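/- Let $k$ be a number field of degree $n$, with real embeddings $\rho_1,\dots,\rho_r$ and with one embedding $\sigma_1,\dots,\sigma_s$ chosen in each pair of conjugate non-real embeddings, so $n=r+2s$. Let $j=(\rho_1,\dots,\rho_r,\sigma_1,\dots,\sigma_s):k\to V:=\mathbb R^r\times\mathbb C^s$, let $$\mathfrak h_1=\Big\{(t,w)\in\mathbb R^r\times\mathbb C^s:\ \sum_i t_i+2\sum_j\operatorname{Re}w_j=0\Big\},$$ acting on $V$ by coordinatewise multiplication by exponentials, and let $\mathcal G_1=\mathfrak h_1\ltimes V$. Let $\Gamma_k\subset\mathfrak h_1$ be the group of all $\tau$ with $e^\tau=j(u)$ for a unit $u\in\mathcal O_k^\times$ that is positive in every real embedding, let $G_k=\Gamma_k\ltimes j(\mathcal O_k)\subset\mathcal G_1$, and let $M_k=G_k\backslash\mathcal G_1$. Then the following hold. (1) $\mathcal G_1$ is a solvable Lie group of dimension $2n-1$, $G_k$ is a discrete subgroup, and $M_k$, with the smooth structure that makes $\mathcal G_1\to M_k$ a local diffeomorphism, is a closed smooth manifold and a smooth $\mathbb T^n$-bundle over $\mathbb T^{n-1}$. (2) The left-invariant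 $1$-form $\sum_i e^{-t_i}d\theta_i+\sum_j\operatorname{Re}(e^{-w_j}dz_j)$ on $\mathcal G_1$ (where $(\theta,z)$ are the coordinates of $V$) descends to a contact form $\alpha_k$ on $M_k$; let $\xi_k=\ker\alpha_k$ with the induced co-orientation. (3) $(M_k,\xi_k)$ is canonical: if $k$ and $k'$ are isomorphic number fields then, for all choices of the complex embeddings $\sigma_j$ for $k$ and for $k'$, $(M_k,\xi_k)$ and $(M_{k'},\xi_{k'})$ are contactomorphic (respecting co-orientations). Moreover, for all $a_i\in\mathbb R$, $c_i>0$, $p_j\in\mathbb C$, $q_j\in\mathbb C\setminus\{0\}$, the left-invariant form $\sum_i(a_i\,dt_i+c_ie^{-t_i}d\theta_i)+\sum_j\operatorname{Re}(p_j\,dw_j+q_je^{-w_j}dz_j)$ (that is, any sum of left-invariant Liouville forms on the factors $\mathrm{Aff}^+(\mathbb R)$ and $\widetilde{\mathrm{Aff}}(\mathbb C)$, with the fixed orientation of $\mathrm{Aff}^+(\mathbb R)$, restricted to $\mathcal G_1$) also descends to a contact form on $M_k$, whose co-oriented contact structure is isotopic to $\xi_k$. (4) If $k$ embeds in $\mathbb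 R$, then for some orientation of $M_k$ there is a Liouville pair $(\alpha_+,\alpha_-)$ on $M_k$: contact forms with $\pm\alpha_\pm\wedge(d\alpha_\pm)^{n-1}>0$ such that $\beta=e^{-s}\alpha_-+e^{s}\alpha_+$ satisfies $(d\beta)^n>0$ on $\mathbb R\times M_k$. They can be chosen such that $(\mathbb R\times M_k,\beta)$ is a Liouville manifold: $d\beta$ is symplectic, the vector field $X$ with $\iota_Xd\beta=\beta$ is complete, and there is a smooth proper function on $\mathbb R\times M_k$, bounded below, whose derivative along $X$ is positive outside a compact set. -/

import Mathlib

open scoped Manifold ContDiff Topology Classical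
open Set Module NumberField NumberField.InfinitePlace NumberField.mixedEmbedding

universe u v

noncomputable section

/-! ## One-forms, contact forms and Liouville pairs on manifolds without boundary -/

section Forms

variable {E : Type*} [NormedAddCommGroup E] [NormedSpace ℝ E]
  {H : Type*} [TopologicalSpace H] (I : ModelWithCorners ℝ E H)
  {E' : Type*} [NormedAddCommGroup E'] [NormedSpace ℝ E']
  {H' : Type*} [TopologicalSpace H'] (J : ModelWithCorners ℝ E' H')
  {EF : Type*} [NormedAddCommGroup EF] [NormedSpace ℝ EF]
  {HF : Type*} [TopologicalSpace HF] (IF : ModelWithCorners ℝ EF HF)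

/-- A (not necessarily smooth) `1`-form on a manifold. -/
abbrev OneForm (M : Type*) [TopologicalSpace M] [ChartedSpace H M] : Type _ :=
  ∀ x : M, TangentSpace I x →L[ℝ] ℝ

variable {M : Type*} [TopologicalSpace M] [ChartedSpace H M]
  {N : Type*} [TopologicalSpace N] [ChartedSpace H' N]
  {F : Type*} [TopologicalSpace F] [ChartedSpace HF F]

namespace OneForm

/-- The pullback `f^* α`. -/
def pullback (f : M → N) (α : OneForm J N) : OneForm I M :=
  fun x => (α (f x)).comp (mfderiv I J f x)

variable {I}

/-- The coordinate expression of `α` in the chart at `x`, i.e. the pullback of `α` by the inverse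
of the chart. Only its values on the target of the chart matter. -/
def inChart (α : OneForm I M) (x : M) (y : E) : E →L[ℝ] ℝ :=
  (α ((extChartAt I x).symm y)).comp (mfderiv 𝓘(ℝ, E) I (extChartAt I x).symm y)

/-- Smoothness of a `1`-form: its coordinate expressions are smooth. -/
def Smooth (α : OneForm I M) : Prop :=
  ∀ x : M, ContDiffOn ℝ ∞ (α.inChart x) (extChartAt I x).target

/-- The exterior derivative `dα`, at the point `x`, as a function of two tangent vectors; it is
computed in the chart at `x` by `dα (u, v) = D_u α (v) - D_v α (u)`. -/
def d (α : OneForm I M) (x : M) (u v : TangentSpace I x) : ℝ :=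
  let D := fderiv ℝ (α.inChart x) (extChartAt I x x)
  let c := mfderiv I 𝓘(ℝ, E) (extChartAt I x) x
  D (c u) (c v) - D (c v) (c u)

end OneForm

/-- `a ∧ η^m`, for a covector `a` and an alternating `2`-form `η`, evaluated on `2m+1` vectors. -/
def wedgeOneTwoPow {V : Type*} (m : ℕ) (a : V → ℝ) (η : V → V → ℝ)
    (v : Fin (2 * m + 1) → V) : ℝ :=
  (1 / 2 : ℝ) ^ m * ∑ τ : Equiv.Perm (Fin (2 * m + 1)), ((Equiv.Perm.sign τ : ℤ) : ℝ) *
    (a (v (τ 0)) * ∏ i : Fin m,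
      η (v (τ ⟨2 * i.1 + 1, by omega⟩)) (v (τ ⟨2 * i.1 + 2, by omega⟩)))

/-- `η^m`, for an alternating `2`-form `η`, evaluated on `2m` vectors. -/
def wedgeTwoPow {V : Type*} (m : ℕ) (η : V → V → ℝ) (v : Fin (2 * m) → V) : ℝ :=
  (1 / 2 : ℝ) ^ m * ∑ τ : Equiv.Perm (Fin (2 * m)), ((Equiv.Perm.sign τ : ℤ) : ℝ) *
    ∏ i : Fin m, η (v (τ ⟨2 * i.1, by omega⟩)) (v (τ ⟨2 * i.1 + 1, by omega⟩))

variable {I}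

/-- The value of `α ∧ (dα)^m` at `x` on a `(2m+1)`-tuple of tangent vectors. -/
def OneForm.contactVolume (m : ℕ) (α : OneForm I M) (x : M)
    (v : Fin (2 * m + 1) → TangentSpace I x) : ℝ :=
  wedgeOneTwoPow m (fun u => α x u) (α.d x) v

/-- `α` is a contact form on the `(2m+1)`-dimensional manifold `M`: a smooth `1`-form such that
`α ∧ (dα)^m` vanishes nowhere. The associated co-oriented contact structure is `ker α`. -/
def IsContactForm (m : ℕ) (α : OneForm I M) : Prop :=
  finrank ℝ E = 2 * m + 1 ∧ α.Smooth ∧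
    ∀ x : M, ∃ v : Fin (2 * m + 1) → TangentSpace I x, α.contactVolume m x v ≠ 0

variable (I M) in
/-- An orientation of a `d`-dimensional manifold: an orientation of each tangent space, varying
continuously. The frame `v` at `x` is transported to nearby points by the chart at `x`. -/
structure ManifoldOrientation (d : ℕ) where
  /-- the orientation of the tangent space at each point -/
  orient : ∀ x : M, Orientation ℝ (TangentSpace I x) (Fin d)
  continuous_orient : ∀ (x : M) (b : Basis (Fin d) ℝ (TangentSpace I x)),
    b.orientation = orient x → ∀ᶠ y in 𝓝 x, ∃ b' : Basis (Fin d) ℝ (TangentSpace I y),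
      b'.orientation = orient y ∧
      ∀ i, b' i = mfderiv 𝓘(ℝ, E) I (extChartAt I x).symm (extChartAt I x y)
        (mfderiv I 𝓘(ℝ, E) (extChartAt I x) x (b i))

/-- The `1`-form `e^{-s} α₋ + e^{s} α₊` on `ℝ × M`. -/
def liouvillePairForm (αp αm : OneForm I M) : OneForm (𝓘(ℝ, ℝ).prod I) (ℝ × M) :=
  fun p => Real.exp (-p.1) • OneForm.pullback (𝓘(ℝ, ℝ).prod I) I Prod.snd αm p +
    Real.exp p.1 • OneForm.pullback (𝓘(ℝ, ℝ).prod I) I Prod.snd αp p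

/-- The frame `(∂_s, v₁, …, v_{2m+1})` of `ℝ × M` at `(s, x)`. Such frames with `v` positive are the
positive frames of the product orientation. -/
def cylinderFrame (m : ℕ) (s : ℝ) (x : M) (v : Fin (2 * m + 1) → TangentSpace I x) :
    Fin (2 * (m + 1)) → TangentSpace (𝓘(ℝ, ℝ).prod I) ((s, x) : ℝ × M) :=
  Fin.cons (n := 2 * m + 1) (α := fun _ => ℝ × E) ((1 : ℝ), (0 : E)) (fun i => ((0 : ℝ), (v i : E)))

/-- `(α₊, α₋)` is a Liouville pair on the `(2m+1)`-dimensional manifold `M` oriented by `o`: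
`α₊` and `α₋` are contact forms with `± α± ∧ (dα±)^m > 0`, and `β = e^{-s} α₋ + e^{s} α₊` satisfies
`(dβ)^{m+1} > 0` on `ℝ × M`. -/
def IsLiouvillePair (m : ℕ) (o : ManifoldOrientation I M (2 * m + 1)) (αp αm : OneForm I M) :
    Prop :=
  IsContactForm m αp ∧ IsContactForm m αm ∧
  (∀ (x : M) (b : Basis (Fin (2 * m + 1)) ℝ (TangentSpace I x)), b.orientation = o.orient x →
    0 < αp.contactVolume m x b ∧ 0 < -αm.contactVolume m x b ∧
    ∀ s : ℝ, 0 < wedgeTwoPow (m + 1) ((liouvillePairForm αp αm).d (s, x))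
      (cylinderFrame m s x b))

/-- `β` is a Liouville form: it is smooth and `dβ` is symplectic. -/
def IsLiouvilleForm (β : OneForm I M) : Prop :=
  β.Smooth ∧ ∀ (x : M) (u : TangentSpace I x), (∀ v, β.d x u v = 0) → u = 0

/-- `(M, β)` is a Liouville manifold (of finite type): `β` is a Liouville form, its dual vector
field `X` is complete, and `M` is convex at infinity, i.e. it has a smooth proper function, bounded
below, that increases along `X` outside a compact set. -/
def IsLiouvilleManifold (β : OneForm I M) : Prop :=
  IsLiouvilleForm β ∧
  ∃ X : ∀ x : M, TangentSpace I x,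
    (∀ x v, β.d x (X x) v = β x v) ∧
    (∀ x, ∃ γ : ℝ → M, γ 0 = x ∧ IsMIntegralCurve (I := I) γ X) ∧
    ∃ (f : M → ℝ) (c : ℝ), ContMDiff I 𝓘(ℝ, ℝ) ∞ f ∧ (∃ b, ∀ x, b ≤ f x) ∧
      (∀ a, IsCompact {x | f x ≤ a}) ∧
      ∀ x, c ≤ f x → (0 : ℝ) < mfderiv I 𝓘(ℝ, ℝ) f x (X x)

variable {J} in
/-- The manifolds with co-oriented contact structures `(M, ker α)` and `(N, ker α')` are
contactomorphic: some diffeomorphism pulls `α'` back to a positive multiple of `α`. -/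
def Contactomorphic (α : OneForm I M) (α' : OneForm J N) : Prop :=
  ∃ (φ : Diffeomorph I J M N ∞) (f : M → ℝ), (∀ x, 0 < f x) ∧
    ∀ x, OneForm.pullback I J φ α' x = f x • α x

/-- The co-oriented contact structures `ker α` and `ker α'` on `M` are isotopic: there is a smooth
isotopy `φ` of `M`, starting at the identity, such that `φ₁` pulls `α'` back to a positive multiple
of `α`. -/
def ContactIsotopic (α α' : OneForm I M) : Prop :=
  ∃ φ : ℝ → Diffeomorph I I M M ∞,
    ContMDiff (𝓘(ℝ, ℝ).prod I) I ∞ (fun p : ℝ × M => φ p.1 p.2) ∧ (∀ x, φ 0 x = x) ∧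
    ∃ f : M → ℝ, (∀ x, 0 < f x) ∧ ∀ x, OneForm.pullback I I (φ 1) α' x = f x • α x

variable (I) in
/-- `p : M → B` is a smooth locally trivial fibre bundle with fibre `F`. -/
def IsSmoothFiberBundle (F : Type*) [TopologicalSpace F] [ChartedSpace HF F]
    (p : M → N) : Prop :=
  ContMDiff I J ∞ p ∧ ∀ b : N, ∃ e : Bundle.Trivialization F p, b ∈ e.baseSet ∧
    ContMDiffOn I (J.prod IF) ∞ e e.source ∧
    ContMDiffOn (J.prod IF) I ∞ e.toOpenPartialHomeomorph.symm e.target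

end Forms

/-- The torus `𝕋^m`, with its product smooth structure. -/
abbrev Torus (m : ℕ) : Type := Fin m → Circle

/-- The model with corners of the torus. -/
abbrev torusModel (m : ℕ) := ModelWithCorners.pi (fun _ : Fin m => 𝓡 1)

/-! ## The solvable Lie group -/

section MixedExp

variable {K : Type u} [Field K]

/-- The coordinatewise exponential `ℝ^r × ℂ^s → ℝ^r × ℂ^s`. -/
def mixedExp (x : mixedSpace K) : mixedSpace K :=
  (fun w => Real.exp (x.1 w), fun w => Complex.exp (x.2 w))

theorem mixedExp_add (x y : mixedSpace K) : mixedExp (x + y) = mixedExp x * mixedExp y := by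
  ext w <;> simp [mixedExp, Real.exp_add, Complex.exp_add]

theorem mixedExp_zero : mixedExp (0 : mixedSpace K) = 1 := by
  ext w <;> simp [mixedExp]

theorem mixedExp_neg_mul (x : mixedSpace K) : mixedExp (-x) * mixedExp x = 1 := by
  rw [← mixedExp_add, neg_add_cancel, mixedExp_zero]

theorem continuous_mixedExp : Continuous (mixedExp : mixedSpace K → mixedSpace K) := by
  unfold mixedExp; fun_prop

end MixedExp

section Group

variable (K : Type u) [Field K] [NumberField K]

/-- The linear form `(t, w) ↦ ∑ tᵢ + 2 ∑ Re wⱼ` on `ℝ^r × ℂ^s`. -/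
def traceForm : mixedSpace K →ₗ[ℝ] ℝ where
  toFun x := (∑ w, x.1 w) + 2 * (∑ w, (x.2 w).re)
  map_add' x y := by simp [Finset.sum_add_distrib]; ring
  map_smul' c x := by simp [Finset.mul_sum, mul_add, mul_left_comm]

/-- The hyperplane `∑ tᵢ + 2 ∑ Re wⱼ = 0` of `ℝ^r × ℂ^s`. -/
abbrev hyperplane : Submodule ℝ (mixedSpace K) := LinearMap.ker (traceForm K)

/-- The underlying vector space of the solvable group. -/
abbrev SolvModel : Type u := hyperplane K × mixedSpace K

/-- The group `{∑ tᵢ + 2 ∑ Re wⱼ = 0} ⋉ (ℝ^r × ℂ^s)`, an element `(t, z)` of which acts on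
`ℝ^r × ℂ^s` by the affine map `x ↦ e^t x + z`, and is the list of these affine maps in the
coordinates, of total determinant `1` (together with logarithms of the linear parts). -/
def SolvGroup : Type u := SolvModel K

instance : TopologicalSpace (SolvGroup K) := inferInstanceAs (TopologicalSpace (SolvModel K))

/-- As a manifold, the group is the vector space `SolvModel K`. -/
instance : ChartedSpace (SolvModel K) (SolvGroup K) :=
  chartedSpaceSelf (SolvModel K)

variable {K}

instance : Group (SolvGroup K) where
  mul g h := ((g.1 + h.1, g.2 + mixedExp g.1.1 * h.2) : SolvModel K)
  one := ((0, 0) : SolvModel K)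
  inv g := ((-g.1, -(mixedExp (-g.1.1) * g.2)) : SolvModel K)
  mul_assoc a b c := by
    refine Prod.ext (add_assoc _ _ _) ?_
    change (a.2 + mixedExp a.1.1 * b.2) + mixedExp (a.1.1 + b.1.1) * c.2 =
      a.2 + mixedExp a.1.1 * (b.2 + mixedExp b.1.1 * c.2)
    rw [mixedExp_add]; ring
  one_mul a := by
    refine Prod.ext (zero_add _) ?_
    change (0 : mixedSpace K) + mixedExp (0 : mixedSpace K) * a.2 = a.2
    rw [mixedExp_zero]; ring
  mul_one a := by
    refine Prod.ext (add_zero _) ?_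
    change a.2 + mixedExp a.1.1 * 0 = a.2
    ring
  inv_mul_cancel a := by
    refine Prod.ext (neg_add_cancel _) ?_
    change -(mixedExp (-a.1.1) * a.2) + mixedExp (-a.1.1) * a.2 = (0 : mixedSpace K)
    ring

instance : IsTopologicalGroup (SolvGroup K) where
  continuous_mul := by
    change Continuous fun p : SolvModel K × SolvModel K =>
      ((p.1.1 + p.2.1, p.1.2 + mixedExp p.1.1.1 * p.2.2) : SolvModel K)
    have := continuous_mixedExp (K := K)
    fun_prop
  continuous_inv := by
    change Continuous fun p : SolvModel K => ((-p.1, -(mixedExp (-p.1.1) * p.2)) : SolvModel K)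
    have := continuous_mixedExp (K := K)
    fun_prop

/-! ## The lattice -/

variable (K) in
/-- A choice of one complex embedding in each conjugate pair of non-real embeddings. -/
abbrev EmbeddingChoice : Type u :=
  ∀ w : {w : InfinitePlace K // IsComplex w}, {φ : K →+* ℂ // InfinitePlace.mk φ = w.1}

instance : Nonempty (EmbeddingChoice K) :=
  ⟨fun w => ⟨w.1.embedding, InfinitePlace.mk_embedding w.1⟩⟩

/-- The map `j : K → ℝ^r × ℂ^s` whose coordinates are the real embeddings and the chosen complex
embeddings. -/
def jEmbedding (σ : EmbeddingChoice K) : K →+* mixedSpace K :=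
  RingHom.prod (RingHom.pi fun w => embedding_of_isReal w.2) (RingHom.pi fun w => (σ w).1)

variable (K) in
/-- The group of units of `K` that are positive in all real embeddings. -/
def positiveUnits : Subgroup (𝓞 K)ˣ where
  carrier := {x | ∀ w : {w : InfinitePlace K // IsReal w}, 0 < embedding_of_isReal w.2 (x : K)}
  mul_mem' hx hy w := by simpa using mul_pos (hx w) (hy w)
  one_mem' w := by simp
  inv_mem' {x} hx w := by
    have h : embedding_of_isReal w.2 (x : K) * embedding_of_isReal w.2 ((x⁻¹ : (𝓞 K)ˣ) : K) = 1 := by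
      rw [← map_mul]; simp
    exact pos_of_mul_pos_right (h ▸ one_pos) (hx w).le

/-- The preimage of the positive units under the exponential map. -/
def unitLattice (σ : EmbeddingChoice K) : AddSubgroup (hyperplane K) where
  carrier := {t | ∃ x ∈ positiveUnits K, mixedExp t.1 = jEmbedding σ (x : K)}
  add_mem' := by
    rintro a b ⟨x, hx, ha⟩ ⟨y, hy, hb⟩
    refine ⟨x * y, mul_mem hx hy, ?_⟩
    simp [mixedExp_add, ha, hb]
  zero_mem' := ⟨1, one_mem _, by simp [mixedExp_zero]⟩
  neg_mem' := by
    rintro a ⟨x, hx, ha⟩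
    refine ⟨x⁻¹, inv_mem hx, ?_⟩
    have h1 := mixedExp_neg_mul a.1
    rw [ha] at h1
    have h2 : jEmbedding σ (x : K) * jEmbedding σ ((x⁻¹ : (𝓞 K)ˣ) : K) = 1 := by
      rw [← map_mul]; simp
    exact left_inv_eq_right_inv h1 h2

/-- The lattice: the semidirect product of `unitLattice σ` and the image of the ring of integers. -/
def solvLattice (σ : EmbeddingChoice K) : Subgroup (SolvGroup K) where
  carrier := {g | g.1 ∈ unitLattice σ ∧ ∃ x : 𝓞 K, g.2 = jEmbedding σ (x : K)}
  mul_mem' := by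
    rintro a b ⟨ha, x, hx⟩ ⟨hb, y, hy⟩
    refine ⟨add_mem ha hb, ?_⟩
    obtain ⟨e, -, he⟩ := ha
    refine ⟨x + e * y, ?_⟩
    change a.2 + mixedExp a.1.1 * b.2 = _
    simp [hx, hy, he]
  one_mem' := ⟨zero_mem _, 0, by simp only [map_zero]; rfl⟩
  inv_mem' := by
    rintro a ⟨ha, x, hx⟩
    refine ⟨neg_mem ha, ?_⟩
    obtain ⟨e, -, he⟩ := neg_mem ha
    refine ⟨-(e * x), ?_⟩
    change -(mixedExp (-a.1.1) * a.2) = _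
    rw [NegMemClass.coe_neg] at he
    simp [hx, he]

theorem eq_zero_of_norm_jEmbedding_lt (σ : EmbeddingChoice K) (x : 𝓞 K)
    (h : ‖jEmbedding σ (x : K)‖ < 1) : x = 0 := by
  by_contra hx
  have hlt : ∀ w : InfinitePlace K, w (x : K) < 1 := by
    intro w
    refine lt_of_le_of_lt ?_ h
    obtain hw | hw := w.isReal_or_isComplex
    · calc w (x : K) = ‖(jEmbedding σ (x : K)).1 ⟨w, hw⟩‖ := by
            rw [← norm_embedding_of_isReal hw]; rfl
        _ ≤ ‖(jEmbedding σ (x : K)).1‖ := norm_le_pi_norm _ _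
        _ ≤ _ := norm_fst_le _
    · calc w (x : K) = ‖(jEmbedding σ (x : K)).2 ⟨w, hw⟩‖ := by
            have := (σ ⟨w, hw⟩).2
            rw [show ‖(jEmbedding σ (x : K)).2 ⟨w, hw⟩‖ = InfinitePlace.mk (σ ⟨w, hw⟩).1 (x : K)
              from rfl, this]
        _ ≤ ‖(jEmbedding σ (x : K)).2‖ := norm_le_pi_norm _ _
        _ ≤ _ := norm_snd_le _
  obtain ⟨w⟩ := (inferInstance : Nonempty (InfinitePlace K))
  exact absurd (InfinitePlace.one_le_of_lt_one (w := w) hx (fun z _ => hlt z)) (not_le.2 (hlt w))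

theorem isDiscrete_solvLattice (σ : EmbeddingChoice K) :
    IsDiscrete (solvLattice σ : Set (SolvGroup K)) := by
  have hV : {g : SolvGroup K | ‖mixedExp (g.1 : mixedSpace K) - 1‖ < 1 ∧ ‖(g.1 : mixedSpace K)‖ < 1 ∧
      ‖(g.2 : mixedSpace K)‖ < 1} ∈ 𝓝 (1 : SolvGroup K) := by
    have hc : Continuous fun g : SolvModel K => ‖mixedExp (g.1 : mixedSpace K) - 1‖ := by
      have := continuous_mixedExp (K := K)
      fun_prop
    have hc1 : Continuous fun g : SolvModel K => ‖(g.1 : mixedSpace K)‖ := by fun_prop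
    have hc2 : Continuous fun g : SolvModel K => ‖g.2‖ := by fun_prop
    refine Filter.inter_mem ?_ (Filter.inter_mem ?_ ?_)
    · refine hc.continuousAt.preimage_mem_nhds (Iio_mem_nhds ?_)
      change ‖mixedExp (0 : mixedSpace K) - 1‖ < 1
      simp [mixedExp_zero]
    · refine hc1.continuousAt.preimage_mem_nhds (Iio_mem_nhds ?_)
      change ‖(0 : mixedSpace K)‖ < 1
      simp
    · refine hc2.continuousAt.preimage_mem_nhds (Iio_mem_nhds ?_)
      change ‖(0 : mixedSpace K)‖ < 1
      simp
  have key : ∀ g ∈ solvLattice σ, ‖mixedExp (g.1 : mixedSpace K) - 1‖ < 1 →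
      ‖(g.1 : mixedSpace K)‖ < 1 → ‖(g.2 : mixedSpace K)‖ < 1 → g = 1 := by
    rintro g ⟨⟨e, -, he⟩, x, hx⟩ h1 h2 h3
    have hx0 : x = 0 := eq_zero_of_norm_jEmbedding_lt σ x (hx ▸ h3)
    have he0 : (e : 𝓞 K) - 1 = 0 := by
      refine eq_zero_of_norm_jEmbedding_lt σ _ ?_
      rw [he] at h1
      simpa using h1
    have he1 : mixedExp (g.1 : mixedSpace K) = 1 := by
      rw [he, sub_eq_zero.1 he0]; simp
    have hg1 : (g.1 : mixedSpace K) = 0 := by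
      refine Prod.ext (funext fun w => ?_) (funext fun w => ?_)
      · have := congrFun (congrArg Prod.fst he1) w
        simpa [mixedExp] using this
      · have := congrFun (congrArg Prod.snd he1) w
        obtain ⟨k, hk⟩ := Complex.exp_eq_one_iff.1 this
        have hn : ‖(g.1 : mixedSpace K).2 w‖ < 1 :=
          ((norm_le_pi_norm _ w).trans (norm_snd_le _)).trans_lt h2
        rw [hk]
        rw [hk] at hn
        have hk0 : k = 0 := by
          by_contra hk0
          have h4 : (1 : ℝ) ≤ |(k : ℝ)| := by exact_mod_cast Int.one_le_abs hk0
          simp [abs_of_pos Real.pi_pos] at hn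
          nlinarith [Real.pi_gt_three]
        simp [hk0]
    refine Prod.ext (Subtype.ext hg1) ?_
    rw [hx, hx0]
    simp only [map_zero]
    rfl
  rw [SetLike.isDiscrete_iff_discreteTopology]
  refine discreteTopology_of_isOpen_singleton_one (isOpen_singleton_iff_nhds_eq_pure _ |>.2 ?_)
  refine le_antisymm (Filter.le_pure_iff.2 ?_) (pure_le_nhds _)
  have hs : Filter.Tendsto (Subtype.val : solvLattice σ → SolvGroup K) (𝓝 1) (𝓝 1) :=
    continuous_subtype_val.continuousAt
  filter_upwards [hs hV] with g hg
  exact Subtype.ext (key g.1 g.2 hg.1 hg.2.1 hg.2.2)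

variable (K) in
/-- The closed manifold: the quotient of the solvable group by left translations by the lattice. -/
def NFManifold (σ : EmbeddingChoice K) : Type u :=
  Quotient (QuotientGroup.rightRel (solvLattice σ))

instance (σ : EmbeddingChoice K) : TopologicalSpace (NFManifold K σ) :=
  inferInstanceAs (TopologicalSpace (Quotient (QuotientGroup.rightRel (solvLattice σ))))

/-- The quotient map. -/
def nfProj (σ : EmbeddingChoice K) (g : SolvGroup K) : NFManifold K σ :=
  Quotient.mk (QuotientGroup.rightRel (solvLattice σ)) g

theorem nfProj_surjective (σ : EmbeddingChoice K) : Function.Surjective (nfProj σ) :=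
  Quotient.mk_surjective

theorem isLocalHomeomorph_nfProj (σ : EmbeddingChoice K) : IsLocalHomeomorph (nfProj σ) :=
  ((isQuotientMap_quotient_mk' (s := QuotientGroup.rightRel (solvLattice σ))
    ).isQuotientCoveringMap_of_subgroup (solvLattice σ) (isDiscrete_solvLattice σ)
      (Quotient.eq''.trans QuotientGroup.rightRel_apply)).isCoveringMap.isLocalHomeomorph

/-- The manifold structure for which the quotient map is a local diffeomorphism; the charts are
local inverses of the quotient map. -/
instance (σ : EmbeddingChoice K) : ChartedSpace (SolvModel K) (NFManifold K σ) :=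
  (isLocalHomeomorph_nfProj σ).chartedSpace (nfProj_surjective σ)

/-! ## Left-invariant forms -/

/-- The left-invariant `1`-form on the group whose value at the identity is `ℓ`. -/
def leftInvariantForm (ℓ : SolvModel K →L[ℝ] ℝ) :
    OneForm 𝓘(ℝ, SolvModel K) (SolvGroup K) :=
  fun g => ℓ.comp (mfderiv 𝓘(ℝ, SolvModel K) 𝓘(ℝ, SolvModel K) (fun h : SolvGroup K => g⁻¹ * h) g)

/-- The `1`-form on the quotient induced by the left-invariant form with value `ℓ` at the
identity. -/
def inducedForm (σ : EmbeddingChoice K) (ℓ : SolvModel K →L[ℝ] ℝ) :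
    OneForm 𝓘(ℝ, SolvModel K) (NFManifold K σ) :=
  fun p =>
    let g : SolvGroup K := Quotient.out p
    (leftInvariantForm ℓ g).comp
      (mfderiv 𝓘(ℝ, SolvModel K) 𝓘(ℝ, SolvModel K) (nfProj σ) g).inverse

/-- The restriction to `SolvModel K` of the covector
`(τ, ζ) ↦ ∑ (aᵢ τᵢ + cᵢ ζᵢ) + ∑ Re (pⱼ τⱼ + qⱼ ζⱼ)` on the Lie algebra of the product of the factors
`Aff⁺(ℝ)` (coordinates `(t, θ)`) and the universal cover of `Aff(ℂ)` (coordinates `(w, z)`).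
The corresponding left-invariant forms are `aᵢ dtᵢ + cᵢ e^{-tᵢ} dθᵢ`, with exterior derivative
`-cᵢ e^{-tᵢ} dtᵢ ∧ dθᵢ`, and `Re (pⱼ dwⱼ + qⱼ e^{-wⱼ} dzⱼ)`, with exterior derivative
`-Re (qⱼ e^{-wⱼ} dwⱼ ∧ dzⱼ)`. Hence they are Liouville forms on the factors if and only if all `cᵢ`
and `qⱼ` are nonzero, and the sign of `cᵢ` is the choice of an orientation of `Aff⁺(ℝ)`. -/
def factorCovector (a c : {w : InfinitePlace K // IsReal w} → ℝ)
    (p q : {w : InfinitePlace K // IsComplex w} → ℂ) : SolvModel K →L[ℝ] ℝ :=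
  LinearMap.toContinuousLinearMap
    { toFun := fun x => ∑ w, (a w * x.1.1.1 w + c w * x.2.1 w) +
        ∑ w, (p w * x.1.1.2 w + q w * x.2.2 w).re
      map_add' := fun x y => by
        simp only [Prod.fst_add, Prod.snd_add, Submodule.coe_add,
          Pi.add_apply]
        rw [add_add_add_comm, ← Finset.sum_add_distrib, ← Finset.sum_add_distrib]
        congr 1 <;> refine Finset.sum_congr rfl fun w _ => ?_
        · ring
        · rw [← Complex.add_re]; congr 1; ring
      map_smul' := fun r x => by
        simp only [Prod.smul_fst, Prod.smul_snd, Submodule.coe_smul, Pi.smul_apply, smul_eq_mul,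
          RingHom.id_apply, mul_add, Finset.mul_sum]
        congr 1 <;> refine Finset.sum_congr rfl fun w _ => ?_
        · ring
        · simp only [Complex.real_smul, Complex.add_re, Complex.mul_re, Complex.mul_im,
            Complex.ofReal_re, Complex.ofReal_im]; ring }

/-- The contact form `∑ e^{-tᵢ} dθᵢ + ∑ Re (e^{-wⱼ} dzⱼ)` on the quotient. -/
def nfContactForm (σ : EmbeddingChoice K) : OneForm 𝓘(ℝ, SolvModel K) (NFManifold K σ) :=
  inducedForm σ (factorCovector 0 1 0 1)

end Group

end

/-! The charts of the quotient are local inverses of the covering projection π, and any two of them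
differ locally by left translation by a lattice element (`exists_eventually_localInv_proj_eq`). In
every chart the form induced by a covector ℓ is therefore the same left-invariant form on the
covering, and its exterior derivative is -ℓ([u, v]) in left-invariant frames (`d_inducedForm`). All
contact and symplectic conditions become linear algebra on the Lie algebra.

Take real coordinates t_k on the hyperplane and φ_k on V, the latter with a sign at imaginary parts.
The trace relation reads ∑ c_k t_k = 0, the standard covector is ∑ e_k φ_k, and its derivative is -∑
t_k ∧ φ_k. Eliminating one t_0 with c_0 ≠ 0 leaves m = n - 1 pairs, and α ∧ (dα)^m becomes m! (-1)^m
(∑ c_k e_k) / c_0 times the determinant of a coordinate system (`wedgeOneTwoPow_of_relation`). Since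
∑ c_k e_k = r + 2s = n, this does not vanish. The passage from wedge powers to determinants is
`sum_sign_mul_prod_minors`.

Right translations descend to the quotient and act on left-invariant forms by the coadjoint action.
A suitable one carries any of the given Liouville sums to a positive multiple of the standard form
(`exists_adjointMap_factorCovector`), and scaling the translating element down to the identity gives
the isotopy. A field isomorphism permutes the places, with a conjugation at complex places if
necessary; real parts do not see the conjugation (`contactomorphic_of_ringEquiv`).

Compactness and the torus bundle rest on arithmetic: the integers form a lattice in V, and the
logarithms of positive units form a lattice in the hyperplane, by Dirichlet's theorem for squares of
units together with the periods 2πi at complex places (`span_unitLattice`).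

For the Liouville pair, the coefficient of φ_0 at one real place is replaced by ±1, which reverses
the contact volume. Then β = 2 sinh s φ_0 + 2 cosh s ∑ e_k φ_k, the sum running over the other
indices. The same elimination shows (dβ)^n > 0 (`exists_isLiouvillePair`), and the Liouville field
is explicit enough to be integrated for all time (`isLiouvilleManifold_pair`). -/

noncomputable section

/-! ### The solvable Lie group and its dimension -/

section SolvGroupStructure

variable {K : Type u} [Field K]

theorem contDiff_mixedExp [NumberField K] :
    ContDiff ℝ ∞ (mixedExp : mixedSpace K → mixedSpace K) := by
  unfold mixedExp
  refine ContDiff.prodMk ?_ ?_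
  · refine contDiff_pi.2 fun w => ?_
    exact Real.contDiff_exp.comp (by fun_prop)
  · refine contDiff_pi.2 fun w => ?_
    have h : ContDiff ℝ ∞ Complex.exp := Complex.contDiff_exp
    exact h.comp (by fun_prop)

variable [NumberField K]

/-- Left translation of the solvable group, on the underlying vector space. -/
def leftTranslate (a b : SolvModel K) : SolvModel K :=
  (a.1 + b.1, a.2 + mixedExp a.1.1 * b.2)

/-- The derivative of a left translation: `(τ, ζ) ↦ (τ, e^t ζ)`. -/
def scaleMap (t : mixedSpace K) : SolvModel K →L[ℝ] SolvModel K :=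
  (ContinuousLinearMap.fst ℝ _ _).prod
    ((ContinuousLinearMap.mul ℝ (mixedSpace K) (mixedExp t)).comp (ContinuousLinearMap.snd ℝ _ _))

@[simp] theorem scaleMap_apply (t : mixedSpace K) (x : SolvModel K) :
    scaleMap t x = (x.1, mixedExp t * x.2) := rfl

theorem scaleMap_add (s t : mixedSpace K) : scaleMap (s + t) = (scaleMap s).comp (scaleMap t) := by
  refine ContinuousLinearMap.ext fun x => ?_
  simp [mixedExp_add, mul_assoc]

theorem scaleMap_zero : scaleMap (0 : mixedSpace K) = ContinuousLinearMap.id ℝ _ := by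
  refine ContinuousLinearMap.ext fun x => ?_
  simp [mixedExp_zero]

theorem contDiff_leftTranslate :
    ContDiff ℝ ∞ fun p : SolvModel K × SolvModel K => leftTranslate p.1 p.2 := by
  unfold leftTranslate
  refine ContDiff.prodMk (by fun_prop) ?_
  refine ContDiff.add (by fun_prop) (ContDiff.mul ?_ (by fun_prop))
  refine contDiff_mixedExp.comp ?_
  exact (hyperplane K).subtypeL.contDiff.comp (by fun_prop)

theorem contDiff_leftTranslate_left (a : SolvModel K) : ContDiff ℝ ∞ (leftTranslate a) :=
  (contDiff_leftTranslate (K := K)).comp (contDiff_const.prodMk contDiff_id)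

theorem hasFDerivAt_leftTranslate (a b : SolvModel K) :
    HasFDerivAt (leftTranslate a) (scaleMap a.1.1) b := by
  have : leftTranslate a = fun b => a + scaleMap a.1.1 b := rfl
  rw [this]
  exact (scaleMap a.1.1).hasFDerivAt.const_add a

instance lieGroup_solvGroup : LieGroup 𝓘(ℝ, SolvModel K) ∞ (SolvGroup K) where
  toIsManifold := inferInstanceAs (IsManifold 𝓘(ℝ, SolvModel K) ∞ (SolvModel K))
  contMDiff_mul := by
    have h : ContMDiff 𝓘(ℝ, SolvModel K × SolvModel K) 𝓘(ℝ, SolvModel K) ∞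
        fun p : SolvModel K × SolvModel K => leftTranslate p.1 p.2 :=
      contDiff_leftTranslate.contMDiff
    rw [modelWithCornersSelf_prod, ← chartedSpaceSelf_prod] at h
    exact h
  contMDiff_inv := by
    have h : ContDiff ℝ ∞ fun g : SolvModel K =>
        ((-g.1, -(mixedExp (-g.1.1) * g.2)) : SolvModel K) := by
      refine ContDiff.prodMk (by fun_prop) (ContDiff.neg (ContDiff.mul ?_ (by fun_prop)))
      refine contDiff_mixedExp.comp (ContDiff.neg ?_)
      exact (hyperplane K).subtypeL.contDiff.comp (by fun_prop)
    exact h.contMDiff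

/-- The projection of the solvable group onto its abelian quotient. -/
def solvGroupFst : SolvGroup K →* Multiplicative (hyperplane K) where
  toFun g := Multiplicative.ofAdd g.1
  map_one' := rfl
  map_mul' _ _ := rfl

/-- The inclusion of the abelian normal subgroup. -/
def solvGroupInr : Multiplicative (mixedSpace K) →* SolvGroup K where
  toFun z := ((0, z.toAdd) : SolvModel K)
  map_one' := rfl
  map_mul' x y := by
    refine Prod.ext (add_zero _).symm ?_
    change x.toAdd + y.toAdd = x.toAdd + mixedExp 0 * y.toAdd
    rw [mixedExp_zero, one_mul]

/-- The group is an extension of the additive group of the hyperplane by the abelian group of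
translations. -/
theorem isSolvable_solvGroup : Group.IsSolvable (SolvGroup K) := by
  refine Group.isSolvable_of_ker_le_range (solvGroupInr (K := K)) solvGroupFst fun g hg => ?_
  refine ⟨Multiplicative.ofAdd g.2, Prod.ext ?_ rfl⟩
  exact (congrArg Multiplicative.toAdd (MonoidHom.mem_ker.1 hg)).symm

/-- A linear form to ℝ is onto unless it is zero, and this one takes the value r + 2s = n > 0 at the
unit element. -/
theorem traceForm_surjective : Function.Surjective (traceForm K) := by
  refine LinearMap.surjective ?_
  intro h
  have h1 := LinearMap.congr_fun h (1 : mixedSpace K)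
  have h2 : (traceForm K) 1 = finrank ℚ K := by
    rw [← card_add_two_mul_card_eq_rank K]
    simp [traceForm]
  rw [h2] at h1
  have := finrank_pos (R := ℚ) (M := K)
  simp at h1
  omega

theorem finrank_hyperplane : finrank ℝ (hyperplane K) + 1 = finrank ℚ K := by
  have h := (traceForm K).finrank_range_add_finrank_ker
  rw [LinearMap.range_eq_top.2 traceForm_surjective, finrank_top, finrank_self,
    mixedEmbedding.finrank] at h
  rw [← h, add_comm]

theorem finrank_solvModel : finrank ℝ (SolvModel K) = 2 * finrank ℚ K - 1 := by
  rw [finrank_prod, mixedEmbedding.finrank, ← finrank_hyperplane]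
  omega

end SolvGroupStructure

/-! ### The smooth structure of the quotient -/

section QuotientManifold

variable {K : Type u} [Field K] [NumberField K] (σ : EmbeddingChoice K)

/-- The quotient map, as a map defined on the vector space underlying the solvable group. -/
def proj : SolvModel K → NFManifold K σ := nfProj σ

theorem proj_eq_proj_iff {a b : SolvModel K} :
    proj σ a = proj σ b ↔ ∃ γ ∈ solvLattice σ, leftTranslate γ a = b := by
  have h (a b : SolvGroup K) : proj σ a = proj σ b ↔ b * a⁻¹ ∈ solvLattice σ :=
    Quotient.eq''.trans QuotientGroup.rightRel_apply
  refine (h a b).trans ?_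
  constructor
  · intro h
    have h' (a b : SolvGroup K) : b * a⁻¹ * a = b := inv_mul_cancel_right b a
    exact ⟨_, h, h' a b⟩
  · rintro ⟨γ, hγ, rfl⟩
    have h' (a γ : SolvGroup K) (hγ : γ ∈ solvLattice σ) : γ * a * a⁻¹ ∈ solvLattice σ := by
      rwa [mul_inv_cancel_right]
    exact h' a γ hγ

theorem proj_leftTranslate {γ : SolvGroup K} (hγ : γ ∈ solvLattice σ) (a : SolvModel K) :
    proj σ (leftTranslate γ a) = proj σ a :=
  ((proj_eq_proj_iff σ).2 ⟨γ, hγ, rfl⟩).symm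

theorem continuous_proj : Continuous (proj σ) := (isLocalHomeomorph_nfProj σ).continuous

theorem isOpenMap_proj : IsOpenMap (proj σ) := (isLocalHomeomorph_nfProj σ).isOpenMap

theorem proj_surjective : Function.Surjective (proj σ) := nfProj_surjective σ

/-- The local inverse of the quotient map at a given point. -/
def localInv (g : SolvModel K) : OpenPartialHomeomorph (NFManifold K σ) (SolvModel K) :=
  (isLocalHomeomorph_nfProj σ).localInverseAt g

theorem localInv_symm (g : SolvModel K) : ⇑(localInv σ g).symm = proj σ :=
  (isLocalHomeomorph_nfProj σ).localInverseAt_symm g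

theorem mem_localInv_source (g : SolvModel K) : proj σ g ∈ (localInv σ g).source :=
  (isLocalHomeomorph_nfProj σ).apply_self_mem_localInverseAt_source

theorem mem_localInv_target (g : SolvModel K) : g ∈ (localInv σ g).target :=
  (isLocalHomeomorph_nfProj σ).self_mem_localInverseAt_target

theorem localInv_proj_self (g : SolvModel K) : localInv σ g (proj σ g) = g :=
  (isLocalHomeomorph_nfProj σ).localInverseAt_apply_self

theorem proj_localInv (g : SolvModel K) {x : NFManifold K σ} (hx : x ∈ (localInv σ g).source) :
    proj σ (localInv σ g x) = x :=
  (isLocalHomeomorph_nfProj σ).apply_localInverseAt_of_mem hx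

/-- A local inverse of π composed with π is a lift of π, so at y it is a deck transformation γ. The
target of the local inverse is open, so near y the point `leftTranslate γ z` stays in it and is the
value of the lift there: the same γ works on a neighbourhood. All smoothness statements about the
quotient reduce to the smoothness of left translations through this lemma. -/
theorem exists_eventually_localInv_proj_eq (g y : SolvModel K)
    (hy : proj σ y ∈ (localInv σ g).source) :
    ∃ γ ∈ solvLattice σ, localInv σ g (proj σ y) = leftTranslate γ y ∧
      ∀ᶠ z in 𝓝 y, proj σ z ∈ (localInv σ g).source ∧
        localInv σ g (proj σ z) = leftTranslate γ z := by
  obtain ⟨γ, hγ, h⟩ := (proj_eq_proj_iff σ).1 (proj_localInv σ g hy).symm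
  refine ⟨γ, hγ, h.symm, ?_⟩
  have h1 : leftTranslate γ y ∈ (localInv σ g).target := by
    rw [h]; exact (localInv σ g).map_source hy
  have h2 : ∀ᶠ z in 𝓝 y, leftTranslate γ z ∈ (localInv σ g).target :=
    ((contDiff_leftTranslate_left γ).continuous.tendsto y).eventually
      ((localInv σ g).open_target.mem_nhds h1)
  filter_upwards [h2] with z hz
  have h3 := (localInv σ g).right_inv hz
  have h4 := (localInv σ g).map_target hz
  rw [localInv_symm, proj_leftTranslate σ hγ] at h3 h4
  exact ⟨h4, h3⟩

/-- The representative in the group of a point of the quotient that is the centre of its chart. -/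
def chartCenter (x : NFManifold K σ) : SolvModel K :=
  (nfProj_surjective σ).hasRightInverse.choose x

theorem proj_chartCenter (x : NFManifold K σ) : proj σ (chartCenter σ x) = x :=
  (nfProj_surjective σ).hasRightInverse.choose_spec x

theorem chartAt_eq_localInv (x : NFManifold K σ) :
    chartAt (SolvModel K) x = localInv σ (chartCenter σ x) := by
  change (localInv σ (chartCenter σ x)).trans (OpenPartialHomeomorph.refl _) = _
  exact OpenPartialHomeomorph.trans_refl _

theorem extChartAt_eq_localInv (x : NFManifold K σ) :
    extChartAt 𝓘(ℝ, SolvModel K) x = (localInv σ (chartCenter σ x)).toPartialEquiv := by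
  rw [extChartAt, chartAt_eq_localInv]
  exact PartialEquiv.trans_refl _

theorem extChartAt_self (x : NFManifold K σ) :
    extChartAt 𝓘(ℝ, SolvModel K) x x = chartCenter σ x := by
  rw [extChartAt_eq_localInv]
  change localInv σ (chartCenter σ x) x = _
  conv_lhs => rw [← proj_chartCenter σ x, proj_chartCenter σ x]
  have := localInv_proj_self σ (chartCenter σ x)
  rwa [proj_chartCenter] at this

theorem extChartAt_symm (x : NFManifold K σ) :
    ⇑(extChartAt 𝓘(ℝ, SolvModel K) x).symm = proj σ := by
  rw [extChartAt_eq_localInv]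
  exact localInv_symm σ _

/-- The transition maps are locally left translations by lattice elements. -/
instance isManifold_nfManifold : IsManifold 𝓘(ℝ, SolvModel K) ∞ (NFManifold K σ) := by
  refine isManifold_of_contDiffOn _ _ _ ?_
  have h : ∀ e ∈ atlas (SolvModel K) (NFManifold K σ), ∃ x, e = localInv σ (chartCenter σ x) := by
    rintro _ ⟨x, rfl⟩
    exact ⟨x, OpenPartialHomeomorph.trans_refl _⟩
  intro e e' he he'
  obtain ⟨x, rfl⟩ := h e he
  obtain ⟨x', rfl⟩ := h e' he'
  rintro y ⟨hy, -⟩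
  have hy : proj σ y ∈ (localInv σ (chartCenter σ x')).source := by
    have := hy.2
    rw [← localInv_symm σ (chartCenter σ x)]
    exact this
  obtain ⟨γ, -, -, hγ⟩ := exists_eventually_localInv_proj_eq σ _ y hy
  refine ContDiffAt.contDiffWithinAt ?_
  refine (contDiff_leftTranslate_left γ).contDiffAt.congr_of_eventuallyEq ?_
  filter_upwards [hγ] with z hz
  rw [← hz.2, ← localInv_symm σ (chartCenter σ x)]
  rfl

theorem exists_eventually_extChartAt_proj_eq (x : NFManifold K σ) (y : SolvModel K)
    (hy : proj σ y ∈ (chartAt (SolvModel K) x).source) :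
    ∃ γ ∈ solvLattice σ, extChartAt 𝓘(ℝ, SolvModel K) x (proj σ y) = leftTranslate γ y ∧
      ∀ᶠ z in 𝓝 y, extChartAt 𝓘(ℝ, SolvModel K) x (proj σ z) = leftTranslate γ z := by
  rw [chartAt_eq_localInv] at hy
  rw [extChartAt_eq_localInv]
  obtain ⟨γ, h1, h2, h3⟩ := exists_eventually_localInv_proj_eq σ _ y hy
  exact ⟨γ, h1, h2, h3.mono fun z hz => hz.2⟩

/-- The derivative of the quotient map in the charts of the quotient. -/
theorem exists_hasMFDerivAt_proj (y : SolvModel K) :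
    ∃ γ ∈ solvLattice σ, chartCenter σ (proj σ y) = leftTranslate γ y ∧
      HasMFDerivAt 𝓘(ℝ, SolvModel K) 𝓘(ℝ, SolvModel K) (proj σ) y (scaleMap γ.1.1) := by
  obtain ⟨γ, h1, h2, h3⟩ :=
    exists_eventually_extChartAt_proj_eq σ (proj σ y) y (mem_chart_source _ _)
  refine ⟨γ, h1, by rw [← h2, extChartAt_self], (continuous_proj σ).continuousAt, ?_⟩
  refine HasFDerivAt.hasFDerivWithinAt ?_
  exact (hasFDerivAt_leftTranslate γ y).congr_of_eventuallyEq h3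

theorem contMDiff_proj : ContMDiff 𝓘(ℝ, SolvModel K) 𝓘(ℝ, SolvModel K) ∞ (proj σ) := by
  intro y
  obtain ⟨γ, h1, h2, h3⟩ :=
    exists_eventually_extChartAt_proj_eq σ (proj σ y) y (mem_chart_source _ _)
  rw [contMDiffAt_iff]
  refine ⟨(continuous_proj σ).continuousAt, ContDiffAt.contDiffWithinAt ?_⟩
  exact (contDiff_leftTranslate_left γ).contDiffAt.congr_of_eventuallyEq h3

theorem contMDiffOn_localInv (g : SolvModel K) :
    ContMDiffOn 𝓘(ℝ, SolvModel K) 𝓘(ℝ, SolvModel K) ∞ (localInv σ g) (localInv σ g).source := by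
  intro x hx
  refine ContMDiffAt.contMDiffWithinAt ?_
  rw [contMDiffAt_iff]
  refine ⟨(localInv σ g).continuousAt hx, ContDiffAt.contDiffWithinAt ?_⟩
  rw [extChartAt_self, extChartAt_symm]
  have hx' : proj σ (chartCenter σ x) ∈ (localInv σ g).source := by rwa [proj_chartCenter]
  obtain ⟨γ, h1, h2, h3⟩ := exists_eventually_localInv_proj_eq σ g _ hx'
  refine (contDiff_leftTranslate_left γ).contDiffAt.congr_of_eventuallyEq ?_
  filter_upwards [h3] with z hz using hz.2

theorem isLocalDiffeomorph_proj :
    IsLocalDiffeomorph 𝓘(ℝ, SolvModel K) 𝓘(ℝ, SolvModel K) ∞ (proj σ) := by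
  intro g
  refine ⟨⟨(localInv σ g).symm.toPartialEquiv, (localInv σ g).open_target,
    (localInv σ g).open_source, ?_, contMDiffOn_localInv σ g⟩, mem_localInv_target σ g, ?_⟩
  · refine (contMDiff_proj σ).contMDiffOn.congr fun y _ => ?_
    exact congrFun (localInv_symm σ g) y
  · intro y _
    exact (congrFun (localInv_symm σ g) y).symm

/-- A discrete subgroup acts properly discontinuously on a locally compact Hausdorff group. -/
instance t2Space_nfManifold : T2Space (NFManifold K σ) := by
  have : LocallyCompactSpace (SolvGroup K) := inferInstanceAs (LocallyCompactSpace (SolvModel K))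
  have : T2Space (SolvGroup K) := inferInstanceAs (T2Space (SolvModel K))
  have := (solvLattice σ).properlyDiscontinuousSMul_of_tendsto_cofinite
    ((solvLattice σ).tendsto_coe_cofinite_of_discrete (isDiscrete_solvLattice σ))
  exact t2Space_of_properlyDiscontinuousSMul_of_t2Space
    (Γ := solvLattice σ) (T := SolvGroup K)

instance secondCountableTopology_nfManifold : SecondCountableTopology (NFManifold K σ) := by
  have : IsOpenQuotientMap (proj σ) := ⟨proj_surjective σ, continuous_proj σ, isOpenMap_proj σ⟩
  exact this.isQuotientMap.secondCountableTopology (isOpenMap_proj σ)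

end QuotientManifold

/-! ### The exterior derivative in the preferred chart -/

section ExteriorDerivative

variable {E : Type*} [NormedAddCommGroup E] [NormedSpace ℝ E]
  {H : Type*} [TopologicalSpace H] {I : ModelWithCorners ℝ E H}
  {M : Type*} [TopologicalSpace M] [ChartedSpace H M]

/-- The tangent space at x is by definition the model space read in the chart at x. Hence the
transport of vectors in the definition of `OneForm.d` is trivial. -/
theorem hasMFDerivAt_extChartAt_self [I.Boundaryless] (x : M) :
    HasMFDerivAt I 𝓘(ℝ, E) (extChartAt I x) x (ContinuousLinearMap.id ℝ E) := by
  refine ⟨continuousAt_extChartAt x, HasFDerivAt.hasFDerivWithinAt ?_⟩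
  refine (hasFDerivAt_id (𝕜 := ℝ) (extChartAt I x x)).congr_of_eventuallyEq ?_
  filter_upwards [extChartAt_target_mem_nhds (I := I) x] with y hy
  exact (extChartAt I x).right_inv hy

theorem OneForm.d_apply [I.Boundaryless] (α : OneForm I M) (x : M) (u v : E) :
    α.d x u v = fderiv ℝ (α.inChart x) (extChartAt I x x) u v -
      fderiv ℝ (α.inChart x) (extChartAt I x x) v u := by
  unfold OneForm.d
  rw [(hasMFDerivAt_extChartAt_self x).mfderiv]
  rfl

/-- Used with P the covering projection, which is the inverse of every chart: coordinate expressions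
become pullbacks to the covering, independent of the chart. -/
theorem OneForm.inChart_eq_pullback (α : OneForm I M) (x : M) {P : E → M}
    (hP : ⇑(extChartAt I x).symm = P) :
    α.inChart x = OneForm.pullback 𝓘(ℝ, E) I P α := by
  subst hP
  rfl

end ExteriorDerivative

/-! ### Exterior derivative of e^{-s} B + e^s A -/

section CylinderCalculus

variable {E : Type*} [NormedAddCommGroup E] [NormedSpace ℝ E]

theorem contDiff_exp_smul_comp_snd {A B : E → E →L[ℝ] ℝ} (hA : ContDiff ℝ ∞ A)
    (hB : ContDiff ℝ ∞ B) : ContDiff ℝ ∞ fun p : ℝ × E =>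
      Real.exp (-p.1) • (B p.2).comp (ContinuousLinearMap.snd ℝ ℝ E) +
        Real.exp p.1 • (A p.2).comp (ContinuousLinearMap.snd ℝ ℝ E) := by
  have h {A : E → E →L[ℝ] ℝ} (hA : ContDiff ℝ ∞ A) : ContDiff ℝ ∞ fun p : ℝ × E =>
      (A p.2).comp (ContinuousLinearMap.snd ℝ ℝ E) :=
    (hA.comp contDiff_snd).clm_comp contDiff_const
  exact ((Real.contDiff_exp.comp contDiff_fst.neg).smul (h hB)).add
    ((Real.contDiff_exp.comp contDiff_fst).smul (h hA))

theorem hasFDerivAt_smul_comp_snd {A : E → E →L[ℝ] ℝ} {f : ℝ → ℝ} {f' : ℝ}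
    (p : ℝ × E) (hf : HasDerivAt f f' p.1) (hA : DifferentiableAt ℝ A p.2) :
    ∃ D : ℝ × E →L[ℝ] ℝ × E →L[ℝ] ℝ, HasFDerivAt (fun p : ℝ × E =>
      f p.1 • (A p.2).comp (ContinuousLinearMap.snd ℝ ℝ E)) D p ∧ ∀ u v : ℝ × E,
      D u v = f p.1 * fderiv ℝ A p.2 u.2 v.2 + u.1 * f' * A p.2 v.2 := by
  have h1 : HasFDerivAt (fun p : ℝ × E => A p.2)
      ((fderiv ℝ A p.2).comp (ContinuousLinearMap.snd ℝ ℝ E)) p :=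
    HasFDerivAt.comp (g := A) p hA.hasFDerivAt (ContinuousLinearMap.snd ℝ ℝ E).hasFDerivAt
  have h2 := h1.clm_comp (hasFDerivAt_const (ContinuousLinearMap.snd ℝ ℝ E) p)
  have h3 : HasFDerivAt (fun p : ℝ × E => f p.1)
      ((ContinuousLinearMap.toSpanSingleton ℝ f').comp (ContinuousLinearMap.fst ℝ ℝ E)) p :=
    HasFDerivAt.comp (g := f) p hf.hasFDerivAt (ContinuousLinearMap.fst ℝ ℝ E).hasFDerivAt
  refine ⟨_, h3.smul h2, fun u v => ?_⟩
  simp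

/-- This is the Leibniz rule d(e^{-s} B + e^s A) = ds ∧ (e^s A - e^{-s} B) + e^s dA + e^{-s} dB. -/
theorem fderiv_exp_smul_comp_snd_sub {A B : E → E →L[ℝ] ℝ} (p u v : ℝ × E)
    (hA : DifferentiableAt ℝ A p.2) (hB : DifferentiableAt ℝ B p.2) :
    fderiv ℝ (fun p : ℝ × E => Real.exp (-p.1) • (B p.2).comp (ContinuousLinearMap.snd ℝ ℝ E) +
        Real.exp p.1 • (A p.2).comp (ContinuousLinearMap.snd ℝ ℝ E)) p u v -
      fderiv ℝ (fun p : ℝ × E => Real.exp (-p.1) • (B p.2).comp (ContinuousLinearMap.snd ℝ ℝ E) +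
        Real.exp p.1 • (A p.2).comp (ContinuousLinearMap.snd ℝ ℝ E)) p v u =
      u.1 * (Real.exp p.1 * A p.2 v.2 - Real.exp (-p.1) * B p.2 v.2) -
      v.1 * (Real.exp p.1 * A p.2 u.2 - Real.exp (-p.1) * B p.2 u.2) +
      Real.exp p.1 * (fderiv ℝ A p.2 u.2 v.2 - fderiv ℝ A p.2 v.2 u.2) +
      Real.exp (-p.1) * (fderiv ℝ B p.2 u.2 v.2 - fderiv ℝ B p.2 v.2 u.2) := by
  have hm : HasDerivAt (fun s : ℝ => Real.exp (-s)) (-Real.exp (-p.1)) p.1 := by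
    simpa using (hasDerivAt_neg p.1).exp
  obtain ⟨D, hD, h1⟩ := hasFDerivAt_smul_comp_snd p hm hB
  obtain ⟨D', hD', h2⟩ := hasFDerivAt_smul_comp_snd p (Real.hasDerivAt_exp p.1) hA
  have h := (hD.add hD').fderiv
  simp only [Pi.add_def] at h
  rw [h]
  simp only [add_apply, h1, h2]
  ring

end CylinderCalculus

/-! ### Derivatives of exponentials and of covectors twisted by a multiplication -/

section ProductCalculus

theorem hasFDerivAt_pi_exp_prod {ι κ : Type*} [Fintype ι] [Fintype κ] (t : (ι → ℝ) × (κ → ℂ)) :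
    HasFDerivAt (fun x : (ι → ℝ) × (κ → ℂ) =>
        ((fun i => Real.exp (x.1 i), fun k => Complex.exp (x.2 k)) : (ι → ℝ) × (κ → ℂ)))
      (((ContinuousLinearMap.pi fun i => Real.exp (t.1 i) •
        (ContinuousLinearMap.proj (R := ℝ) (φ := fun _ : ι => ℝ) i).comp
          (ContinuousLinearMap.fst ℝ (ι → ℝ) (κ → ℂ))).prod
        (ContinuousLinearMap.pi fun k => Complex.exp (t.2 k) •
          (ContinuousLinearMap.proj (R := ℝ) (φ := fun _ : κ => ℂ) k).comp
            (ContinuousLinearMap.snd ℝ (ι → ℝ) (κ → ℂ))))) t := by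
  refine HasFDerivAt.prodMk (hasFDerivAt_pi.2 fun i => ?_) (hasFDerivAt_pi.2 fun k => ?_)
  · exact ((ContinuousLinearMap.proj (R := ℝ) (φ := fun _ : ι => ℝ) i).comp
      (ContinuousLinearMap.fst ℝ (ι → ℝ) (κ → ℂ))).hasFDerivAt.exp
  · exact ((ContinuousLinearMap.proj (R := ℝ) (φ := fun _ : κ => ℂ) k).comp
      (ContinuousLinearMap.snd ℝ (ι → ℝ) (κ → ℂ))).hasFDerivAt.cexp

variable {A V : Type*} [NormedAddCommGroup A] [NormedSpace ℝ A] [NormedAddCommGroup V]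
  [NormedSpace ℝ V]

/-- The linear dependence of `v ↦ ℓ (v.1, B e v.2)` on `e`. -/
def compProdMul (B : V →L[ℝ] V →L[ℝ] V) (ℓ : A × V →L[ℝ] ℝ) : V →L[ℝ] A × V →L[ℝ] ℝ :=
  (ContinuousLinearMap.compL ℝ (A × V) V ℝ (ℓ.comp (ContinuousLinearMap.inr ℝ A V))).comp
    (((ContinuousLinearMap.compL ℝ (A × V) V V).flip (ContinuousLinearMap.snd ℝ A V)).comp B)

variable (B : V →L[ℝ] V →L[ℝ] V)

theorem compProdMul_apply (ℓ : A × V →L[ℝ] ℝ) (e : V) (u : A × V) :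
    compProdMul B ℓ e u = ℓ (0, B e u.2) := rfl

/-- Splits off the part that does not depend on e; what remains is linear in e, so smoothness and
derivatives follow from those of e alone. -/
theorem comp_prod_mul_eq (ℓ : A × V →L[ℝ] ℝ) (e : V) :
    ℓ.comp ((ContinuousLinearMap.fst ℝ A V).prod ((B e).comp (ContinuousLinearMap.snd ℝ A V))) =
    (ℓ.comp (ContinuousLinearMap.inl ℝ A V)).comp (ContinuousLinearMap.fst ℝ A V) +
      compProdMul B ℓ e := by
  refine ContinuousLinearMap.ext fun u => ?_
  rw [add_apply, compProdMul_apply]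
  change ℓ (u.1, B e u.2) = ℓ (u.1, 0) + _
  rw [← map_add]
  simp

theorem contDiff_comp_prod_mul (ℓ : A × V →L[ℝ] ℝ) {e : A → V} (he : ContDiff ℝ ∞ e) :
    ContDiff ℝ ∞ fun g : A × V => ℓ.comp ((ContinuousLinearMap.fst ℝ A V).prod
      ((B (e g.1)).comp (ContinuousLinearMap.snd ℝ A V))) := by
  simp only [comp_prod_mul_eq]
  have h : ContDiff ℝ ∞ (compProdMul B ℓ) := ContinuousLinearMap.contDiff _
  exact contDiff_const.add (h.comp (he.comp contDiff_fst))

theorem hasFDerivAt_comp_prod_mul (ℓ : A × V →L[ℝ] ℝ) {e : A → V} {e' : A →L[ℝ] V} (g : A × V)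
    (he : HasFDerivAt e e' g.1) :
    ∃ D : A × V →L[ℝ] A × V →L[ℝ] ℝ, HasFDerivAt (fun g : A × V =>
      ℓ.comp ((ContinuousLinearMap.fst ℝ A V).prod
        ((B (e g.1)).comp (ContinuousLinearMap.snd ℝ A V)))) D g ∧
      ∀ u v, D u v = ℓ (0, B (e' u.1) v.2) := by
  simp only [comp_prod_mul_eq]
  have h : HasFDerivAt (fun g : A × V => e g.1) (e'.comp (ContinuousLinearMap.fst ℝ A V)) g :=
    HasFDerivAt.comp (g := e) g he (ContinuousLinearMap.fst ℝ A V).hasFDerivAt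
  exact ⟨_, HasFDerivAt.const_add _ (HasFDerivAt.comp (g := compProdMul B ℓ) g
    (compProdMul B ℓ).hasFDerivAt h), fun u v => rfl⟩

end ProductCalculus

/-! ### Left-invariant forms on the group, the quotient and the cylinder -/

section InvariantForms

variable {K : Type u} [Field K] [NumberField K]

/-- The left-invariant form on the group with value `ℓ` at the identity. -/
def leftForm (ℓ : SolvModel K →L[ℝ] ℝ) (g : SolvModel K) : SolvModel K →L[ℝ] ℝ :=
  ℓ.comp (scaleMap (-g.1.1))

theorem leftForm_apply (ℓ : SolvModel K →L[ℝ] ℝ) (g u : SolvModel K) :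
    leftForm ℓ g u = ℓ (scaleMap (-g.1.1) u) := rfl

theorem leftInvariantForm_eq (ℓ : SolvModel K →L[ℝ] ℝ) (g : SolvModel K) :
    leftInvariantForm ℓ g = leftForm ℓ g := by
  have h : HasFDerivAt (leftTranslate ((-g.1, -(mixedExp (-g.1.1) * g.2)) : SolvModel K))
    (scaleMap (-g.1.1)) g := hasFDerivAt_leftTranslate _ g
  exact congrArg (fun A : SolvModel K →L[ℝ] SolvModel K => ℓ.comp A) h.hasMFDerivAt.mfderiv

theorem scaleMap_neg_comp (t : mixedSpace K) :
    (scaleMap (-t)).comp (scaleMap t) = ContinuousLinearMap.id ℝ (SolvModel K) := by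
  rw [← scaleMap_add, neg_add_cancel, scaleMap_zero]

theorem scaleMap_comp_neg (t : mixedSpace K) :
    (scaleMap t).comp (scaleMap (-t)) = ContinuousLinearMap.id ℝ (SolvModel K) := by
  rw [← scaleMap_add, add_neg_cancel, scaleMap_zero]

/-- Left invariance: e^{-(τ+t)} e^τ = e^{-t} on the fibre component, and left translations are pure
translations on the base component. -/
theorem leftForm_leftTranslate_comp (ℓ : SolvModel K →L[ℝ] ℝ) (γ g : SolvModel K) :
    (leftForm ℓ (leftTranslate γ g)).comp (scaleMap γ.1.1) = leftForm ℓ g := by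
  unfold leftForm
  rw [ContinuousLinearMap.comp_assoc, ← scaleMap_add]
  congr 2
  simp [leftTranslate]

variable (σ : EmbeddingChoice K)

/-- The definition evaluates at an arbitrary representative, while the tangent space at x is read at
the centre of the chart. The two points differ by a lattice element γ, the derivative of π is the
derivative of translation by γ, and left invariance absorbs the difference. -/
theorem inducedForm_eq (ℓ : SolvModel K →L[ℝ] ℝ) (x : NFManifold K σ) :
    inducedForm σ ℓ x = leftForm ℓ (chartCenter σ x) := by
  obtain ⟨g, hg⟩ : ∃ g : SolvModel K, g = Quotient.out x := ⟨_, rfl⟩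
  have hx : proj σ g = x := by rw [hg]; exact Quotient.out_eq x
  obtain ⟨γ, -, h2, h3⟩ := exists_hasMFDerivAt_proj σ g
  rw [hx] at h2
  have h5 : (scaleMap (K := K) γ.1.1).inverse = scaleMap (-γ.1.1) :=
    ContinuousLinearMap.inverse_eq (scaleMap_comp_neg _) (scaleMap_neg_comp _)
  have h4 : inducedForm σ ℓ x = (leftForm ℓ g).comp (scaleMap (-γ.1.1)) := by
    rw [← h5, ← leftInvariantForm_eq, hg]
    rw [hg] at h3
    exact congrArg (fun A : SolvModel K →L[ℝ] SolvModel K =>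
      (leftInvariantForm ℓ (Quotient.out x)).comp A.inverse) h3.mfderiv
  rw [h4, h2, ← leftForm_leftTranslate_comp ℓ γ g, ContinuousLinearMap.comp_assoc,
    scaleMap_comp_neg]
  rfl

theorem pullback_proj_inducedForm (ℓ : SolvModel K →L[ℝ] ℝ) (g : SolvModel K) :
    OneForm.pullback 𝓘(ℝ, SolvModel K) 𝓘(ℝ, SolvModel K) (proj σ) (inducedForm σ ℓ) g =
      leftForm ℓ g := by
  obtain ⟨γ, -, h2, h3⟩ := exists_hasMFDerivAt_proj σ g
  unfold OneForm.pullback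
  rw [h3.mfderiv, inducedForm_eq, h2]
  exact leftForm_leftTranslate_comp ℓ γ g

theorem pullback_nfProj_inducedForm (ℓ : SolvModel K →L[ℝ] ℝ) :
    OneForm.pullback 𝓘(ℝ, SolvModel K) 𝓘(ℝ, SolvModel K) (nfProj σ) (inducedForm σ ℓ) =
      leftInvariantForm ℓ :=
  funext fun g => (pullback_proj_inducedForm σ ℓ g).trans (leftInvariantForm_eq ℓ g).symm

theorem hasFDerivAt_mixedExp (t : mixedSpace K) :
    HasFDerivAt mixedExp (ContinuousLinearMap.mul ℝ (mixedSpace K) (mixedExp t)) t := by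
  refine (hasFDerivAt_pi_exp_prod t).congr_fderiv (ContinuousLinearMap.ext fun x => ?_)
  ext w <;> simp [mixedExp]

theorem hasFDerivAt_mixedExp_neg (t : hyperplane K) :
    HasFDerivAt (fun t : hyperplane K => mixedExp (-t.1))
      ((ContinuousLinearMap.mul ℝ (mixedSpace K) (mixedExp (-t.1))).comp
        (-(hyperplane K).subtypeL)) t :=
  HasFDerivAt.comp (g := mixedExp) t (hasFDerivAt_mixedExp (-t.1))
    (-(hyperplane K).subtypeL).hasFDerivAt

theorem contDiff_mixedExp_neg : ContDiff ℝ ∞ fun t : hyperplane K => mixedExp (-t.1) :=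
  contDiff_mixedExp.comp (-(hyperplane K).subtypeL).contDiff

theorem contDiff_leftForm (ℓ : SolvModel K →L[ℝ] ℝ) : ContDiff ℝ ∞ (leftForm ℓ) := by
  have h := contDiff_comp_prod_mul (ContinuousLinearMap.mul ℝ (mixedSpace K)) ℓ
    contDiff_mixedExp_neg
  exact h

theorem hasFDerivAt_leftForm (ℓ : SolvModel K →L[ℝ] ℝ) (g : SolvModel K) :
    ∃ D : SolvModel K →L[ℝ] SolvModel K →L[ℝ] ℝ, HasFDerivAt (leftForm ℓ) D g ∧
      ∀ u v, D u v = ℓ (0, mixedExp (-g.1.1) * -u.1.1 * v.2) := by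
  have h := hasFDerivAt_comp_prod_mul (ContinuousLinearMap.mul ℝ (mixedSpace K)) ℓ g
    (hasFDerivAt_mixedExp_neg g.1)
  exact h

theorem differentiableAt_leftForm (ℓ : SolvModel K →L[ℝ] ℝ) (g : SolvModel K) :
    DifferentiableAt ℝ (leftForm ℓ) g :=
  let ⟨_, h, _⟩ := hasFDerivAt_leftForm ℓ g
  h.differentiableAt

/-- The value `ℓ([u, v])` of a covector on a Lie bracket. -/
def bracketForm (ℓ : SolvModel K →L[ℝ] ℝ) (u v : SolvModel K) : ℝ :=
  ℓ (0, u.1.1 * v.2 - v.1.1 * u.2)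

/-- The Maurer–Cartan formula dα(u, v) = -ℓ([u, v]); the minus sign comes from differentiating
e^{-t}. -/
theorem fderiv_leftForm_sub (ℓ : SolvModel K →L[ℝ] ℝ) (g u v : SolvModel K) :
    fderiv ℝ (leftForm ℓ) g u v - fderiv ℝ (leftForm ℓ) g v u =
      -bracketForm ℓ (scaleMap (-g.1.1) u) (scaleMap (-g.1.1) v) := by
  obtain ⟨D, hD, h⟩ := hasFDerivAt_leftForm ℓ g
  rw [hD.fderiv, h, h]
  change ℓ (0, mixedExp (-g.1.1) * -u.1.1 * v.2) - ℓ (0, mixedExp (-g.1.1) * -v.1.1 * u.2) =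
    -ℓ (0, u.1.1 * (mixedExp (-g.1.1) * v.2) - v.1.1 * (mixedExp (-g.1.1) * u.2))
  rw [← map_sub, ← map_neg]
  congr 1
  refine Prod.ext (by simp) ?_
  change _ - _ = -(_ - _)
  ring

theorem smooth_inducedForm (ℓ : SolvModel K →L[ℝ] ℝ) : (inducedForm σ ℓ).Smooth := by
  intro x
  rw [OneForm.inChart_eq_pullback _ x (extChartAt_symm σ x),
    funext (pullback_proj_inducedForm σ ℓ)]
  exact (contDiff_leftForm ℓ).contDiffOn

theorem d_inducedForm (ℓ : SolvModel K →L[ℝ] ℝ) (x : NFManifold K σ) (u v : SolvModel K) :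
    (inducedForm σ ℓ).d x u v = -bracketForm ℓ (scaleMap (-(chartCenter σ x).1.1) u)
      (scaleMap (-(chartCenter σ x).1.1) v) := by
  rw [OneForm.d_apply, OneForm.inChart_eq_pullback _ x (extChartAt_symm σ x),
    funext (pullback_proj_inducedForm σ ℓ), extChartAt_self]
  exact fderiv_leftForm_sub ℓ _ u v

/-- The map `id × π` from the universal cover of the cylinder. -/
def cylProj (p : ℝ × SolvModel K) : ℝ × NFManifold K σ := (p.1, proj σ p.2)

theorem extChartAt_cyl_symm (x : ℝ × NFManifold K σ) :
    ⇑(extChartAt (𝓘(ℝ, ℝ).prod 𝓘(ℝ, SolvModel K)) x).symm = cylProj σ := by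
  rw [extChartAt_prod]
  funext p
  refine Prod.ext rfl ?_
  exact congrFun (extChartAt_symm σ x.2) p.2

theorem extChartAt_cyl_self (x : ℝ × NFManifold K σ) :
    extChartAt (𝓘(ℝ, ℝ).prod 𝓘(ℝ, SolvModel K)) x x = (x.1, chartCenter σ x.2) := by
  rw [extChartAt_prod]
  exact Prod.ext rfl (extChartAt_self σ x.2)

/-- The `1`-form `e^{-s} ℓ₋ + e^{s} ℓ₊` on the universal cover of the cylinder. -/
def cylForm (ℓp ℓm : SolvModel K →L[ℝ] ℝ) (p : ℝ × SolvModel K) : ℝ × SolvModel K →L[ℝ] ℝ :=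
  Real.exp (-p.1) • (leftForm ℓm p.2).comp (ContinuousLinearMap.snd ℝ _ _) +
    Real.exp p.1 • (leftForm ℓp p.2).comp (ContinuousLinearMap.snd ℝ _ _)

theorem exists_hasMFDerivAt_cylProj (p : ℝ × SolvModel K) :
    ∃ γ ∈ solvLattice σ, chartCenter σ (proj σ p.2) = leftTranslate γ p.2 ∧
      HasMFDerivAt 𝓘(ℝ, ℝ × SolvModel K) (𝓘(ℝ, ℝ).prod 𝓘(ℝ, SolvModel K)) (cylProj σ) p
        ((ContinuousLinearMap.fst ℝ _ _).prod
          ((scaleMap γ.1.1).comp (ContinuousLinearMap.snd ℝ _ _)) :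
          ℝ × SolvModel K →L[ℝ] ℝ × SolvModel K) := by
  obtain ⟨γ, h1, h2, h3⟩ := exists_hasMFDerivAt_proj σ p.2
  refine ⟨γ, h1, h2, HasMFDerivAt.prodMk ?_ ?_⟩
  · exact (hasFDerivAt_fst (𝕜 := ℝ)).hasMFDerivAt
  · exact h3.comp p (hasFDerivAt_snd (𝕜 := ℝ)).hasMFDerivAt

theorem liouvillePairForm_eq (ℓp ℓm : SolvModel K →L[ℝ] ℝ) (x : ℝ × NFManifold K σ) :
    liouvillePairForm (inducedForm σ ℓp) (inducedForm σ ℓm) x =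
      cylForm ℓp ℓm (x.1, chartCenter σ x.2) := by
  unfold liouvillePairForm OneForm.pullback
  rw [mfderiv_snd, inducedForm_eq, inducedForm_eq]
  rfl

theorem pullback_cylProj_liouvillePairForm (ℓp ℓm : SolvModel K →L[ℝ] ℝ) (p : ℝ × SolvModel K) :
    OneForm.pullback 𝓘(ℝ, ℝ × SolvModel K) (𝓘(ℝ, ℝ).prod 𝓘(ℝ, SolvModel K)) (cylProj σ)
      (liouvillePairForm (inducedForm σ ℓp) (inducedForm σ ℓm)) p = cylForm ℓp ℓm p := by
  obtain ⟨γ, -, h2, h3⟩ := exists_hasMFDerivAt_cylProj σ p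
  unfold OneForm.pullback
  rw [h3.mfderiv, liouvillePairForm_eq]
  change (cylForm ℓp ℓm (p.1, chartCenter σ (proj σ p.2))).comp _ = _
  rw [h2]
  unfold cylForm
  rw [← leftForm_leftTranslate_comp ℓp γ p.2, ← leftForm_leftTranslate_comp ℓm γ p.2]
  rfl

theorem contDiff_cylForm (ℓp ℓm : SolvModel K →L[ℝ] ℝ) : ContDiff ℝ ∞ (cylForm ℓp ℓm) :=
  contDiff_exp_smul_comp_snd (contDiff_leftForm ℓp) (contDiff_leftForm ℓm)

theorem fderiv_cylForm_sub (ℓp ℓm : SolvModel K →L[ℝ] ℝ) (p u v : ℝ × SolvModel K) :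
    fderiv ℝ (cylForm ℓp ℓm) p u v - fderiv ℝ (cylForm ℓp ℓm) p v u =
      u.1 * (Real.exp p.1 * ℓp (scaleMap (-p.2.1.1) v.2) -
        Real.exp (-p.1) * ℓm (scaleMap (-p.2.1.1) v.2)) -
      v.1 * (Real.exp p.1 * ℓp (scaleMap (-p.2.1.1) u.2) -
        Real.exp (-p.1) * ℓm (scaleMap (-p.2.1.1) u.2)) -
      (Real.exp p.1 * bracketForm ℓp (scaleMap (-p.2.1.1) u.2) (scaleMap (-p.2.1.1) v.2) +
        Real.exp (-p.1) * bracketForm ℓm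
          (scaleMap (-p.2.1.1) u.2) (scaleMap (-p.2.1.1) v.2)) := by
  refine (fderiv_exp_smul_comp_snd_sub p u v (differentiableAt_leftForm ℓp p.2)
    (differentiableAt_leftForm ℓm p.2)).trans ?_
  rw [fderiv_leftForm_sub, fderiv_leftForm_sub]
  simp only [leftForm_apply]
  ring

theorem smooth_liouvillePairForm (ℓp ℓm : SolvModel K →L[ℝ] ℝ) :
    (liouvillePairForm (inducedForm σ ℓp) (inducedForm σ ℓm)).Smooth := by
  intro x
  rw [OneForm.inChart_eq_pullback _ x (extChartAt_cyl_symm σ x)]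
  refine ContDiffOn.congr (f := cylForm ℓp ℓm) (contDiff_cylForm ℓp ℓm).contDiffOn fun p _ => ?_
  exact pullback_cylProj_liouvillePairForm σ ℓp ℓm p

theorem d_liouvillePairForm (ℓp ℓm : SolvModel K →L[ℝ] ℝ) (x : ℝ × NFManifold K σ)
    (u v : ℝ × SolvModel K) :
    (liouvillePairForm (inducedForm σ ℓp) (inducedForm σ ℓm)).d x u v =
      u.1 * (Real.exp x.1 * ℓp (scaleMap (-(chartCenter σ x.2).1.1) v.2) -
        Real.exp (-x.1) * ℓm (scaleMap (-(chartCenter σ x.2).1.1) v.2)) -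
      v.1 * (Real.exp x.1 * ℓp (scaleMap (-(chartCenter σ x.2).1.1) u.2) -
        Real.exp (-x.1) * ℓm (scaleMap (-(chartCenter σ x.2).1.1) u.2)) -
      (Real.exp x.1 * bracketForm ℓp (scaleMap (-(chartCenter σ x.2).1.1) u.2)
          (scaleMap (-(chartCenter σ x.2).1.1) v.2) +
        Real.exp (-x.1) * bracketForm ℓm (scaleMap (-(chartCenter σ x.2).1.1) u.2)
          (scaleMap (-(chartCenter σ x.2).1.1) v.2)) := by
  have h : (liouvillePairForm (inducedForm σ ℓp) (inducedForm σ ℓm)).inChart x =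
      cylForm ℓp ℓm := by
    rw [OneForm.inChart_eq_pullback _ x (extChartAt_cyl_symm σ x)]
    exact funext (pullback_cylProj_liouvillePairForm σ ℓp ℓm)
  refine (OneForm.d_apply _ x u v).trans ?_
  rw [h, extChartAt_cyl_self]
  exact fderiv_cylForm_sub ℓp ℓm _ u v

end InvariantForms

/-! ### Alternating sums of products of 2 × 2 minors -/

section Pfaffian

variable {N P : Type*} [Fintype N] [DecidableEq N] [Fintype P]

/-- A choice, for each pair of a set of pairs of rows, of a pair of rows and of an ordering of it,
seen as a map on rows. -/
def pairMap (f : P → P × Bool) (x : P × Bool) : P × Bool := ((f x.1).1, xor x.2 (f x.1).2)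

/-- The signs that make a choice of ordered pairs of rows unimodular on each pair. -/
def pairSign (f : P → P × Bool) (x : P × Bool) : ℝ := if x.2 && (f x.1).2 then -1 else 1

theorem prod_pairSign (f : P → P × Bool) :
    ∏ x, pairSign f x = ∏ i, if (f i).2 then (-1 : ℝ) else 1 := by
  rw [Fintype.prod_prod_type]
  refine Finset.prod_congr rfl fun i _ => ?_
  simp [pairSign]

theorem prod_extend_embedding {R : Type*} [CommMonoid R] (e : P × Bool ↪ N) (F : N → R) :
    ∏ n, F n = (∏ n ∈ (Finset.univ.map e)ᶜ, F n) * ∏ x, F (e x) := by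
  rw [← Finset.prod_compl_mul_prod (Finset.univ.map e), Finset.prod_map]

variable [DecidableEq P]

/-- If the chosen pairs are distinct, the rows are rearranged by a permutation κ of the pairs
followed by flips inside pairs. The permutation of pairs moves two rows at a time and so is even;
each flip contributes -1, which the prefactor cancels. If a pair is chosen twice, two rows coincide.
-/
theorem det_submatrix_extend_pairMap (e : P × Bool ↪ N) (M : Matrix N N ℝ) (f : P → P × Bool) :
    (∏ i, if (f i).2 then (-1 : ℝ) else 1) *
      (M.submatrix (Function.extend e (e ∘ pairMap f) id) id).det =
      if Function.Bijective (fun i => (f i).1) then M.det else 0 := by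
  split_ifs with hf
  · let κ : Equiv.Perm P := Equiv.ofBijective _ hf
    let b : P → Equiv.Perm Bool := fun i => if (f i).2 then Equiv.swap false true else 1
    let g : Equiv.Perm (P × Bool) := (Equiv.prodCongrRight b).trans (Equiv.prodCongrLeft fun _ => κ)
    have hg : ⇑g = pairMap f := by
      funext x
      obtain ⟨i, c⟩ := x
      refine Prod.ext rfl ?_
      change b i c = xor c (f i).2
      dsimp only [b]
      cases (f i).2 <;> cases c <;> rfl
    have hr : Function.extend e (e ∘ pairMap f) id = g.viaFintypeEmbedding e := by
      funext n
      by_cases hn : n ∈ Set.range e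
      · obtain ⟨x, rfl⟩ := hn
        rw [e.injective.extend_apply, Equiv.Perm.viaFintypeEmbedding_apply_image, hg]
        rfl
      · rw [Function.extend_apply' _ _ _ hn,
          Equiv.Perm.viaFintypeEmbedding_apply_notMem_range _ _ hn]
        rfl
    have hs : ((Equiv.Perm.sign g : ℤ) : ℝ) = ∏ i, if (f i).2 then (-1 : ℝ) else 1 := by
      have h1 : Equiv.Perm.sign g = Equiv.Perm.sign (Equiv.prodCongrLeft fun _ : Bool => κ) *
          Equiv.Perm.sign (Equiv.prodCongrRight b) := Equiv.Perm.sign_mul _ _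
      have h2 : Equiv.Perm.sign (Equiv.prodCongrLeft fun _ : Bool => κ) = 1 := by
        rw [Equiv.Perm.sign_prodCongrLeft, Fintype.prod_bool]
        exact Int.units_mul_self _
      rw [h1, h2, one_mul, Equiv.Perm.sign_prodCongrRight]
      push_cast
      refine Finset.prod_congr rfl fun i _ => ?_
      dsimp only [b]
      split_ifs
      · rw [Equiv.Perm.sign_swap (by decide)]; simp
      · simp
    rw [hr, Matrix.det_permute, Equiv.Perm.viaFintypeEmbedding_sign, hs, ← mul_assoc,
      ← Finset.prod_mul_distrib]
    rw [Finset.prod_congr rfl (g := fun _ => (1 : ℝ)), Finset.prod_const_one, one_mul]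
    intro i _
    split_ifs <;> norm_num
  · have hinj : ¬ Function.Injective (fun i => (f i).1) :=
      fun h => hf (Finite.injective_iff_bijective.1 h)
    simp only [Function.Injective, not_forall] at hinj
    obtain ⟨i, i', h1, h2⟩ := hinj
    -- In each of the two colliding pairs, the slot labelled by its own flip holds the first row of
    -- the chosen pair.
    have h3 : pairMap f (i, (f i).2) = pairMap f (i', (f i').2) := by
      simp only [pairMap, Bool.xor_self]
      rw [h1]
    rw [Matrix.det_zero_of_row_eq (i := e (i, (f i).2)) (j := e (i', (f i').2)), mul_zero]
    · intro h
      exact h2 (congrArg Prod.fst (e.injective h))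
    · funext j
      simp only [Matrix.submatrix_apply, e.injective.extend_apply, Function.comp_apply, h3]

theorem card_filter_bijective :
    (Finset.univ.filter fun k : P → P => Function.Bijective k).card = (Fintype.card P).factorial := by
  rw [← Fintype.card_perm, ← Fintype.card_subtype]
  exact Fintype.card_congr (Equiv.ofBijective (fun κ : Equiv.Perm P => ⟨κ, κ.bijective⟩)
    ⟨fun a b h => Equiv.coe_fn_injective (congrArg Subtype.val h),
      fun k => ⟨Equiv.ofBijective k.1 k.2, rfl⟩⟩).symm

/-- The signed sum over permutations of a product of `2 × 2` minors is a multiple of the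
determinant. -/
theorem sum_sign_mul_prod_minors (e : P × Bool ↪ N) (M : Matrix N N ℝ) :
    ∑ τ : Equiv.Perm N, ((Equiv.Perm.sign τ : ℤ) : ℝ) *
      ((∏ n ∈ (Finset.univ.map e)ᶜ, M n (τ n)) * ∏ i : P, ∑ k : P,
        (M (e (k, false)) (τ (e (i, false))) * M (e (k, true)) (τ (e (i, true))) -
          M (e (k, true)) (τ (e (i, false))) * M (e (k, false)) (τ (e (i, true))))) =
      2 ^ Fintype.card P * (Fintype.card P).factorial * M.det := by
  -- A minor on the rows of pair k is the signed sum over the two orderings of these rows, so the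
  -- sum of minors runs over ordered pairs.
  have h1 (τ : Equiv.Perm N) (i : P) : ∑ k : P,
        (M (e (k, false)) (τ (e (i, false))) * M (e (k, true)) (τ (e (i, true))) -
          M (e (k, true)) (τ (e (i, false))) * M (e (k, false)) (τ (e (i, true)))) =
      ∑ y : P × Bool, (M (e y) (τ (e (i, false))) *
        ((if y.2 then -1 else 1) * M (e (y.1, !y.2)) (τ (e (i, true))))) := by
    rw [Fintype.sum_prod_type]
    refine Finset.sum_congr rfl fun k _ => ?_
    rw [Fintype.sum_bool]
    simp
    ring
  -- For a fixed choice f of ordered pairs, the alternating sum over τ is a Leibniz expansion of the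
  -- matrix with rows rearranged by f and rescaled by `pairSign f`.
  have h2 (f : P → P × Bool) : ∑ τ : Equiv.Perm N, ((Equiv.Perm.sign τ : ℤ) : ℝ) *
      ((∏ n ∈ (Finset.univ.map e)ᶜ, M n (τ n)) * ∏ i : P, (M (e (f i)) (τ (e (i, false))) *
        ((if (f i).2 then -1 else 1) * M (e ((f i).1, !(f i).2)) (τ (e (i, true)))))) =
      if Function.Bijective (fun i => (f i).1) then M.det else 0 := by
    rw [← det_submatrix_extend_pairMap e M f, ← prod_pairSign]
    have h3 := Matrix.det_mul_column (Function.extend e (pairSign f) 1)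
      (M.submatrix (Function.extend e (e ∘ pairMap f) id) id)
    rw [prod_extend_embedding e (Function.extend _ _ _)] at h3
    simp only [e.injective.extend_apply] at h3
    rw [Finset.prod_eq_one, one_mul] at h3
    · rw [← h3, ← Matrix.det_transpose, Matrix.det_apply']
      refine Finset.sum_congr rfl fun τ _ => ?_
      congr 1
      rw [prod_extend_embedding e]
      congr 1
      · refine Finset.prod_congr rfl fun n hn => ?_
        have hn' : ¬ ∃ x, e x = n := by simpa using hn
        simp [Function.extend_apply' _ _ _ hn']
      · rw [Fintype.prod_prod_type]
        refine Finset.prod_congr rfl fun i _ => ?_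
        rw [Fintype.prod_bool]
        simp only [Matrix.transpose_apply, Matrix.of_apply, e.injective.extend_apply,
          Matrix.submatrix_apply, Function.comp_apply, pairMap, pairSign, id]
        generalize f i = y
        obtain ⟨k, b⟩ := y
        cases b <;> simp <;> ring
    · intro n hn
      have hn' : ¬ ∃ x, e x = n := by simpa using hn
      simp [Function.extend_apply' _ _ _ hn']
  simp only [h1, Finset.prod_univ_sum, Fintype.piFinset_univ, Finset.mul_sum]
  rw [Finset.sum_comm]
  rw [Finset.sum_congr rfl fun f _ => h2 f]
  -- A choice is a map of pairs together with flips: the flips contribute 2^|P| and only the |P|!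
  -- bijective maps contribute a determinant.
  rw [← (Equiv.arrowProdEquivProdArrow P (fun _ => P) (fun _ => Bool)).symm.sum_comp
    (fun f => if Function.Bijective (fun i => (f i).1) then M.det else 0), Fintype.sum_prod_type]
  simp only [Equiv.arrowProdEquivProdArrow_symm_apply, Finset.sum_const, Finset.card_univ,
    Fintype.card_pi, Fintype.card_bool, Finset.prod_const, nsmul_eq_mul]
  rw [← Finset.mul_sum, Finset.sum_ite, Finset.sum_const, Finset.sum_const_zero, add_zero,
    card_filter_bijective]
  push_cast
  simp [mul_assoc]

end Pfaffian

/-! ### Wedge powers as determinants -/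

section WedgePowers

/-- The enumeration of the `2m` slots of an `m`-th power of a `2`-form by pairs. -/
def evenIdx (m : ℕ) : Fin m × Bool ≃ Fin (2 * m) :=
  Equiv.ofBijective (fun x => ⟨2 * x.1.1 + x.2.toNat, by
      have := x.1.2; have := x.2.toNat_le; omega⟩) <| by
    rw [Fintype.bijective_iff_injective_and_card]
    refine ⟨fun x y h => ?_, by simp [mul_comm]⟩
    obtain ⟨⟨i, hi⟩, b⟩ := x
    obtain ⟨⟨j, hj⟩, c⟩ := y
    cases b <;> cases c <;> simp at h ⊢ <;> omega

/-- The enumeration of the `2m + 1` slots of the product of a `1`-form and the `m`-th power of a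
`2`-form. -/
def oddIdx (m : ℕ) : Option (Fin m × Bool) ≃ Fin (2 * m + 1) :=
  Equiv.ofBijective (fun x => x.elim 0 fun x => ⟨2 * x.1.1 + 1 + x.2.toNat, by
      have := x.1.2; have := x.2.toNat_le; omega⟩) <| by
    rw [Fintype.bijective_iff_injective_and_card]
    refine ⟨fun x y h => ?_, by simp [mul_comm]⟩
    obtain _ | ⟨⟨i, hi⟩, b⟩ := x <;> obtain _ | ⟨⟨j, hj⟩, c⟩ := y
    · rfl
    · simp [Fin.ext_iff] at h; omega
    · simp [Fin.ext_iff] at h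
    · cases b <;> cases c <;> simp at h ⊢ <;> omega

variable {V : Type*} {m : ℕ}

/-- A family of pairs of covectors. -/
def pairRow (μ ν : Fin m → V → ℝ) (x : Fin m × Bool) : V → ℝ := if x.2 then ν x.1 else μ x.1

/-- A covector followed by a family of pairs of covectors. -/
def oddRow (a : V → ℝ) (μ ν : Fin m → V → ℝ) (x : Option (Fin m × Bool)) : V → ℝ :=
  x.elim a (pairRow μ ν)

/-- The determinant of the values of `a, μ, ν` on a frame. -/
def oddDet (a : V → ℝ) (μ ν : Fin m → V → ℝ) (v : Fin (2 * m + 1) → V) : ℝ :=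
  (Matrix.of fun x y => oddRow a μ ν x (v (oddIdx m y))).det

/-- The normalization (1/2)^m of the wedge power cancels the 2^m orderings, and m! remains. -/
theorem wedgeTwoPow_eq_det (η : V → V → ℝ) (μ ν : Fin m → V → ℝ)
    (hη : ∀ u v, η u v = ∑ k, (μ k u * ν k v - ν k u * μ k v)) (v : Fin (2 * m) → V) :
    wedgeTwoPow m η v = m.factorial *
      (Matrix.of fun x y => pairRow μ ν x (v (evenIdx m y))).det := by
  have h := sum_sign_mul_prod_minors (evenIdx m).toEmbedding
    (Matrix.of fun n j => pairRow μ ν ((evenIdx m).symm n) (v j))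
  have h1 : ((Finset.univ : Finset (Fin m × Bool)).map (evenIdx m).toEmbedding)ᶜ = ∅ := by
    rw [Finset.map_univ_equiv, Finset.compl_univ]
  rw [h1, Fintype.card_fin, ← Matrix.det_submatrix_equiv_self (evenIdx m)] at h
  unfold wedgeTwoPow
  simp only [hη]
  simp only [Finset.prod_empty, one_mul, Equiv.coe_toEmbedding, Matrix.of_apply,
    Equiv.symm_apply_apply] at h
  have h2 : (Matrix.of fun x y => pairRow μ ν x (v (evenIdx m y))) =
      (Matrix.of fun n j => pairRow μ ν ((evenIdx m).symm n) (v j)).submatrix (evenIdx m)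
        (evenIdx m) := by
    ext x y; simp
  rw [h2]
  refine (congrArg _ h).trans ?_
  rw [← mul_assoc, ← mul_assoc, ← mul_pow]
  norm_num

theorem wedgeOneTwoPow_eq_det (a : V → ℝ) (η : V → V → ℝ) (μ ν : Fin m → V → ℝ)
    (hη : ∀ u v, η u v = ∑ k, (μ k u * ν k v - ν k u * μ k v)) (v : Fin (2 * m + 1) → V) :
    wedgeOneTwoPow m a η v = m.factorial * oddDet a μ ν v := by
  have h := sum_sign_mul_prod_minors (Function.Embedding.some.trans (oddIdx m).toEmbedding)
    (Matrix.of fun n j => oddRow a μ ν ((oddIdx m).symm n) (v j))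
  have h1 : ((Finset.univ : Finset (Fin m × Bool)).map
      (Function.Embedding.some.trans (oddIdx m).toEmbedding))ᶜ = {oddIdx m none} := by
    ext n
    obtain ⟨x, rfl⟩ := (oddIdx m).surjective n
    cases x <;> simp
  rw [h1, Fintype.card_fin, ← Matrix.det_submatrix_equiv_self (oddIdx m)] at h
  unfold wedgeOneTwoPow oddDet
  simp only [hη]
  simp only [Finset.prod_singleton, Equiv.coe_toEmbedding, Matrix.of_apply,
    Equiv.symm_apply_apply, Function.Embedding.trans_apply, Function.Embedding.some_apply] at h
  have h2 : (Matrix.of fun x y => oddRow a μ ν x (v (oddIdx m y))) =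
      (Matrix.of fun n j => oddRow a μ ν ((oddIdx m).symm n) (v j)).submatrix (oddIdx m)
        (oddIdx m) := by
    ext x y; simp
  rw [h2]
  refine (congrArg _ h).trans ?_
  rw [← mul_assoc, ← mul_assoc, ← mul_pow]
  norm_num

/-- The φ_k are already rows of the determinant, so only the coefficient of φ₀ in the first row
matters. -/
theorem oddDet_add_sum (φ₀ : V → ℝ) (t φ : Fin m → V → ℝ) (d : ℝ) (e : Fin m → ℝ) {a : V → ℝ}
    (ha : ∀ u, a u = d * φ₀ u + ∑ k, e k * φ k u) (v : Fin (2 * m + 1) → V) :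
    oddDet a t φ v = d * oddDet φ₀ t φ v := by
  have h := Matrix.det_updateRow_sum (Matrix.of fun x y => oddRow φ₀ t φ x (v (oddIdx m y))) none
    (fun x => x.elim d fun x => if x.2 then e x.1 else 0)
  refine Eq.trans (congrArg Matrix.det ?_) h
  ext x y
  obtain _ | x := x
  · rw [Matrix.updateRow_self, Fintype.sum_option, Fintype.sum_prod_type]
    simp [Finset.sum_apply, oddRow, pairRow, ha]
  · rw [Matrix.updateRow_ne (by simp)]
    rfl

theorem oddDet_sub_smul (φ₀ : V → ℝ) (t φ : Fin m → V → ℝ) (c : Fin m → ℝ)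
    (v : Fin (2 * m + 1) → V) :
    oddDet φ₀ t (fun k u => φ k u - c k * φ₀ u) v = oddDet φ₀ t φ v := by
  refine Matrix.det_eq_of_forall_row_eq_smul_add_const
    (fun x => x.elim 0 fun x => if x.2 then -c x.1 else 0) none rfl fun x y => ?_
  obtain _ | ⟨k, _ | _⟩ := x
  · simp [oddRow]
  · simp [oddRow, pairRow]
  · simp [oddRow, pairRow]; ring

theorem oddDet_smul (φ₀ : V → ℝ) (t φ : Fin m → V → ℝ) (r : ℝ) (v : Fin (2 * m + 1) → V) :
    oddDet φ₀ (fun k u => r * t k u) φ v = r ^ m * oddDet φ₀ t φ v := by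
  have h := Matrix.det_mul_column (fun x : Option (Fin m × Bool) =>
      x.elim 1 fun x => if x.2 then 1 else r)
    (Matrix.of fun x y => oddRow φ₀ t φ x (v (oddIdx m y)))
  rw [Fintype.prod_option, Fintype.prod_prod_type] at h
  simp at h
  unfold oddDet
  rw [← h]
  congr 1
  ext x y
  obtain _ | ⟨k, _ | _⟩ := x <;> simp [oddRow, pairRow]

theorem oddDet_smul_left (φ₀ : V → ℝ) (t φ : Fin m → V → ℝ) (r : ℝ) (v : Fin (2 * m + 1) → V) :
    oddDet (fun u => r * φ₀ u) t φ v = r * oddDet φ₀ t φ v :=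
  oddDet_add_sum φ₀ t φ r 0 (by simp) v

/-- The value of `a ∧ η^m` for `a = e₀φ₀ + ∑ eₖφₖ` and `η = -(t₀ ∧ φ₀ + ∑ tₖ ∧ φₖ)`, when
`t₀ = -∑ cₖtₖ`. -/
theorem wedgeOneTwoPow_of_relation (a t₀ φ₀ : V → ℝ) (η : V → V → ℝ) (t φ : Fin m → V → ℝ)
    (e₀ : ℝ) (c e : Fin m → ℝ) (ht : ∀ u, t₀ u = -∑ k, c k * t k u)
    (ha : ∀ u, a u = e₀ * φ₀ u + ∑ k, e k * φ k u)
    (hη : ∀ u v, η u v = -(t₀ u * φ₀ v - φ₀ u * t₀ v + ∑ k, (t k u * φ k v - φ k u * t k v)))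
    (v : Fin (2 * m + 1) → V) :
    wedgeOneTwoPow m a η v =
      m.factorial * ((e₀ + ∑ k, c k * e k) * ((-1) ^ m * oddDet φ₀ t φ v)) := by
  -- Substituting t₀ = -∑ c_k t_k gives η = -∑ t_k ∧ (φ_k - c_k φ₀), a sum of exactly m decomposable
  -- terms. In these covectors the coefficient of φ₀ in a becomes e₀ + ∑ c_k e_k.
  rw [wedgeOneTwoPow_eq_det a η (fun k u => -1 * t k u) (fun k u => φ k u - c k * φ₀ u),
    oddDet_add_sum φ₀ _ _ (e₀ + ∑ k, c k * e k) e, oddDet_smul, oddDet_sub_smul]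
  · intro u
    rw [ha, add_mul, add_assoc, Finset.sum_mul, ← Finset.sum_add_distrib]
    congr 1
    exact Finset.sum_congr rfl fun k _ => by ring
  · intro u v
    rw [hη, ht, ht, neg_mul, mul_neg, Finset.sum_mul, Finset.mul_sum, ← Finset.sum_neg_distrib,
      ← Finset.sum_neg_distrib, ← Finset.sum_sub_distrib, ← Finset.sum_add_distrib,
      ← Finset.sum_neg_distrib]
    exact Finset.sum_congr rfl fun k _ => by ring

/-- The slots of the power of a `2`-form on a cylinder. -/
def cylIdx (m : ℕ) : Unit ⊕ Option (Fin m × Bool) ≃ Fin (m + 1) × Bool where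
  toFun := Sum.elim (fun _ => (0, false)) fun x => x.elim (0, true) fun x => (x.1.succ, x.2)
  invFun x := Fin.cases (if x.2 then Sum.inr none else Sum.inl ())
    (fun i => Sum.inr (some (i, x.2))) x.1
  left_inv := by rintro (_ | _ | _) <;> simp
  right_inv := by
    rintro ⟨i, b⟩
    refine Fin.cases ?_ (fun i => ?_) i
    · cases b <;> simp
    · simp

theorem evenIdx_cylIdx_inl : evenIdx (m + 1) (cylIdx m (Sum.inl ())) = 0 := rfl

theorem evenIdx_cylIdx_inr (x : Option (Fin m × Bool)) :
    evenIdx (m + 1) (cylIdx m (Sum.inr x)) = Fin.succ (oddIdx m x) := by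
  obtain _ | ⟨i, b⟩ := x
  · rfl
  · refine Fin.ext ?_
    change 2 * (i.1 + 1) + b.toNat = 2 * i.1 + 1 + b.toNat + 1
    ring

/-- The value of `η^(m+1)` on a frame of a cylinder, for
`η = (g₀ds - f₀t₀) ∧ φ₀ + ∑ (g eₖ ds - f tₖ) ∧ φₖ`, when `t₀ = -∑ cₖtₖ`. -/
theorem wedgeTwoPow_of_relation [Zero V] (t₀ φ₀ : V → ℝ) (η : ℝ × V → ℝ × V → ℝ)
    (t φ : Fin m → V → ℝ) (f₀ g₀ f g : ℝ) (c e : Fin m → ℝ) (hf : f ≠ 0)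
    (ht : ∀ u, t₀ u = -∑ k, c k * t k u)
    (hη : ∀ u v, η u v = (g₀ * u.1 - f₀ * t₀ u.2) * φ₀ v.2 - φ₀ u.2 * (g₀ * v.1 - f₀ * t₀ v.2) +
      ∑ k, ((g * e k * u.1 - f * t k u.2) * φ k v.2 - φ k u.2 * (g * e k * v.1 - f * t k v.2)))
    (v : Fin (2 * m + 1) → V) (w : Fin (2 * (m + 1)) → ℝ × V) (hw₀ : w 0 = (1, 0))
    (hw : ∀ i : Fin (2 * m + 1), w i.succ = (0, v i)) :
    wedgeTwoPow (m + 1) η w = (m + 1).factorial *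
      ((g₀ + f₀ * g / f * ∑ k, c k * e k) * f ^ m * ((-1) ^ m * oddDet φ₀ t φ v)) := by
  let μ : Fin m → ℝ × V → ℝ := fun k u => g * e k * u.1 - f * t k u.2
  let ν : Fin m → ℝ × V → ℝ := fun k u => φ k u.2
  rw [wedgeTwoPow_eq_det η (Fin.cons (fun u => g₀ * u.1 - f₀ * t₀ u.2) μ)
    (Fin.cons (fun u => φ₀ u.2) ν), ← Matrix.det_submatrix_equiv_self (cylIdx m)]
  swap
  · intro u v
    rw [hη, Fin.sum_univ_succ]
    rfl
  congr 1
  let R : Unit ⊕ Option (Fin m × Bool) → ℝ × V → ℝ :=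
    Sum.elim (fun _ u => u.1) (oddRow (fun u => φ₀ u.2) μ ν)
  let A : Matrix (Unit ⊕ Option (Fin m × Bool)) (Unit ⊕ Option (Fin m × Bool)) ℝ :=
    Matrix.of fun x y => R x (w (evenIdx (m + 1) (cylIdx m y)))
  -- By the relation for t₀ and μ_k = g e_k ds - f t_k, the first row g₀ ds - f₀ t₀ equals (g₀ + (f₀
  -- g / f) ∑ c_k e_k) ds - ∑ (f₀ c_k / f) μ_k. The μ_k are other rows, so only the coefficient of
  -- ds survives; this is where f ≠ 0 enters.
  have h1 : (Matrix.of fun x y => pairRow (Fin.cons (fun u => g₀ * u.1 - f₀ * t₀ u.2) μ)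
      (Fin.cons (fun u => φ₀ u.2) ν) x (w (evenIdx (m + 1) y))).submatrix (cylIdx m) (cylIdx m) =
      A.updateRow (Sum.inl ()) (∑ x, (Sum.elim (fun _ => g₀ + f₀ * g / f * ∑ k, c k * e k)
        (fun x => x.elim 0 fun x => if x.2 then 0 else -(f₀ * c x.1 / f)) x : ℝ) • A x) := by
    ext x y
    obtain _ | _ | ⟨i, _ | _⟩ := x
    · rw [Matrix.updateRow_self, Fintype.sum_sum_type, Fintype.sum_option, Fintype.sum_prod_type]
      simp only [Finset.sum_apply, Fintype.sum_bool, Pi.add_apply, Pi.smul_apply, smul_eq_mul,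
        A, R, Matrix.of_apply, Sum.elim_inl, Sum.elim_inr, Finset.univ_unique, Finset.sum_singleton,
        Option.elim, oddRow, pairRow, μ, ν, Matrix.submatrix_apply]
      change g₀ * _ - f₀ * t₀ _ = _
      simp only [ht, zero_mul, zero_add, if_true, Bool.false_eq_true, if_false]
      rw [add_mul, Finset.mul_sum, Finset.sum_mul, add_assoc, ← Finset.sum_add_distrib, mul_neg,
        sub_neg_eq_add, Finset.mul_sum]
      congr 1
      refine Finset.sum_congr rfl fun k _ => ?_
      field_simp
      ring
    · rw [Matrix.updateRow_ne (by simp)]; rfl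
    · rw [Matrix.updateRow_ne (by simp)]; rfl
    · rw [Matrix.updateRow_ne (by simp)]; rfl
  -- On the frame, ds is 1 on the first vector and 0 on all others, so the matrix is block
  -- triangular. The ds-parts of the μ_k lie in the block that does not affect the determinant.
  have h2 : A = Matrix.fromBlocks 1 0 (Matrix.of fun x _ => A (Sum.inr x) (Sum.inl ()))
      (Matrix.of fun x y => oddRow φ₀ (fun k u => -f * t k u) φ x (v (oddIdx m y))) := by
    ext x y
    obtain x | x := x <;> obtain y | y := y
    · change (w (evenIdx (m + 1) (cylIdx m (Sum.inl ())))).1 = _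
      rw [evenIdx_cylIdx_inl, hw₀]
      simp
    · change (w (evenIdx (m + 1) (cylIdx m (Sum.inr y)))).1 = _
      rw [evenIdx_cylIdx_inr, hw]
      simp
    · rfl
    · change oddRow (fun u => φ₀ u.2) μ ν x (w (evenIdx (m + 1) (cylIdx m (Sum.inr y)))) = _
      rw [evenIdx_cylIdx_inr, hw]
      obtain _ | ⟨k, _ | _⟩ := x <;> simp [oddRow, pairRow, μ, ν]
  rw [h1, Matrix.det_updateRow_sum, h2, Matrix.det_fromBlocks_zero₁₂, Matrix.det_one, one_mul]
  have h3 := oddDet_smul φ₀ t φ (-f) v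
  unfold oddDet at h3
  rw [h3, neg_pow, Sum.elim_inl, smul_eq_mul, oddDet]
  ring

end WedgePowers

/-! ### Real coordinates adapted to the trace relation -/

section Coordinates

variable {K : Type u} [Field K]

/-- The real coordinates on `ℝ^r × ℂ^s`. -/
def realCoord : index K → mixedSpace K →ₗ[ℝ] ℝ
  | Sum.inl w => (LinearMap.proj w).comp (LinearMap.fst ℝ _ _)
  | Sum.inr (w, i) => (if i = 0 then Complex.reLm else Complex.imLm).comp
      ((LinearMap.proj w).comp (LinearMap.snd ℝ _ _))

@[simp] theorem realCoord_inl (w : {w : InfinitePlace K // IsReal w}) (x : mixedSpace K) :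
    realCoord (Sum.inl w) x = x.1 w := rfl

@[simp] theorem realCoord_inr_zero (w : {w : InfinitePlace K // IsComplex w}) (x : mixedSpace K) :
    realCoord (Sum.inr (w, 0)) x = (x.2 w).re := rfl

@[simp] theorem realCoord_inr_one (w : {w : InfinitePlace K // IsComplex w}) (x : mixedSpace K) :
    realCoord (Sum.inr (w, 1)) x = (x.2 w).im := rfl

theorem eq_zero_of_realCoord {x : mixedSpace K} (h : ∀ k, realCoord k x = 0) : x = 0 := by
  refine Prod.ext (funext fun w => h (Sum.inl w)) (funext fun w => Complex.ext ?_ ?_)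
  · exact h (Sum.inr (w, 0))
  · exact h (Sum.inr (w, 1))

variable [NumberField K]

theorem card_index : Fintype.card (index K) = finrank ℚ K := by
  rw [← mixedEmbedding.finrank K, finrank_eq_card_basis (stdBasis K)]

theorem sum_index {R : Type*} [AddCommMonoid R] (F : index K → R) :
    ∑ k, F k = ∑ w, F (Sum.inl w) + ∑ w, (F (Sum.inr (w, 0)) + F (Sum.inr (w, 1))) := by
  rw [Fintype.sum_sum_type, Fintype.sum_prod_type]
  simp

/-- The coefficients of the trace form in the real coordinates. -/
def traceCoeff : index K → ℝ
  | Sum.inl _ => 1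
  | Sum.inr (_, i) => if i = 0 then 2 else 0

/-- The coefficients of the standard contact form in the real coordinates. -/
def contactCoeff : index K → ℝ
  | Sum.inl _ => 1
  | Sum.inr (_, i) => if i = 0 then 1 else 0

/-- The signs of the standard `2`-form in the real coordinates. -/
def signCoeff : index K → ℝ
  | Sum.inl _ => 1
  | Sum.inr (_, i) => if i = 0 then 1 else -1

theorem sum_traceCoeff_mul (x : hyperplane K) : ∑ k, traceCoeff k * realCoord k x.1 = 0 := by
  rw [sum_index]
  have h : traceForm K x.1 = 0 := x.2
  refine Eq.trans ?_ h
  simp [traceCoeff, traceForm, Finset.mul_sum]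

/-- The number r + 2s = n; its being nonzero is the reason why the standard form is contact. -/
theorem sum_traceCoeff_mul_contactCoeff :
    ∑ k : index K, traceCoeff k * contactCoeff k = finrank ℚ K := by
  rw [sum_index, ← card_add_two_mul_card_eq_rank K]
  simp [traceCoeff, contactCoeff]
  rw [mul_comm]

theorem exists_traceCoeff_ne_zero : ∃ k : index K, traceCoeff k ≠ 0 := by
  by_contra! h
  have h1 := sum_traceCoeff_mul_contactCoeff (K := K)
  simp only [h, zero_mul, Finset.sum_const_zero] at h1
  have := finrank_pos (R := ℚ) (M := K)
  exact this.ne (by exact_mod_cast h1)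

/-- The horizontal coordinates on the solvable group. -/
def baseCoord (k : index K) (u : SolvModel K) : ℝ := realCoord k u.1.1

/-- The vertical coordinates on the solvable group, up to a sign. -/
def fiberCoord (k : index K) (u : SolvModel K) : ℝ := signCoeff k * realCoord k u.2

/-- The index k₀ is the one whose base coordinate the trace relation eliminates. The splitting of
sums is what later computations use; injectivity of g is not recorded. -/
theorem exists_enumeration (k₀ : index K) {m : ℕ} (hm : finrank ℚ K = m + 1) :
    ∃ g : Fin m → index K, (∀ i, g i ≠ k₀) ∧ (∀ k, k ≠ k₀ → ∃ i, g i = k) ∧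
      ∀ F : index K → ℝ, ∑ k, F k = F k₀ + ∑ i, F (g i) := by
  have e : index K ≃ Fin (m + 1) := Fintype.equivFinOfCardEq (card_index.trans hm)
  let e' : Fin (m + 1) ≃ index K := (e.trans (Equiv.swap (e k₀) 0)).symm
  have h0 : e' 0 = k₀ := by simp [e']
  refine ⟨fun i => e' i.succ, fun i hi => ?_, fun k hk => ?_, fun F => ?_⟩
  · rw [← h0] at hi
    exact Fin.succ_ne_zero _ (e'.injective hi)
  · obtain ⟨j, rfl⟩ := e'.surjective k
    have hj : j ≠ 0 := by rintro rfl; exact hk h0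
    obtain ⟨i, rfl⟩ := Fin.exists_succ_eq.2 hj
    exact ⟨i, rfl⟩
  · rw [← e'.sum_comp, Fin.sum_univ_succ, h0]

/-- An adapted basis of the Lie algebra, dual to a coordinate system. -/
theorem exists_basis_det (k₀ : index K) (hk₀ : traceCoeff k₀ ≠ 0) {m : ℕ}
    (hm : finrank ℚ K = m + 1) (g : Fin m → index K) (hg : ∀ k, k ≠ k₀ → ∃ i, g i = k)
    (hsum : ∀ F : index K → ℝ, ∑ k, F k = F k₀ + ∑ i, F (g i)) :
    ∃ b : Basis (Fin (2 * m + 1)) ℝ (SolvModel K), ∀ v,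
      oddDet (fiberCoord k₀) (fun i => baseCoord (g i)) (fun i => fiberCoord (g i)) v =
        b.det v := by
  let Ψ : SolvModel K →ₗ[ℝ] (Option (Fin m × Bool) → ℝ) :=
    { toFun := fun u x => oddRow (fiberCoord k₀) (fun i => baseCoord (g i))
        (fun i => fiberCoord (g i)) x u
      map_add' := fun u v => by
        ext x
        obtain _ | ⟨i, _ | _⟩ := x <;> simp [oddRow, pairRow, fiberCoord, baseCoord, mul_add]
      map_smul' := fun r u => by
        ext x
        obtain _ | ⟨i, _ | _⟩ := x <;>
          simp [oddRow, pairRow, fiberCoord, baseCoord, mul_left_comm] }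
  have hs (k : index K) : signCoeff k ≠ 0 := by
    obtain w | ⟨w, i⟩ := k
    · simp [signCoeff]
    · simp only [signCoeff]; split_ifs <;> norm_num
  have hinj : Function.Injective Ψ := by
    refine (injective_iff_map_eq_zero Ψ).2 fun u hu => ?_
    have h0 : fiberCoord k₀ u = 0 := congrFun hu none
    have h1 (i) : baseCoord (g i) u = 0 := congrFun hu (some (i, false))
    have h2 (i) : fiberCoord (g i) u = 0 := congrFun hu (some (i, true))
    -- The base coordinate missing from the list is recovered from the trace relation, since its
    -- coefficient is nonzero.
    have h3 : baseCoord k₀ u = 0 := by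
      have h4 := sum_traceCoeff_mul u.1
      rw [hsum, Finset.sum_eq_zero, add_zero] at h4
      · exact (mul_eq_zero.1 h4).resolve_left hk₀
      · intro i _
        have := h1 i
        rw [baseCoord] at this
        rw [this, mul_zero]
    refine Prod.ext (Subtype.ext (eq_zero_of_realCoord fun k => ?_))
      (eq_zero_of_realCoord fun k => ?_)
    · by_cases hk : k = k₀
      · exact hk ▸ h3
      · obtain ⟨i, rfl⟩ := hg k hk
        exact h1 i
    · by_cases hk : k = k₀
      · exact (mul_eq_zero.1 (hk ▸ h0 : fiberCoord k u = 0)).resolve_left (hs k)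
      · obtain ⟨i, rfl⟩ := hg k hk
        exact (mul_eq_zero.1 (h2 i)).resolve_left (hs _)
  -- Both sides have dimension 2n - 1 = 2m + 1.
  have hrank : finrank ℝ (SolvModel K) = finrank ℝ (Option (Fin m × Bool) → ℝ) := by
    rw [finrank_solvModel, hm, finrank_fintype_fun_eq_card]
    simp
    omega
  let Ψ' := LinearEquiv.ofInjectiveOfFinrankEq Ψ hinj hrank
  let b' : Basis (Option (Fin m × Bool)) ℝ (SolvModel K) := Basis.ofEquivFun Ψ'
  refine ⟨b'.reindex (oddIdx m), fun v => ?_⟩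
  rw [Basis.det_reindex, Basis.det_apply]
  rfl

theorem factorCovector_apply (a c : {w : InfinitePlace K // IsReal w} → ℝ)
    (p q : {w : InfinitePlace K // IsComplex w} → ℂ) (x : SolvModel K) :
    factorCovector a c p q x = ∑ w, (a w * x.1.1.1 w + c w * x.2.1 w) +
      ∑ w, (p w * x.1.1.2 w + q w * x.2.2 w).re := rfl

theorem factorCovector_standard_apply (u : SolvModel K) :
    factorCovector 0 1 0 1 u = ∑ k, contactCoeff k * signCoeff k * fiberCoord k u := by
  rw [factorCovector_apply, sum_index]
  simp [fiberCoord, contactCoeff, signCoeff]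

/-- Since Re(wz) = Re w Re z - Im w Im z, the sign built into the fibre coordinates at imaginary
parts makes all terms enter with the same sign. -/
theorem bracketForm_standard_apply (u v : SolvModel K) :
    bracketForm (factorCovector 0 1 0 1) u v =
      ∑ k, (baseCoord k u * fiberCoord k v - fiberCoord k u * baseCoord k v) := by
  rw [bracketForm, factorCovector_apply, sum_index]
  simp only [fiberCoord, baseCoord, signCoeff, realCoord_inl, realCoord_inr_zero,
    realCoord_inr_one]
  congr 1
  · refine Finset.sum_congr rfl fun w _ => ?_
    simp
    ring
  · refine Finset.sum_congr rfl fun w _ => ?_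
    simp
    ring

/-- The covector defining the forms of the Liouville pair: the coefficient at one real place is
replaced by a sign. -/
def pairCovector (w₀ : {w : InfinitePlace K // IsReal w}) (ε : ℝ) : SolvModel K →L[ℝ] ℝ :=
  factorCovector 0 (Function.update 1 w₀ ε) 0 1

theorem pairCovector_apply (w₀ : {w : InfinitePlace K // IsReal w}) (ε : ℝ) (u : SolvModel K) :
    pairCovector w₀ ε u = factorCovector 0 1 0 1 u + (ε - 1) * fiberCoord (Sum.inl w₀) u := by
  rw [pairCovector, factorCovector_apply, factorCovector_apply, add_right_comm]
  congr 1
  have h (w) : (0 : {w : InfinitePlace K // IsReal w} → ℝ) w * u.1.1.1 w +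
      Function.update (1 : {w : InfinitePlace K // IsReal w} → ℝ) w₀ ε w * u.2.1 w =
      ((0 : {w : InfinitePlace K // IsReal w} → ℝ) w * u.1.1.1 w +
        (1 : {w : InfinitePlace K // IsReal w} → ℝ) w * u.2.1 w) +
      if w = w₀ then (ε - 1) * fiberCoord (Sum.inl w₀) u else 0 := by
    split_ifs with hw
    · subst hw
      simp [fiberCoord, signCoeff]
      ring
    · simp [Function.update_of_ne hw]
  rw [Finset.sum_congr rfl fun w _ => h w, Finset.sum_add_distrib, Finset.sum_ite_eq' Finset.univ w₀]
  simp

theorem bracketForm_pairCovector (w₀ : {w : InfinitePlace K // IsReal w}) (ε : ℝ)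
    (u v : SolvModel K) :
    bracketForm (pairCovector w₀ ε) u v = bracketForm (factorCovector 0 1 0 1) u v +
      (ε - 1) * (baseCoord (Sum.inl w₀) u * fiberCoord (Sum.inl w₀) v -
        fiberCoord (Sum.inl w₀) u * baseCoord (Sum.inl w₀) v) := by
  rw [bracketForm, pairCovector_apply, ← bracketForm]
  congr 2
  simp [fiberCoord, baseCoord, signCoeff]
  ring

end Coordinates

/-! ### The contact condition and the coadjoint orbit of the standard covector -/

section ContactForms

variable {K : Type u} [Field K] [NumberField K]

theorem exists_finrank_eq_add_one : ∃ m, finrank ℚ K = m + 1 :=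
  ⟨finrank ℚ K - 1, by have := finrank_pos (R := ℚ) (M := K); omega⟩

theorem relation_of_enumeration {m : ℕ} {k₀ : index K} (hk₀ : traceCoeff k₀ ≠ 0)
    {g : Fin m → index K} (hsum : ∀ F : index K → ℝ, ∑ k, F k = F k₀ + ∑ i, F (g i))
    (u : SolvModel K) :
    baseCoord k₀ u = -∑ i, traceCoeff (g i) / traceCoeff k₀ * baseCoord (g i) u := by
  have h := sum_traceCoeff_mul u.1
  rw [hsum] at h
  simp only [div_mul_eq_mul_div]
  rw [← Finset.sum_div]
  unfold baseCoord
  field_simp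
  linarith

/-- This is the identity ∑ c_k e_k = n divided by the coefficient at k₀; the signs drop out because
the contact coefficient vanishes wherever the sign is -1. -/
theorem sum_div_traceCoeff {m : ℕ} {k₀ : index K} (hk₀ : traceCoeff k₀ ≠ 0)
    (hm : finrank ℚ K = m + 1) {g : Fin m → index K}
    (hsum : ∀ F : index K → ℝ, ∑ k, F k = F k₀ + ∑ i, F (g i)) :
    contactCoeff k₀ * signCoeff k₀ +
      ∑ i, traceCoeff (g i) / traceCoeff k₀ * (contactCoeff (g i) * signCoeff (g i)) =
      (m + 1) / traceCoeff k₀ := by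
  have h1 (k : index K) : contactCoeff k * signCoeff k = contactCoeff k := by
    obtain w | ⟨w, i⟩ := k
    · simp [signCoeff]
    · simp only [signCoeff, contactCoeff]; split_ifs <;> norm_num
  have h := sum_traceCoeff_mul_contactCoeff (K := K)
  rw [hsum, hm] at h
  push_cast at h
  rw [← h]
  simp only [h1, div_mul_eq_mul_div]
  rw [← Finset.sum_div]
  field_simp

/-- The value of `ℓ ∧ (dℓ)^m` for the covector defining the standard contact form. -/
theorem exists_wedgeOneTwoPow_standard_ne_zero {m : ℕ} (hm : finrank ℚ K = m + 1) :
    ∃ v : Fin (2 * m + 1) → SolvModel K,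
      wedgeOneTwoPow m (factorCovector 0 1 0 1)
        (fun u v => -bracketForm (factorCovector 0 1 0 1) u v) v ≠ 0 := by
  obtain ⟨k₀, hk₀⟩ := exists_traceCoeff_ne_zero (K := K)
  obtain ⟨g, -, hg, hsum⟩ := exists_enumeration k₀ hm
  obtain ⟨b, hb⟩ := exists_basis_det k₀ hk₀ hm g hg hsum
  refine ⟨b, ?_⟩
  rw [wedgeOneTwoPow_of_relation _ (baseCoord k₀) (fiberCoord k₀) _ (fun i => baseCoord (g i))
    (fun i => fiberCoord (g i)) (contactCoeff k₀ * signCoeff k₀)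
    (fun i => traceCoeff (g i) / traceCoeff k₀) (fun i => contactCoeff (g i) * signCoeff (g i))
    (relation_of_enumeration hk₀ hsum), hb, b.det_self, sum_div_traceCoeff hk₀ hm hsum]
  · have h1 : ((m : ℝ) + 1) / traceCoeff k₀ ≠ 0 := div_ne_zero (by positivity) hk₀
    have h2 : (m.factorial : ℝ) ≠ 0 := by positivity
    have h3 : ((-1 : ℝ) ^ m * 1) ≠ 0 := by simp
    exact mul_ne_zero h2 (mul_ne_zero h1 h3)
  · intro u
    rw [factorCovector_standard_apply, hsum]
  · intro u v
    rw [bracketForm_standard_apply, hsum]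

theorem wedgeOneTwoPow_smul {V : Type*} (m : ℕ) (a : V → ℝ) (η : V → V → ℝ) (r : ℝ)
    (v : Fin (2 * m + 1) → V) :
    wedgeOneTwoPow m (fun u => r * a u) (fun u v => r * η u v) v =
      r ^ (m + 1) * wedgeOneTwoPow m a η v := by
  unfold wedgeOneTwoPow
  rw [mul_left_comm, Finset.mul_sum _ _ (r ^ (m + 1))]
  congr 1
  refine Finset.sum_congr rfl fun τ _ => ?_
  rw [Finset.prod_mul_distrib, Finset.prod_const, Finset.card_univ, Fintype.card_fin]
  ring

variable (σ : EmbeddingChoice K)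

theorem contactVolume_inducedForm (m : ℕ) (ℓ : SolvModel K →L[ℝ] ℝ) (x : NFManifold K σ)
    (v : Fin (2 * m + 1) → SolvModel K) :
    (inducedForm σ ℓ).contactVolume m x v = wedgeOneTwoPow m ℓ (fun u v => -bracketForm ℓ u v)
      (fun i => scaleMap (-(chartCenter σ x).1.1) (v i)) := by
  have h1 : ∀ u v : SolvModel K, (inducedForm σ ℓ).d x u v =
      -bracketForm ℓ (scaleMap (-(chartCenter σ x).1.1) u) (scaleMap (-(chartCenter σ x).1.1) v) :=
    d_inducedForm σ ℓ x
  have h2 : ∀ u : SolvModel K, inducedForm σ ℓ x u = ℓ (scaleMap (-(chartCenter σ x).1.1) u) := by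
    intro u
    rw [inducedForm_eq]
    rfl
  unfold OneForm.contactVolume wedgeOneTwoPow
  congr 1
  refine Finset.sum_congr rfl fun τ _ => ?_
  congr 1
  exact congrArg₂ _ (h2 _) (Finset.prod_congr rfl fun i _ => h1 _ _)

/-- By left invariance, nonvanishing of the volume on one frame of the Lie algebra gives it at every
point: the frame is transported by the left-translation derivative. -/
theorem isContactForm_inducedForm {m : ℕ} (hm : finrank ℚ K = m + 1) (ℓ : SolvModel K →L[ℝ] ℝ)
    (hℓ : ∃ v : Fin (2 * m + 1) → SolvModel K,
      wedgeOneTwoPow m ℓ (fun u v => -bracketForm ℓ u v) v ≠ 0) :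
    IsContactForm m (inducedForm σ ℓ) := by
  obtain ⟨v, hv⟩ := hℓ
  refine ⟨?_, smooth_inducedForm σ ℓ, fun x =>
    ⟨fun i => scaleMap ((chartCenter σ x).1.1) (v i), ?_⟩⟩
  · rw [finrank_solvModel, hm]
    omega
  · have h : (inducedForm σ ℓ).contactVolume m x
        (fun i => scaleMap ((chartCenter σ x).1.1) (v i)) = _ :=
      contactVolume_inducedForm σ m ℓ x _
    rw [h]
    convert hv using 2
    funext i
    exact congrFun (congrArg DFunLike.coe (scaleMap_neg_comp (chartCenter σ x).1.1)) (v i)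

/-- The coadjoint action: the automorphism of the Lie algebra by which right translations act on
left-invariant forms. -/
def adjointMap (h : SolvModel K) : SolvModel K →ₗ[ℝ] SolvModel K where
  toFun u := (u.1, mixedExp (-h.1.1) * (u.2 + u.1.1 * h.2))
  map_add' u v := by
    refine Prod.ext rfl ?_
    change _ * ((u.2 + v.2) + (u.1.1 + v.1.1) * h.2) = _ + _
    ring
  map_smul' r u := by
    refine Prod.ext rfl ?_
    change mixedExp (-h.1.1) * (r • u.2 + (r • u.1.1) * h.2) =
      r • (mixedExp (-h.1.1) * (u.2 + u.1.1 * h.2))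
    rw [smul_mul_assoc, ← smul_add, mul_smul_comm]

theorem adjointMap_apply (h u : SolvModel K) :
    adjointMap h u = (u.1, mixedExp (-h.1.1) * (u.2 + u.1.1 * h.2)) := rfl

/-- Expresses that `adjointMap h` is an automorphism of the Lie algebra. -/
theorem bracketForm_adjointMap (ℓ : SolvModel K →L[ℝ] ℝ) (h u v : SolvModel K) :
    bracketForm ℓ (adjointMap h u) (adjointMap h v) =
      ℓ (adjointMap h (0, u.1.1 * v.2 - v.1.1 * u.2)) := by
  rw [bracketForm]
  congr 1
  refine Prod.ext rfl ?_
  change u.1.1 * (mixedExp (-h.1.1) * (v.2 + v.1.1 * h.2)) -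
    v.1.1 * (mixedExp (-h.1.1) * (u.2 + u.1.1 * h.2)) =
    mixedExp (-h.1.1) * ((u.1.1 * v.2 - v.1.1 * u.2) + 0 * h.2)
  ring

/-- Every left-invariant Liouville form on the factors lies, up to a positive factor, in the
coadjoint orbit of the standard one. -/
theorem exists_adjointMap_factorCovector (a c : {w : InfinitePlace K // IsReal w} → ℝ)
    (p q : {w : InfinitePlace K // IsComplex w} → ℂ) (hc : ∀ w, 0 < c w) (hq : ∀ w, q w ≠ 0) :
    ∃ (h : SolvModel K) (r : ℝ), 0 < r ∧ ∀ u, factorCovector a c p q (adjointMap h u) =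
      r * factorCovector 0 1 0 1 u := by
  let l : mixedSpace K := (fun w => Real.log (c w), fun w => Complex.log (q w))
  -- Here d is the weighted mean of the logarithms of the coefficients. Subtracting it puts l into
  -- the hyperplane, so the fibre coefficients can be normalized only to the common value e^d; this
  -- is the positive factor in the conclusion.
  obtain ⟨d, hd⟩ : ∃ d : ℝ, traceForm K l = d * finrank ℚ K :=
    ⟨traceForm K l / finrank ℚ K, by
      rw [div_mul_cancel₀]
      exact_mod_cast finrank_pos.ne'⟩
  have h1 : traceForm K 1 = finrank ℚ K := by
    rw [← card_add_two_mul_card_eq_rank K]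
    simp [traceForm]
  let t : hyperplane K := ⟨l - d • 1, by
    rw [LinearMap.mem_ker, map_sub, map_smul, h1, hd, smul_eq_mul, sub_self]⟩
  -- Translating by z adds e^d z to the base coefficients, and this choice cancels a and p.
  let z : mixedSpace K := (fun w => -a w / Real.exp d, fun w => -p w / Complex.exp d)
  have ht : mixedExp (-t.1) = (fun w => Real.exp d / c w, fun w => Complex.exp d / q w) := by
    refine Prod.ext (funext fun w => ?_) (funext fun w => ?_)
    · change Real.exp (-(Real.log (c w) - d * 1)) = _
      rw [mul_one, neg_sub, Real.exp_sub, Real.exp_log (hc w)]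
    · change Complex.exp (-(Complex.log (q w) - (d : ℝ) • 1)) = _
      rw [Complex.real_smul, mul_one, neg_sub, Complex.exp_sub, Complex.exp_log (hq w)]
  refine ⟨(t, z), Real.exp d, Real.exp_pos d, fun u => ?_⟩
  rw [adjointMap_apply]
  change factorCovector a c p q (u.1, mixedExp (-t.1) * (u.2 + u.1.1 * z)) = _
  rw [ht, factorCovector_apply, factorCovector_apply,
    mul_add (Real.exp d), Finset.mul_sum, Finset.mul_sum]
  congr 1
  · refine Finset.sum_congr rfl fun w _ => ?_
    simp only [Prod.fst_mul, Prod.fst_add, Pi.mul_apply, Pi.add_apply, Pi.zero_apply, Pi.one_apply,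
      z]
    have := (hc w).ne'
    have := (Real.exp_pos d).ne'
    field_simp
    ring
  · refine Finset.sum_congr rfl fun w _ => ?_
    simp only [Prod.snd_mul, Prod.snd_add, Pi.mul_apply, Pi.add_apply, Pi.zero_apply, Pi.one_apply,
      z, zero_mul, one_mul, zero_add]
    rw [← Complex.re_ofReal_mul, Complex.ofReal_exp]
    congr 1
    have := hq w
    have := Complex.exp_ne_zero d
    field_simp
    ring

theorem isContactForm_nfContactForm {m : ℕ} (hm : finrank ℚ K = m + 1) :
    IsContactForm m (nfContactForm σ) :=
  isContactForm_inducedForm σ hm _ (exists_wedgeOneTwoPow_standard_ne_zero hm)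

/-- Evaluated on the standard frame moved by the Lie algebra automorphism `adjointMap h`, the volume
is r^{m+1} times the standard one. -/
theorem isContactForm_factorCovector {m : ℕ} (hm : finrank ℚ K = m + 1)
    (a c : {w : InfinitePlace K // IsReal w} → ℝ)
    (p q : {w : InfinitePlace K // IsComplex w} → ℂ) (hc : ∀ w, 0 < c w) (hq : ∀ w, q w ≠ 0) :
    IsContactForm m (inducedForm σ (factorCovector a c p q)) := by
  refine isContactForm_inducedForm σ hm _ ?_
  obtain ⟨v, hv⟩ := exists_wedgeOneTwoPow_standard_ne_zero hm
  obtain ⟨h, r, hr, hh⟩ := exists_adjointMap_factorCovector a c p q hc hq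
  refine ⟨fun i => adjointMap h (v i), ?_⟩
  have h1 := wedgeOneTwoPow_smul m (factorCovector 0 1 0 1)
    (fun u v => -bracketForm (factorCovector 0 1 0 1) u v) r v
  have h2 : wedgeOneTwoPow m (factorCovector a c p q)
      (fun u v => -bracketForm (factorCovector a c p q) u v) (fun i => adjointMap h (v i)) =
      wedgeOneTwoPow m (fun u => factorCovector a c p q (adjointMap h u))
      (fun u v => -bracketForm (factorCovector a c p q) (adjointMap h u) (adjointMap h v)) v := rfl
  rw [h2]
  simp only [bracketForm_adjointMap, hh]
  simp only [bracketForm, ← mul_neg] at h1 ⊢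
  rw [h1]
  exact mul_ne_zero (pow_ne_zero _ hr.ne') hv

end ContactForms

/-! ### Right translations on the quotient and the contact isotopy -/

section RightTranslations

variable {K : Type u} [Field K] [NumberField K] (σ : EmbeddingChoice K)

section Descent

variable {E' : Type*} [NormedAddCommGroup E'] [NormedSpace ℝ E'] {H' : Type*} [TopologicalSpace H']
  {J : ModelWithCorners ℝ E' H'} {N : Type*} [TopologicalSpace N] [ChartedSpace H' N]
  {E'' : Type*} [NormedAddCommGroup E''] [NormedSpace ℝ E''] {H'' : Type*} [TopologicalSpace H'']
  {J' : ModelWithCorners ℝ E'' H''} {N' : Type*} [TopologicalSpace N'] [ChartedSpace H'' N']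

/-- Smoothness can be tested on the covering because π has smooth local inverses. -/
theorem contMDiffAt_of_comp_proj {f : NFManifold K σ → N} (g : SolvModel K)
    (hf : ContMDiffAt 𝓘(ℝ, SolvModel K) J ∞ (fun g => f (proj σ g)) g) :
    ContMDiffAt 𝓘(ℝ, SolvModel K) J ∞ f (proj σ g) := by
  have h1 := (contMDiffOn_localInv σ g).contMDiffAt
    ((localInv σ g).open_source.mem_nhds (mem_localInv_source σ g))
  have h2 : ContMDiffAt 𝓘(ℝ, SolvModel K) J ∞
      ((fun g => f (proj σ g)) ∘ localInv σ g) (proj σ g) := by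
    refine ContMDiffAt.comp _ ?_ h1
    rwa [localInv_proj_self]
  refine h2.congr_of_eventuallyEq ?_
  filter_upwards [(localInv σ g).open_source.mem_nhds (mem_localInv_source σ g)] with x hx
  exact (congrArg f (proj_localInv σ g hx)).symm

theorem contMDiff_of_comp_proj {f : NFManifold K σ → N}
    (hf : ContMDiff 𝓘(ℝ, SolvModel K) J ∞ (fun g => f (proj σ g))) :
    ContMDiff 𝓘(ℝ, SolvModel K) J ∞ f := by
  intro x
  obtain ⟨g, rfl⟩ := proj_surjective σ x
  exact contMDiffAt_of_comp_proj σ g (hf g)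

theorem contMDiff_of_comp_prod_proj {f : N' × NFManifold K σ → N}
    (hf : ContMDiff (J'.prod 𝓘(ℝ, SolvModel K)) J ∞
      (fun p : N' × SolvModel K => f (p.1, proj σ p.2))) :
    ContMDiff (J'.prod 𝓘(ℝ, SolvModel K)) J ∞ f := by
  rintro ⟨y, x⟩
  obtain ⟨g, rfl⟩ := proj_surjective σ x
  have h1 := (contMDiffOn_localInv σ g).contMDiffAt
    ((localInv σ g).open_source.mem_nhds (mem_localInv_source σ g))
  have h3 : ContMDiffAt (J'.prod 𝓘(ℝ, SolvModel K)) (J'.prod 𝓘(ℝ, SolvModel K)) ∞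
      (fun p : N' × NFManifold K σ => (p.1, localInv σ g p.2)) (y, proj σ g) :=
    contMDiffAt_fst.prodMk (ContMDiffAt.comp (y, proj σ g) (g := localInv σ g) (f := Prod.snd)
      h1 contMDiffAt_snd)
  refine ((hf _).comp (y, proj σ g) h3).congr_of_eventuallyEq ?_
  have h4 : ∀ᶠ p : N' × NFManifold K σ in 𝓝 (y, proj σ g), p.2 ∈ (localInv σ g).source :=
    continuous_snd.continuousAt.eventually
      ((localInv σ g).open_source.mem_nhds (mem_localInv_source σ g))
  filter_upwards [h4] with p hp
  exact (congrArg (fun x => f (p.1, x)) (proj_localInv σ g hp)).symm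

end Descent

theorem leftTranslate_assoc (a b c : SolvModel K) :
    leftTranslate (leftTranslate a b) c = leftTranslate a (leftTranslate b c) :=
  mul_assoc (G := SolvGroup K) a b c

/-- The map of the quotient induced by a right translation. -/
def rightTranslate (h : SolvModel K) (x : NFManifold K σ) : NFManifold K σ :=
  proj σ (leftTranslate (chartCenter σ x) h)

/-- Left and right translations commute, so the choice of representative does not matter. -/
theorem rightTranslate_proj (h g : SolvModel K) :
    rightTranslate σ h (proj σ g) = proj σ (leftTranslate g h) := by
  obtain ⟨γ, hγ, h1⟩ := (proj_eq_proj_iff σ).1 (proj_chartCenter σ (proj σ g)).symm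
  rw [rightTranslate, ← h1]
  exact (congrArg (proj σ) (leftTranslate_assoc γ g h)).trans (proj_leftTranslate σ hγ _)

/-- The inverse in the solvable group. -/
def solvInv (h : SolvModel K) : SolvModel K := (-h.1, -(mixedExp (-h.1.1) * h.2))

theorem leftTranslate_solvInv (h : SolvModel K) : leftTranslate h (solvInv h) = 0 :=
  mul_inv_cancel (G := SolvGroup K) h

theorem solvInv_leftTranslate (h : SolvModel K) : leftTranslate (solvInv h) h = 0 :=
  inv_mul_cancel (G := SolvGroup K) h

theorem leftTranslate_zero (g : SolvModel K) : leftTranslate g 0 = g := mul_one (M := SolvGroup K) g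

theorem contMDiff_rightTranslate {E' : Type*} [NormedAddCommGroup E'] [NormedSpace ℝ E']
    {H' : Type*} [TopologicalSpace H'] {J : ModelWithCorners ℝ E' H'} {N : Type*}
    [TopologicalSpace N] [ChartedSpace H' N] {h : N → SolvModel K}
    (hh : ContMDiff J 𝓘(ℝ, SolvModel K) ∞ h) :
    ContMDiff (J.prod 𝓘(ℝ, SolvModel K)) 𝓘(ℝ, SolvModel K) ∞
      fun p : N × NFManifold K σ => rightTranslate σ (h p.1) p.2 := by
  refine contMDiff_of_comp_prod_proj σ ?_
  have h1 : ContMDiff 𝓘(ℝ, SolvModel K × SolvModel K) 𝓘(ℝ, SolvModel K) ∞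
      fun p : SolvModel K × SolvModel K => leftTranslate p.1 p.2 :=
    (contDiff_leftTranslate (K := K)).contMDiff
  have h2 : ContMDiff (J.prod 𝓘(ℝ, SolvModel K)) 𝓘(ℝ, SolvModel K × SolvModel K) ∞
      fun p : N × SolvModel K => (p.2, h p.1) :=
    contMDiff_snd.prodMk_space (hh.comp contMDiff_fst)
  refine ((contMDiff_proj σ).comp (h1.comp h2)).congr fun p => ?_
  exact rightTranslate_proj σ (h p.1) p.2

theorem contMDiff_rightTranslate_const (h : SolvModel K) :
    ContMDiff 𝓘(ℝ, SolvModel K) 𝓘(ℝ, SolvModel K) ∞ (rightTranslate σ h) :=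
  (contMDiff_rightTranslate σ (J := 𝓘(ℝ, ℝ)) (h := fun _ : ℝ => h) contMDiff_const).comp
    ((contMDiff_const (c := (0 : ℝ))).prodMk contMDiff_id)

/-- A right translation, as a diffeomorphism of the quotient. -/
def rightDiffeo (h : SolvModel K) :
    Diffeomorph 𝓘(ℝ, SolvModel K) 𝓘(ℝ, SolvModel K) (NFManifold K σ) (NFManifold K σ) ∞ where
  toFun := rightTranslate σ h
  invFun := rightTranslate σ (solvInv h)
  left_inv x := by
    obtain ⟨g, rfl⟩ := proj_surjective σ x
    rw [rightTranslate_proj, rightTranslate_proj, leftTranslate_assoc, leftTranslate_solvInv,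
      leftTranslate_zero]
  right_inv x := by
    obtain ⟨g, rfl⟩ := proj_surjective σ x
    rw [rightTranslate_proj, rightTranslate_proj, leftTranslate_assoc, solvInv_leftTranslate,
      leftTranslate_zero]
  contMDiff_toFun := contMDiff_rightTranslate_const σ h
  contMDiff_invFun := contMDiff_rightTranslate_const σ (solvInv h)

theorem hasFDerivAt_rightTranslate (h g : SolvModel K) :
    ∃ D : SolvModel K →L[ℝ] SolvModel K, HasFDerivAt (fun g => leftTranslate g h) D g ∧
      ∀ u, D u = (u.1, u.2 + mixedExp g.1.1 * u.1.1 * h.2) := by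
  have h1 : HasFDerivAt (fun t : hyperplane K => mixedExp t.1)
      ((ContinuousLinearMap.mul ℝ (mixedSpace K) (mixedExp g.1.1)).comp (hyperplane K).subtypeL)
      g.1 :=
    HasFDerivAt.comp (g := mixedExp) g.1 (hasFDerivAt_mixedExp g.1.1)
      (hyperplane K).subtypeL.hasFDerivAt
  have h2 := HasFDerivAt.comp (g := fun t : hyperplane K => mixedExp t.1) g h1
    (ContinuousLinearMap.fst ℝ (hyperplane K) (mixedSpace K)).hasFDerivAt
  have h3 := HasFDerivAt.comp g
    ((ContinuousLinearMap.mul ℝ (mixedSpace K)).flip h.2).hasFDerivAt h2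
  have h4 : HasFDerivAt (fun g : SolvModel K => g.1 + h.1)
      (ContinuousLinearMap.fst ℝ (hyperplane K) (mixedSpace K)) g :=
    (ContinuousLinearMap.fst ℝ (hyperplane K) (mixedSpace K)).hasFDerivAt.add_const h.1
  have h5 := h4.prodMk
    ((ContinuousLinearMap.snd ℝ (hyperplane K) (mixedSpace K)).hasFDerivAt.add h3)
  exact ⟨_, h5, fun u => rfl⟩

/-- The derivative of π is invertible, so a proportionality of forms verified on the covering
descends. -/
theorem pullback_comp_proj_eq {E' : Type*} [NormedAddCommGroup E'] [NormedSpace ℝ E']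
    {M' : Type*} [TopologicalSpace M'] [ChartedSpace E' M']
    {α : OneForm 𝓘(ℝ, SolvModel K) (NFManifold K σ)} {α' : OneForm 𝓘(ℝ, E') M'}
    {φ : NFManifold K σ → M'} (hφ : ContMDiff 𝓘(ℝ, SolvModel K) 𝓘(ℝ, E') ∞ φ) (r : ℝ)
    (h : ∀ g, OneForm.pullback 𝓘(ℝ, SolvModel K) 𝓘(ℝ, E') (φ ∘ proj σ) α' g =
      r • OneForm.pullback 𝓘(ℝ, SolvModel K) 𝓘(ℝ, SolvModel K) (proj σ) α g)
    (x : NFManifold K σ) :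
    OneForm.pullback 𝓘(ℝ, SolvModel K) 𝓘(ℝ, E') φ α' x = r • α x := by
  obtain ⟨g, rfl⟩ := proj_surjective σ x
  obtain ⟨γ, -, -, h1⟩ := exists_hasMFDerivAt_proj σ g
  have h2 := h g
  unfold OneForm.pullback at h2 ⊢
  have h3 := mfderiv_comp g ((hφ (proj σ g)).mdifferentiableAt (by simp)) h1.mdifferentiableAt
  rw [h3, h1.mfderiv] at h2
  refine ContinuousLinearMap.ext fun u => ?_
  have h4 := congrArg (fun A : SolvModel K →L[ℝ] ℝ => A (scaleMap (-γ.1.1) u)) h2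
  have h5 : scaleMap γ.1.1 (scaleMap (-γ.1.1) u) = u :=
    congrFun (congrArg DFunLike.coe (scaleMap_comp_neg γ.1.1)) u
  change α' (φ (proj σ g)) (mfderiv 𝓘(ℝ, SolvModel K) 𝓘(ℝ, E') φ (proj σ g)
    (scaleMap γ.1.1 (scaleMap (-γ.1.1) u))) =
    r • α (proj σ g) (scaleMap γ.1.1 (scaleMap (-γ.1.1) u)) at h4
  rw [h5] at h4
  exact h4

/-- The isotopy is right translation by s • h, which is the identity at s = 0. At s = 1 its
derivative, read in left-invariant frames at source and target, is `adjointMap h`, so the pullback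
of ℓ' is r times ℓ. -/
theorem contactIsotopic_of_adjointMap {ℓ ℓ' : SolvModel K →L[ℝ] ℝ} {h : SolvModel K} {r : ℝ}
    (hr : 0 < r) (hh : ∀ u, ℓ' (adjointMap h u) = r * ℓ u) :
    ContactIsotopic (inducedForm σ ℓ) (inducedForm σ ℓ') := by
  refine ⟨fun s => rightDiffeo σ (s • h), ?_, fun x => ?_, fun _ => r, fun _ => hr, ?_⟩
  · have h1 : ContMDiff 𝓘(ℝ, ℝ) 𝓘(ℝ, SolvModel K) ∞ fun s : ℝ => s • h := by
      have h2 : ContDiff ℝ ∞ fun s : ℝ => s • h := by fun_prop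
      exact h2.contMDiff
    exact contMDiff_rightTranslate σ h1
  · obtain ⟨g, rfl⟩ := proj_surjective σ x
    change rightTranslate σ ((0 : ℝ) • h) (proj σ g) = _
    rw [zero_smul, rightTranslate_proj, leftTranslate_zero]
  · refine pullback_comp_proj_eq σ (rightDiffeo σ ((1 : ℝ) • h)).contMDiff r fun g => ?_
    have h1 : ⇑(rightDiffeo σ ((1 : ℝ) • h)) ∘ proj σ = proj σ ∘ fun g => leftTranslate g h := by
      funext g
      rw [one_smul]
      exact rightTranslate_proj σ h g
    rw [h1, pullback_proj_inducedForm]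
    obtain ⟨D, hD, hD'⟩ := hasFDerivAt_rightTranslate h g
    have h2 := mfderiv_comp g ((contMDiff_proj σ _).mdifferentiableAt (by simp))
      hD.hasMFDerivAt.mdifferentiableAt
    have h3 := pullback_proj_inducedForm σ ℓ' (leftTranslate g h)
    unfold OneForm.pullback at h3 ⊢
    rw [h2, hD.hasMFDerivAt.mfderiv]
    refine ContinuousLinearMap.ext fun u => ?_
    have h4 := congrArg (fun A : SolvModel K →L[ℝ] ℝ => A (D u)) h3
    have key (u : SolvModel K) : ℓ' (scaleMap (-(g.1 + h.1).1) (D u)) =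
        r * ℓ (scaleMap (-g.1.1) u) := by
      rw [← hh, hD']
      congr 1
      refine Prod.ext rfl ?_
      change mixedExp (-(g.1.1 + h.1.1)) * (u.2 + mixedExp g.1.1 * u.1.1 * h.2) =
        mixedExp (-h.1.1) * (mixedExp (-g.1.1) * u.2 + u.1.1 * h.2)
      rw [neg_add, mixedExp_add]
      linear_combination (mixedExp (-h.1.1) * u.1.1 * h.2) * mixedExp_neg_mul g.1.1
    exact h4.trans (key u)

end RightTranslations

/-! ### Places and embeddings under a field isomorphism -/

section Places

theorem comap_comap_symm {K : Type u} [Field K] {L : Type v} [Field L] (f : K ≃+* L)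
    (w : InfinitePlace L) :
    (w.comap (f : K →+* L)).comap (f.symm : L →+* K) = w := by
  rw [← comap_comp]
  simp only [RingEquiv.comp_symm]
  exact comap_id w

variable {K : Type u} [Field K] {L : Type v} [Field L] (f : K ≃+* L) (σ : EmbeddingChoice K)
  (σ' : EmbeddingChoice L)

/-- The bijection of infinite places induced by an isomorphism of fields. -/
def placeEquiv : InfinitePlace L ≃ InfinitePlace K where
  toFun w := w.comap (f : K →+* L)
  invFun w := w.comap (f.symm : L →+* K)
  left_inv := comap_comap_symm f
  right_inv := comap_comap_symm f.symm

/-- The bijection of real places induced by an isomorphism of fields. -/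
def realPlaceEquiv : {w : InfinitePlace L // IsReal w} ≃ {w : InfinitePlace K // IsReal w} :=
  (placeEquiv f).subtypeEquiv fun _ => (isReal_comap_iff f).symm

/-- The bijection of complex places induced by an isomorphism of fields. -/
def complexPlaceEquiv :
    {w : InfinitePlace L // IsComplex w} ≃ {w : InfinitePlace K // IsComplex w} :=
  (placeEquiv f).subtypeEquiv fun w => by
    rw [← not_isReal_iff_isComplex, ← not_isReal_iff_isComplex]
    exact not_congr (isReal_comap_iff f).symm

theorem embedding_of_isReal_realPlaceEquiv (w : {w : InfinitePlace L // IsReal w}) (x : K) :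
    embedding_of_isReal (realPlaceEquiv f w).2 x = embedding_of_isReal w.2 (f x) := by
  have h := RingHom.congr_fun
    (comap_embedding_of_isReal (f : K →+* L) (w := w.1) (realPlaceEquiv f w).2) x
  have h1 := embedding_of_isReal_apply (realPlaceEquiv f w).2 x
  have h2 := embedding_of_isReal_apply w.2 (f x)
  exact_mod_cast (h1.trans h).trans h2.symm

/-- The comparison of two choices of a complex embedding. -/
def conjIso (w : {w : InfinitePlace L // IsComplex w}) : ℂ ≃ₐ[ℝ] ℂ :=
  if (σ (complexPlaceEquiv f w)).1 = (σ' w).1.comp (f : K →+* L) then AlgEquiv.refl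
  else Complex.conjAe

/-- Two complex embeddings that define the same place are equal or conjugate, so the case
distinction in `conjIso` is exhaustive. -/
theorem conjIso_apply (w : {w : InfinitePlace L // IsComplex w}) (x : K) :
    conjIso f σ σ' w ((σ (complexPlaceEquiv f w)).1 x) = (σ' w).1 (f x) := by
  unfold conjIso
  split_ifs with h
  · exact RingHom.congr_fun h x
  · have h1 : InfinitePlace.mk (σ (complexPlaceEquiv f w)).1 =
        InfinitePlace.mk ((σ' w).1.comp (f : K →+* L)) := by
      rw [(σ (complexPlaceEquiv f w)).2, ← comap_mk, (σ' w).2]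
      rfl
    have h2 := (mk_eq_iff.1 h1).resolve_left h
    exact RingHom.congr_fun h2 x

theorem conjIso_re (w : {w : InfinitePlace L // IsComplex w}) (z : ℂ) :
    (conjIso f σ σ' w z).re = z.re := by
  unfold conjIso
  split_ifs <;> simp

theorem conjIso_exp (w : {w : InfinitePlace L // IsComplex w}) (z : ℂ) :
    conjIso f σ σ' w (Complex.exp z) = Complex.exp (conjIso f σ σ' w z) := by
  unfold conjIso
  split_ifs
  · rfl
  · exact (Complex.exp_conj z).symm

theorem map_mem_positiveUnits_iff (x : (𝓞 K)ˣ) :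
    Units.map (RingOfIntegers.mapRingEquiv f).toMonoidHom x ∈ positiveUnits L ↔
      x ∈ positiveUnits K := by
  change (∀ w : {w : InfinitePlace L // IsReal w}, 0 < embedding_of_isReal w.2 (f (x : K))) ↔
    ∀ w : {w : InfinitePlace K // IsReal w}, 0 < embedding_of_isReal w.2 (x : K)
  rw [← (realPlaceEquiv f).forall_congr_right]
  simp only [embedding_of_isReal_realPlaceEquiv]

end Places

/-! ### Isomorphic fields give contactomorphic manifolds -/

section Isomorphisms

variable {K : Type u} [Field K] [NumberField K] {L : Type v} [Field L] [NumberField L]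

/-- An algebra isomorphism of the mixed spaces that respects the exponential maps and the trace
forms. -/
structure MixedIso (K : Type u) [Field K] [NumberField K] (L : Type v) [Field L]
    [NumberField L] where
  /-- the underlying linear isomorphism -/
  toEquiv : mixedSpace K ≃ₗ[ℝ] mixedSpace L
  map_mul : ∀ x y, toEquiv (x * y) = toEquiv x * toEquiv y
  map_exp : ∀ x, toEquiv (mixedExp x) = mixedExp (toEquiv x)
  map_trace : ∀ x, traceForm L (toEquiv x) = traceForm K x

namespace MixedIso

variable (Φ : MixedIso K L)

/-- The induced map of hyperplanes. -/
def hyperplaneEquiv : hyperplane K ≃ₗ[ℝ] hyperplane L where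
  toFun t := ⟨Φ.toEquiv t.1, by rw [LinearMap.mem_ker, Φ.map_trace]; exact t.2⟩
  map_add' _ _ := Subtype.ext (map_add Φ.toEquiv _ _)
  map_smul' _ _ := Subtype.ext (map_smul Φ.toEquiv _ _)
  invFun t := ⟨Φ.toEquiv.symm t.1, by
    rw [LinearMap.mem_ker, ← Φ.map_trace, LinearEquiv.apply_symm_apply]; exact t.2⟩
  left_inv t := Subtype.ext (Φ.toEquiv.symm_apply_apply t.1)
  right_inv t := Subtype.ext (Φ.toEquiv.apply_symm_apply t.1)

/-- The induced isomorphism of solvable groups. -/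
def solvEquiv : SolvModel K ≃L[ℝ] SolvModel L :=
  (Φ.hyperplaneEquiv.prodCongr Φ.toEquiv).toContinuousLinearEquiv

theorem solvEquiv_leftTranslate (a b : SolvModel K) :
    Φ.solvEquiv (leftTranslate a b) = leftTranslate (Φ.solvEquiv a) (Φ.solvEquiv b) := by
  refine Prod.ext (map_add Φ.hyperplaneEquiv _ _) ?_
  change Φ.toEquiv (a.2 + mixedExp a.1.1 * b.2) =
    Φ.toEquiv a.2 + mixedExp (Φ.toEquiv a.1.1) * Φ.toEquiv b.2
  rw [map_add, Φ.map_mul, Φ.map_exp]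

theorem solvEquiv_scaleMap (t : mixedSpace K) (u : SolvModel K) :
    Φ.solvEquiv (scaleMap t u) = scaleMap (Φ.toEquiv t) (Φ.solvEquiv u) := by
  refine Prod.ext rfl ?_
  change Φ.toEquiv (mixedExp t * u.2) = mixedExp (Φ.toEquiv t) * Φ.toEquiv u.2
  rw [Φ.map_mul, Φ.map_exp]

theorem proj_solvEquiv_eq_iff (σ : EmbeddingChoice K) (σ' : EmbeddingChoice L)
    (hΓ : ∀ γ : SolvModel K, γ ∈ solvLattice σ ↔ Φ.solvEquiv γ ∈ solvLattice σ')
    (a b : SolvModel K) :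
    proj σ' (Φ.solvEquiv a) = proj σ' (Φ.solvEquiv b) ↔ proj σ a = proj σ b := by
  rw [proj_eq_proj_iff, proj_eq_proj_iff]
  constructor
  · rintro ⟨γ, hγ, h⟩
    obtain ⟨γ, rfl⟩ := Φ.solvEquiv.surjective γ
    refine ⟨γ, (hΓ γ).2 hγ, Φ.solvEquiv.injective ?_⟩
    exact (Φ.solvEquiv_leftTranslate γ a).trans h
  · rintro ⟨γ, hγ, rfl⟩
    exact ⟨Φ.solvEquiv γ, (hΓ γ).1 hγ, (Φ.solvEquiv_leftTranslate γ a).symm⟩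

/-- An isomorphism of the solvable groups matching the lattices descends to a diffeomorphism, and
matching covectors make it strict: the conformal factor is 1. -/
theorem contactomorphic (σ : EmbeddingChoice K) (σ' : EmbeddingChoice L)
    (hΓ : ∀ γ : SolvModel K, γ ∈ solvLattice σ ↔ Φ.solvEquiv γ ∈ solvLattice σ')
    (ℓ : SolvModel K →L[ℝ] ℝ) (ℓ' : SolvModel L →L[ℝ] ℝ) (hℓ : ∀ u, ℓ' (Φ.solvEquiv u) = ℓ u) :
    Contactomorphic (inducedForm σ ℓ) (inducedForm σ' ℓ') := by
  let f : NFManifold K σ → NFManifold L σ' := fun x => proj σ' (Φ.solvEquiv (chartCenter σ x))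
  let f' : NFManifold L σ' → NFManifold K σ :=
    fun y => proj σ (Φ.solvEquiv.symm (chartCenter σ' y))
  have hf (g : SolvModel K) : f (proj σ g) = proj σ' (Φ.solvEquiv g) :=
    (Φ.proj_solvEquiv_eq_iff σ σ' hΓ _ _).2 (proj_chartCenter σ _)
  have hf' (g : SolvModel L) : f' (proj σ' g) = proj σ (Φ.solvEquiv.symm g) := by
    refine (Φ.proj_solvEquiv_eq_iff σ σ' hΓ _ _).1 ?_
    rw [ContinuousLinearEquiv.apply_symm_apply, ContinuousLinearEquiv.apply_symm_apply]
    exact proj_chartCenter σ' _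
  have hc : ContMDiff 𝓘(ℝ, SolvModel K) 𝓘(ℝ, SolvModel L) ∞ f := by
    refine contMDiff_of_comp_proj σ ?_
    simp only [hf]
    exact (contMDiff_proj σ').comp Φ.solvEquiv.contDiff.contMDiff
  have hc' : ContMDiff 𝓘(ℝ, SolvModel L) 𝓘(ℝ, SolvModel K) ∞ f' := by
    refine contMDiff_of_comp_proj σ' ?_
    simp only [hf']
    exact (contMDiff_proj σ).comp Φ.solvEquiv.symm.contDiff.contMDiff
  refine ⟨⟨⟨f, f', fun x => ?_, fun y => ?_⟩, hc, hc'⟩, fun _ => 1, fun _ => one_pos, ?_⟩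
  · obtain ⟨g, rfl⟩ := proj_surjective σ x
    rw [hf, hf', ContinuousLinearEquiv.symm_apply_apply]
  · obtain ⟨g, rfl⟩ := proj_surjective σ' y
    rw [hf', hf, ContinuousLinearEquiv.apply_symm_apply]
  · refine pullback_comp_proj_eq σ hc 1 fun g => ?_
    have h1 : f ∘ proj σ = proj σ' ∘ Φ.solvEquiv := funext hf
    rw [h1, pullback_proj_inducedForm]
    have h2 := mfderiv_comp g ((contMDiff_proj σ' _).mdifferentiableAt (by simp))
      (Φ.solvEquiv.contDiff.contMDiff.mdifferentiableAt (n := ∞) (by simp))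
    have h3 := pullback_proj_inducedForm σ' ℓ' (Φ.solvEquiv g)
    have h5 : HasFDerivAt Φ.solvEquiv (Φ.solvEquiv : SolvModel K →L[ℝ] SolvModel L) g :=
      Φ.solvEquiv.hasFDerivAt
    unfold OneForm.pullback at h3 ⊢
    rw [h2, h5.hasMFDerivAt.mfderiv]
    refine ContinuousLinearMap.ext fun u => ?_
    have h4 := congrArg (fun A : SolvModel L →L[ℝ] ℝ => A (Φ.solvEquiv u)) h3
    have key (u : SolvModel K) : ℓ' (scaleMap (-(Φ.solvEquiv g).1.1) (Φ.solvEquiv u)) =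
        1 * ℓ (scaleMap (-g.1.1) u) := by
      rw [one_mul, ← hℓ, solvEquiv_scaleMap, map_neg]
      rfl
    exact h4.trans (key u)

end MixedIso

variable (f : K ≃+* L) (σ : EmbeddingChoice K) (σ' : EmbeddingChoice L)

/-- The isomorphism of mixed spaces induced by an isomorphism of fields. -/
def mixedIso : MixedIso K L where
  toEquiv := (LinearEquiv.funCongrLeft ℝ ℝ (realPlaceEquiv f)).prodCongr
    ((LinearEquiv.funCongrLeft ℝ ℂ (complexPlaceEquiv f)).trans
      (LinearEquiv.piCongrRight fun w => (conjIso f σ σ' w).toLinearEquiv))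
  map_mul x y := by
    refine Prod.ext rfl (funext fun w => ?_)
    exact map_mul (conjIso f σ σ' w) _ _
  map_exp x := by
    refine Prod.ext rfl (funext fun w => ?_)
    exact conjIso_exp f σ σ' w _
  map_trace x := by
    change (∑ w, x.1 (realPlaceEquiv f w)) +
      2 * ∑ w, (conjIso f σ σ' w (x.2 (complexPlaceEquiv f w))).re = _
    simp only [conjIso_re]
    rw [(realPlaceEquiv f).sum_comp x.1, (complexPlaceEquiv f).sum_comp fun w => (x.2 w).re]
    rfl

theorem mixedIso_jEmbedding (x : K) :
    (mixedIso f σ σ').toEquiv (jEmbedding σ x) = jEmbedding σ' (f x) := by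
  refine Prod.ext (funext fun w => ?_) (funext fun w => ?_)
  · exact embedding_of_isReal_realPlaceEquiv f w x
  · exact conjIso_apply f σ σ' w x

theorem mem_solvLattice_iff_mixedIso (γ : SolvModel K) :
    γ ∈ solvLattice σ ↔ (mixedIso f σ σ').solvEquiv γ ∈ solvLattice σ' := by
  have h1 : γ.1 ∈ unitLattice σ ↔ ((mixedIso f σ σ').solvEquiv γ).1 ∈ unitLattice σ' := by
    constructor
    · rintro ⟨x, hx, h⟩
      refine ⟨_, (map_mem_positiveUnits_iff f x).2 hx, ?_⟩
      have h2 := congrArg (mixedIso f σ σ').toEquiv h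
      rw [MixedIso.map_exp, mixedIso_jEmbedding] at h2
      exact h2
    · rintro ⟨y, hy, h⟩
      obtain ⟨x, rfl⟩ : ∃ x, Units.map (RingOfIntegers.mapRingEquiv f).toMonoidHom x = y :=
        (Units.mapEquiv (RingOfIntegers.mapRingEquiv f).toMulEquiv).surjective y
      refine ⟨x, (map_mem_positiveUnits_iff f x).1 hy, (mixedIso f σ σ').toEquiv.injective ?_⟩
      rw [MixedIso.map_exp, mixedIso_jEmbedding]
      exact h
  have h2 : (∃ x : 𝓞 K, γ.2 = jEmbedding σ (x : K)) ↔
      ∃ x : 𝓞 L, ((mixedIso f σ σ').solvEquiv γ).2 = jEmbedding σ' (x : L) := by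
    constructor
    · rintro ⟨x, h⟩
      refine ⟨RingOfIntegers.mapRingEquiv f x, ?_⟩
      have h3 := congrArg (mixedIso f σ σ').toEquiv h
      rw [mixedIso_jEmbedding] at h3
      exact h3
    · rintro ⟨y, h⟩
      obtain ⟨x, rfl⟩ := (RingOfIntegers.mapRingEquiv f).surjective y
      refine ⟨x, (mixedIso f σ σ').toEquiv.injective ?_⟩
      rw [mixedIso_jEmbedding]
      exact h
  exact and_congr h1 h2

/-- The covector involves only real coordinates and real parts. These are permuted by the
isomorphism and unaffected by conjugation, so the choices of complex embeddings are immaterial. -/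
theorem contactomorphic_of_ringEquiv {K : Type u} [Field K] [NumberField K] {L : Type v}
    [Field L] [NumberField L] (f : K ≃+* L) (σ : EmbeddingChoice K) (σ' : EmbeddingChoice L) :
    Contactomorphic (nfContactForm σ) (nfContactForm σ') := by
  refine (mixedIso f σ σ').contactomorphic σ σ' (mem_solvLattice_iff_mixedIso f σ σ') _ _
    fun u => ?_
  rw [factorCovector_apply, factorCovector_apply]
  simp only [Pi.zero_apply, Pi.one_apply, zero_mul, one_mul, zero_add]
  change (∑ w, u.2.1 (realPlaceEquiv f w)) +
    ∑ w, (conjIso f σ σ' w (u.2.2 (complexPlaceEquiv f w))).re = _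
  simp only [conjIso_re]
  rw [(realPlaceEquiv f).sum_comp u.2.1, (complexPlaceEquiv f).sum_comp fun w => (u.2.2 w).re]

end Isomorphisms

/-! ### Orientation and the Liouville pair at a real place -/

section LiouvillePair

variable {K : Type u} [Field K] [NumberField K]

/-- Scaling of the fibres, as a linear isomorphism. -/
def scaleEquiv (t : mixedSpace K) : SolvModel K ≃ₗ[ℝ] SolvModel K :=
  LinearEquiv.ofLinearMap (scaleMap t) (scaleMap (-t))
    (by
      have h := congrArg ContinuousLinearMap.toLinearMap (scaleMap_comp_neg t)
      exact h)
    (by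
      have h := congrArg ContinuousLinearMap.toLinearMap (scaleMap_neg_comp t)
      exact h)

/-- The map is the square of the one at t/2. Hence all transports between left-invariant frames
preserve orientation. -/
theorem det_scaleMap_pos (t : mixedSpace K) :
    0 < LinearMap.det (scaleMap t : SolvModel K →ₗ[ℝ] SolvModel K) := by
  have h1 : (scaleMap t : SolvModel K →ₗ[ℝ] SolvModel K) =
      (scaleMap ((1 / 2 : ℝ) • t) : SolvModel K →ₗ[ℝ] SolvModel K).comp
        (scaleMap ((1 / 2 : ℝ) • t) : SolvModel K →ₗ[ℝ] SolvModel K) := by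
    have h := scaleMap_add ((1 / 2 : ℝ) • t) ((1 / 2 : ℝ) • t)
    rw [← add_smul] at h
    norm_num at h
    simpa using congrArg ContinuousLinearMap.toLinearMap h
  rw [h1, LinearMap.det_comp]
  have h2 : LinearMap.det (scaleMap ((1 / 2 : ℝ) • t) : SolvModel K →ₗ[ℝ] SolvModel K) ≠ 0 :=
    (LinearEquiv.isUnit_det' (scaleEquiv ((1 / 2 : ℝ) • t))).ne_zero
  exact mul_self_pos.2 h2

theorem orientation_map_scaleEquiv {d : ℕ} (b : Basis (Fin d) ℝ (SolvModel K)) (t : mixedSpace K) :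
    (b.map (scaleEquiv t)).orientation = b.orientation := by
  refine ((b.orientation_eq_iff_det_pos _).2 ?_).symm
  have h : ⇑(b.map (scaleEquiv t)) = (scaleMap t : SolvModel K →ₗ[ℝ] SolvModel K) ∘ b :=
    funext fun i => b.map_apply _ i
  rw [h, Basis.det_comp, b.det_self, mul_one]
  exact det_scaleMap_pos t

variable (σ : EmbeddingChoice K)

/-- The orientation of the quotient that is constant in left-invariant frames. -/
def constOrientation {d : ℕ} (o : Orientation ℝ (SolvModel K) (Fin d)) :
    ManifoldOrientation 𝓘(ℝ, SolvModel K) (NFManifold K σ) d where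
  orient _ := o
  continuous_orient x := by
    have key (b : Basis (Fin d) ℝ (SolvModel K)) (hb : b.orientation = o) :
        ∀ᶠ y in 𝓝 x, ∃ b' : Basis (Fin d) ℝ (SolvModel K), b'.orientation = o ∧
          ∀ i, b' i = (mfderiv 𝓘(ℝ, SolvModel K) 𝓘(ℝ, SolvModel K)
            (extChartAt 𝓘(ℝ, SolvModel K) x).symm (extChartAt 𝓘(ℝ, SolvModel K) x y) :
              SolvModel K →L[ℝ] SolvModel K)
            ((mfderiv 𝓘(ℝ, SolvModel K) 𝓘(ℝ, SolvModel K) (extChartAt 𝓘(ℝ, SolvModel K) x) x :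
              SolvModel K →L[ℝ] SolvModel K) (b i)) := by
      refine Filter.Eventually.of_forall fun y => ?_
      rw [(hasMFDerivAt_extChartAt_self x).mfderiv, extChartAt_symm]
      obtain ⟨γ, -, -, h⟩ := exists_hasMFDerivAt_proj σ (extChartAt 𝓘(ℝ, SolvModel K) x y)
      rw [h.mfderiv]
      exact ⟨b.map (scaleEquiv γ.1.1), (orientation_map_scaleEquiv b _).trans hb,
        fun i => b.map_apply _ i⟩
    exact key

/-- Reverses the orientation of b when m is odd, in order to absorb the factor (-1)^m common to all
volumes below. -/
theorem exists_orientation_det_pos {m : ℕ} (b : Basis (Fin (2 * m + 1)) ℝ (SolvModel K)) :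
    ∃ o : Orientation ℝ (SolvModel K) (Fin (2 * m + 1)),
      ∀ b' : Basis (Fin (2 * m + 1)) ℝ (SolvModel K), b'.orientation = o →
        0 < (-1) ^ m * b.det b' := by
  obtain h | h := m.even_or_odd
  · refine ⟨b.orientation, fun b' hb' => ?_⟩
    rw [h.neg_one_pow, one_mul]
    exact (b.orientation_eq_iff_det_pos b').1 hb'.symm
  · refine ⟨-b.orientation, fun b' hb' => ?_⟩
    rw [h.neg_one_pow, neg_one_mul, neg_pos]
    refine lt_of_le_of_ne (not_lt.1 fun h1 => ?_) (b.isUnit_det b').ne_zero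
    rw [← b.orientation_eq_iff_det_pos, hb'] at h1
    exact Module.Ray.ne_neg_self _ h1

variable (w₀ : {w : InfinitePlace K // IsReal w})

theorem pairCovector_eq {m : ℕ} {g : Fin m → index K}
    (hsum : ∀ F : index K → ℝ, ∑ k, F k = F (Sum.inl w₀) + ∑ i, F (g i)) (ε : ℝ) (u : SolvModel K) :
    pairCovector w₀ ε u = ε * fiberCoord (Sum.inl w₀) u +
      ∑ i, contactCoeff (g i) * signCoeff (g i) * fiberCoord (g i) u := by
  rw [pairCovector_apply, factorCovector_standard_apply, hsum]
  simp only [contactCoeff, signCoeff]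
  ring

theorem bracketForm_pairCovector_eq {m : ℕ} {g : Fin m → index K}
    (hsum : ∀ F : index K → ℝ, ∑ k, F k = F (Sum.inl w₀) + ∑ i, F (g i)) (ε : ℝ)
    (u v : SolvModel K) :
    bracketForm (pairCovector w₀ ε) u v =
      ε * (baseCoord (Sum.inl w₀) u * fiberCoord (Sum.inl w₀) v -
        fiberCoord (Sum.inl w₀) u * baseCoord (Sum.inl w₀) v) +
      ∑ i, (baseCoord (g i) u * fiberCoord (g i) v - fiberCoord (g i) u * baseCoord (g i) v) := by
  rw [bracketForm_pairCovector, bracketForm_standard_apply, hsum]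
  ring

/-- The exterior derivative of the form of the Liouville pair, in a left-invariant frame. -/
def pairTwoForm (s : ℝ) (u v : ℝ × SolvModel K) : ℝ :=
  u.1 * (Real.exp s * pairCovector w₀ 1 v.2 - Real.exp (-s) * pairCovector w₀ (-1) v.2) -
    v.1 * (Real.exp s * pairCovector w₀ 1 u.2 - Real.exp (-s) * pairCovector w₀ (-1) u.2) -
    (Real.exp s * bracketForm (pairCovector w₀ 1) u.2 v.2 +
      Real.exp (-s) * bracketForm (pairCovector w₀ (-1)) u.2 v.2)

/-- The two covectors differ only in the sign at w₀, so e^s and e^{-s} combine to 2 sinh s on that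
fibre coordinate and to 2 cosh s on the others; differentiation in s exchanges the two factors. -/
theorem pairTwoForm_eq {m : ℕ} {g : Fin m → index K}
    (hsum : ∀ F : index K → ℝ, ∑ k, F k = F (Sum.inl w₀) + ∑ i, F (g i)) (s : ℝ)
    (u v : ℝ × SolvModel K) :
    pairTwoForm w₀ s u v =
      (2 * Real.cosh s * u.1 - 2 * Real.sinh s * baseCoord (Sum.inl w₀) u.2) *
          fiberCoord (Sum.inl w₀) v.2 -
        fiberCoord (Sum.inl w₀) u.2 *
          (2 * Real.cosh s * v.1 - 2 * Real.sinh s * baseCoord (Sum.inl w₀) v.2) +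
      ∑ i, ((2 * Real.sinh s * (contactCoeff (g i) * signCoeff (g i)) * u.1 -
          2 * Real.cosh s * baseCoord (g i) u.2) * fiberCoord (g i) v.2 -
        fiberCoord (g i) u.2 * (2 * Real.sinh s * (contactCoeff (g i) * signCoeff (g i)) * v.1 -
          2 * Real.cosh s * baseCoord (g i) v.2)) := by
  have h1 (a b : ℝ) (u v : SolvModel K) :
      ∑ i, ((2 * Real.sinh s * (contactCoeff (g i) * signCoeff (g i)) * a -
          2 * Real.cosh s * baseCoord (g i) u) * fiberCoord (g i) v -
        fiberCoord (g i) u * (2 * Real.sinh s * (contactCoeff (g i) * signCoeff (g i)) * b -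
          2 * Real.cosh s * baseCoord (g i) v)) =
      2 * Real.sinh s * a * ∑ i, contactCoeff (g i) * signCoeff (g i) * fiberCoord (g i) v -
        2 * Real.sinh s * b * ∑ i, contactCoeff (g i) * signCoeff (g i) * fiberCoord (g i) u -
        2 * Real.cosh s *
          ∑ i, (baseCoord (g i) u * fiberCoord (g i) v - fiberCoord (g i) u * baseCoord (g i) v) := by
    rw [Finset.mul_sum, Finset.mul_sum, Finset.mul_sum, ← Finset.sum_sub_distrib,
      ← Finset.sum_sub_distrib]
    exact Finset.sum_congr rfl fun i _ => by ring
  rw [h1, pairTwoForm, pairCovector_eq w₀ hsum, pairCovector_eq w₀ hsum, pairCovector_eq w₀ hsum,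
    pairCovector_eq w₀ hsum, bracketForm_pairCovector_eq w₀ hsum,
    bracketForm_pairCovector_eq w₀ hsum, Real.cosh_eq, Real.sinh_eq]
  ring

theorem d_pairForm (x : ℝ × NFManifold K σ) (u v : ℝ × SolvModel K) :
    (liouvillePairForm (inducedForm σ (pairCovector w₀ 1))
      (inducedForm σ (pairCovector w₀ (-1)))).d x u v =
      pairTwoForm w₀ x.1 (u.1, scaleMap (-(chartCenter σ x.2).1.1) u.2)
        (v.1, scaleMap (-(chartCenter σ x.2).1.1) v.2) :=
  d_liouvillePairForm σ _ _ x u v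

/-- The covector and its derivative are the standard ones with φ₀ replaced by εφ₀, so the
determinant acquires the factor ε. -/
theorem wedgeOneTwoPow_pairCovector {m : ℕ} (hm : finrank ℚ K = m + 1) {g : Fin m → index K}
    (hsum : ∀ F : index K → ℝ, ∑ k, F k = F (Sum.inl w₀) + ∑ i, F (g i)) (ε : ℝ)
    (v : Fin (2 * m + 1) → SolvModel K) :
    wedgeOneTwoPow m (pairCovector w₀ ε) (fun u v => -bracketForm (pairCovector w₀ ε) u v) v =
      ε * (m.factorial * (m + 1) * ((-1) ^ m * oddDet (fiberCoord (Sum.inl w₀))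
        (fun i => baseCoord (g i)) (fun i => fiberCoord (g i)) v)) := by
  have hk₀ : traceCoeff (K := K) (Sum.inl w₀) = 1 := rfl
  rw [wedgeOneTwoPow_of_relation _ (baseCoord (Sum.inl w₀))
    (fun u => ε * fiberCoord (Sum.inl w₀) u) _ (fun i => baseCoord (g i))
    (fun i => fiberCoord (g i)) (contactCoeff (K := K) (Sum.inl w₀) * signCoeff (Sum.inl w₀))
    (fun i => traceCoeff (g i) / traceCoeff (Sum.inl w₀))
    (fun i => contactCoeff (g i) * signCoeff (g i))
    (relation_of_enumeration (hk₀ ▸ one_ne_zero) hsum),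
    sum_div_traceCoeff (hk₀ ▸ one_ne_zero) hm hsum, oddDet_smul_left, hk₀]
  · ring
  · intro u
    rw [pairCovector_eq w₀ hsum]
    simp [contactCoeff, signCoeff]
  · intro u v
    rw [bracketForm_pairCovector_eq w₀ hsum]
    ring

/-- Here ∑ c_k e_k = m, because w₀ accounts for 1 of the total n = m + 1. The factor 2 cosh s + m (2
sinh s)² / (2 cosh s) is positive for every s. -/
theorem wedgeTwoPow_pairTwoForm {m : ℕ} (hm : finrank ℚ K = m + 1) {g : Fin m → index K}
    (hsum : ∀ F : index K → ℝ, ∑ k, F k = F (Sum.inl w₀) + ∑ i, F (g i)) (s : ℝ)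
    (v : Fin (2 * m + 1) → SolvModel K) (w : Fin (2 * (m + 1)) → ℝ × SolvModel K)
    (hw₀ : w 0 = (1, 0)) (hw : ∀ i : Fin (2 * m + 1), w i.succ = (0, v i)) :
    wedgeTwoPow (m + 1) (pairTwoForm w₀ s) w = (m + 1).factorial *
      ((2 * Real.cosh s + 2 * Real.sinh s * (2 * Real.sinh s) / (2 * Real.cosh s) * m) *
        (2 * Real.cosh s) ^ m * ((-1) ^ m * oddDet (fiberCoord (Sum.inl w₀))
          (fun i => baseCoord (g i)) (fun i => fiberCoord (g i)) v)) := by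
  have hk₀ : traceCoeff (K := K) (Sum.inl w₀) = 1 := rfl
  have h := sum_div_traceCoeff (hk₀ ▸ one_ne_zero) hm hsum
  have h1 : contactCoeff (K := K) (Sum.inl w₀) * signCoeff (Sum.inl w₀) = 1 := mul_one 1
  rw [h1, hk₀, div_one, add_comm (m : ℝ), add_right_inj] at h
  rw [wedgeTwoPow_of_relation (baseCoord (Sum.inl w₀)) (fiberCoord (Sum.inl w₀))
    (pairTwoForm w₀ s) (fun i => baseCoord (g i)) (fun i => fiberCoord (g i)) (2 * Real.sinh s)
    (2 * Real.cosh s) (2 * Real.cosh s) (2 * Real.sinh s)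
    (fun i => traceCoeff (g i) / traceCoeff (Sum.inl w₀))
    (fun i => contactCoeff (g i) * signCoeff (g i)) (by have := Real.cosh_pos s; positivity)
    (relation_of_enumeration (hk₀ ▸ one_ne_zero) hsum) (pairTwoForm_eq w₀ hsum s) v w hw₀ hw, hk₀, h]

/-- The three volumes are multiples of the same (-1)^m times a determinant, with coefficients
positive, negative and positive respectively; the orientation is the one making this determinant
term positive. -/
theorem exists_isLiouvillePair {m : ℕ} (hm : finrank ℚ K = m + 1) :
    ∃ o : ManifoldOrientation 𝓘(ℝ, SolvModel K) (NFManifold K σ) (2 * m + 1),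
      IsLiouvillePair m o (inducedForm σ (pairCovector w₀ 1))
        (inducedForm σ (pairCovector w₀ (-1))) := by
  have hk₀ : traceCoeff (K := K) (Sum.inl w₀) ≠ 0 := one_ne_zero
  obtain ⟨g, -, hg, hsum⟩ := exists_enumeration (Sum.inl w₀) hm
  obtain ⟨b₀, hb₀⟩ := exists_basis_det _ hk₀ hm g hg hsum
  obtain ⟨o, ho⟩ := exists_orientation_det_pos b₀
  have hcontact (ε : ℝ) (hε : ε ≠ 0) : IsContactForm m (inducedForm σ (pairCovector w₀ ε)) := by
    refine isContactForm_inducedForm σ hm _ ⟨b₀, ?_⟩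
    rw [wedgeOneTwoPow_pairCovector w₀ hm hsum, hb₀, b₀.det_self, mul_one]
    have h1 : ((m.factorial : ℝ) * (m + 1)) ≠ 0 := by positivity
    exact mul_ne_zero hε (mul_ne_zero h1 (by simp))
  have hpos (x : NFManifold K σ) (b : Basis (Fin (2 * m + 1)) ℝ (SolvModel K))
      (hb : b.orientation = o) :
      0 < (-1) ^ m * oddDet (fiberCoord (Sum.inl w₀)) (fun i => baseCoord (g i))
        (fun i => fiberCoord (g i)) (fun i => scaleMap (-(chartCenter σ x).1.1) (b i)) := by
    rw [hb₀]
    refine ho (b.map (scaleEquiv (-(chartCenter σ x).1.1))) ?_ |>.trans_eq ?_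
    · rw [orientation_map_scaleEquiv, hb]
    · congr 2
  refine ⟨constOrientation σ o, hcontact 1 one_ne_zero, hcontact (-1) (by norm_num), ?_⟩
  have key (x : NFManifold K σ) (b : Basis (Fin (2 * m + 1)) ℝ (SolvModel K))
      (hb : b.orientation = o) :
      0 < (inducedForm σ (pairCovector w₀ 1)).contactVolume m x b ∧
      0 < -(inducedForm σ (pairCovector w₀ (-1))).contactVolume m x b ∧
      ∀ s : ℝ, 0 < wedgeTwoPow (m + 1) ((liouvillePairForm (inducedForm σ (pairCovector w₀ 1))
        (inducedForm σ (pairCovector w₀ (-1)))).d (s, x)) (cylinderFrame m s x b) := by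
    have h := hpos x b hb
    refine ⟨?_, ?_, fun s => ?_⟩
    · have h1 := contactVolume_inducedForm σ m (pairCovector w₀ 1) x b
      rw [wedgeOneTwoPow_pairCovector w₀ hm hsum] at h1
      rw [h1]
      positivity
    · have h1 := contactVolume_inducedForm σ m (pairCovector w₀ (-1)) x b
      rw [wedgeOneTwoPow_pairCovector w₀ hm hsum] at h1
      rw [h1, neg_mul, neg_neg]
      positivity
    · have h1 : wedgeTwoPow (m + 1) ((liouvillePairForm (inducedForm σ (pairCovector w₀ 1))
          (inducedForm σ (pairCovector w₀ (-1)))).d (s, x)) (cylinderFrame m s x b) =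
          wedgeTwoPow (m + 1) (pairTwoForm w₀ s)
            (Fin.cons (n := 2 * m + 1) (α := fun _ => ℝ × SolvModel K) (1, 0)
              fun i => (0, scaleMap (-(chartCenter σ x).1.1) (b i))) := by
        let F : Fin (2 * (m + 1)) → ℝ × SolvModel K :=
          cylinderFrame (I := 𝓘(ℝ, SolvModel K)) m s x b
        have h2 (i : Fin (2 * (m + 1))) : Fin.cons (n := 2 * m + 1)
            (α := fun _ => ℝ × SolvModel K) (1, 0)
              (fun i => (0, scaleMap (-(chartCenter σ x).1.1) (b i))) i =
            ((F i).1, scaleMap (-(chartCenter σ x).1.1) (F i).2) := by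
          refine Fin.cases (n := 2 * m + 1) ?_ (fun i => ?_) i
          · exact Prod.ext rfl (map_zero _).symm
          · rfl
        unfold wedgeTwoPow
        congr 1
        refine Finset.sum_congr rfl fun τ _ => ?_
        congr 1
        refine Finset.prod_congr rfl fun i _ => ?_
        rw [h2, h2]
        exact d_pairForm σ w₀ (s, x) _ _
      rw [h1, wedgeTwoPow_pairTwoForm w₀ hm hsum s
        (fun i => scaleMap (-(chartCenter σ x).1.1) (b i)) _ rfl fun i => rfl]
      have hc := Real.cosh_pos s
      have h3 : 0 ≤ 2 * Real.sinh s * (2 * Real.sinh s) / (2 * Real.cosh s) * m := by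
        have := mul_self_nonneg (2 * Real.sinh s)
        positivity
      have h4 : 0 < 2 * Real.cosh s + 2 * Real.sinh s * (2 * Real.sinh s) / (2 * Real.cosh s) * m := by
        positivity
      positivity
  exact key

end LiouvillePair

/-! ### The radial part of the Liouville flow -/

section LiouvilleFlow

/-- A first integral of the radial component of the Liouville vector field. -/
def radialIntegral (m : ℕ) (s : ℝ) : ℝ := Real.sinh s * Real.cosh s ^ m

/-- The radial component of the Liouville vector field. -/
def radialSpeed (m : ℕ) (s : ℝ) : ℝ :=
  (m + 1) * (Real.sinh s * Real.cosh s) / (Real.cosh s ^ 2 + m * Real.sinh s ^ 2)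

theorem radialDenom_pos (m : ℕ) (s : ℝ) : 0 < Real.cosh s ^ 2 + m * Real.sinh s ^ 2 := by
  have := Real.cosh_pos s
  positivity

theorem exists_hasDerivAt_radialIntegral (m : ℕ) (s : ℝ) :
    ∃ d, HasDerivAt (radialIntegral m) d s ∧ 0 < d ∧
      radialSpeed m s * d = (m + 1) * radialIntegral m s := by
  have hc := Real.cosh_pos s
  have hd := radialDenom_pos m s
  refine ⟨_, (Real.hasDerivAt_sinh s).mul ((Real.hasDerivAt_cosh s).pow m), ?_⟩
  -- The extra factor cosh s makes up for the exponent m - 1, which is truncated at m = 0, where its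
  -- coefficient vanishes.
  have h : Real.cosh s * (Real.cosh s * Real.cosh s ^ m +
      Real.sinh s * (m * Real.cosh s ^ (m - 1) * Real.sinh s)) =
      Real.cosh s ^ m * (Real.cosh s ^ 2 + m * Real.sinh s ^ 2) := by
    obtain _ | m := m
    · simp
      ring
    · simp only [Nat.add_sub_cancel, pow_succ]
      ring
  constructor
  · have h1 : 0 < Real.cosh s ^ m * (Real.cosh s ^ 2 + m * Real.sinh s ^ 2) := by positivity
    rw [← h] at h1
    exact pos_of_mul_pos_right h1 hc.le
  · unfold radialSpeed radialIntegral
    rw [div_mul_eq_mul_div, div_eq_iff hd.ne']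
    linear_combination ((m : ℝ) + 1) * Real.sinh s * h

theorem continuous_radialIntegral (m : ℕ) : Continuous (radialIntegral m) :=
  Real.continuous_sinh.mul (Real.continuous_cosh.pow m)

theorem strictMono_radialIntegral (m : ℕ) : StrictMono (radialIntegral m) := by
  refine strictMono_of_deriv_pos fun s => ?_
  obtain ⟨d, h1, h2, -⟩ := exists_hasDerivAt_radialIntegral m s
  rwa [h1.deriv]

/-- As cosh ≥ 1, the function is at least sinh in absolute value, and sinh is already onto. -/
theorem surjective_radialIntegral (m : ℕ) : Function.Surjective (radialIntegral m) := by
  intro x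
  refine mem_range_of_exists_le_of_exists_ge (continuous_radialIntegral m) ?_ ?_
  · refine ⟨Real.arsinh (-|x|), ?_⟩
    rw [radialIntegral, Real.sinh_arsinh]
    have := one_le_pow₀ (n := m) (Real.one_le_cosh (Real.arsinh (-|x|)))
    nlinarith [abs_nonneg x, neg_abs_le x]
  · refine ⟨Real.arsinh |x|, ?_⟩
    rw [radialIntegral, Real.sinh_arsinh]
    have := one_le_pow₀ (n := m) (Real.one_le_cosh (Real.arsinh |x|))
    nlinarith [abs_nonneg x, le_abs_self x]

/-- In the coordinate F = sinh s cosh^m s the equation is linear, F' = (m + 1) F. Since F is a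
bijection of ℝ, the solution F⁻¹(F(s₀) e^{(m+1)u}) exists for all time. -/
theorem exists_radialFlow (m : ℕ) (s₀ : ℝ) :
    ∃ S : ℝ → ℝ, S 0 = s₀ ∧ ∀ u, HasDerivAt S (radialSpeed m (S u)) u := by
  let e : ℝ ≃o ℝ := (strictMono_radialIntegral m).orderIsoOfSurjective _
    (surjective_radialIntegral m)
  have he (x : ℝ) : radialIntegral m (e.symm x) = x := e.apply_symm_apply x
  refine ⟨fun u => e.symm (radialIntegral m s₀ * Real.exp ((m + 1) * u)), ?_, fun u => ?_⟩
  · simp only [mul_zero, Real.exp_zero, mul_one]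
    exact e.symm_apply_apply s₀
  · obtain ⟨d, h1, h2, h3⟩ := exists_hasDerivAt_radialIntegral m
      (e.symm (radialIntegral m s₀ * Real.exp ((m + 1) * u)))
    have h4 : HasDerivAt (fun u : ℝ => radialIntegral m s₀ * Real.exp ((m + 1) * u))
        (radialIntegral m s₀ * (Real.exp ((m + 1) * u) * ((m + 1) * 1))) u :=
      (((hasDerivAt_id u).const_mul ((m : ℝ) + 1)).exp).const_mul _
    have h5 : ContinuousAt (fun u : ℝ =>
        e.symm (radialIntegral m s₀ * Real.exp ((m + 1) * u))) u :=
      e.symm.continuous.continuousAt.comp h4.continuousAt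
    have h6 := HasDerivAt.of_comp_left h5 h1 h4 h2.ne' (Filter.Eventually.of_forall fun u => he _)
    refine h6.congr_deriv ?_
    rw [div_eq_iff h2.ne', h3, he]
    ring

end LiouvilleFlow

/-! ### Nondegeneracy, the Liouville field and convexity at infinity -/

section LiouvilleManifold

variable {K : Type u} [Field K]

theorem exists_forall_realCoord (c : index K → ℝ) : ∃ x : mixedSpace K, ∀ k, realCoord k x = c k := by
  refine ⟨(fun w => c (Sum.inl w), fun w => ⟨c (Sum.inr (w, 0)), c (Sum.inr (w, 1))⟩), ?_⟩
  rintro (w | ⟨w, i⟩)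
  · rfl
  · fin_cases i <;> rfl

theorem signCoeff_mul_self (k : index K) : signCoeff k * signCoeff k = 1 := by
  obtain w | ⟨w, i⟩ := k
  · simp [signCoeff]
  · simp only [signCoeff]; split_ifs <;> norm_num

variable [NumberField K]

theorem exists_forall_realCoord_hyperplane (c : index K → ℝ) (hc : ∑ k, traceCoeff k * c k = 0) :
    ∃ x : hyperplane K, ∀ k, realCoord k x.1 = c k := by
  obtain ⟨x, hx⟩ := exists_forall_realCoord c
  refine ⟨⟨x, ?_⟩, hx⟩
  rw [LinearMap.mem_ker, ← hc]
  simp only [← hx]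
  rw [sum_index]
  simp [traceCoeff, traceForm, Finset.mul_sum]

theorem exists_forall_fiberCoord (c : index K → ℝ) :
    ∃ z : mixedSpace K, ∀ (k : index K) (t : hyperplane K), fiberCoord k (t, z) = c k := by
  obtain ⟨z, hz⟩ := exists_forall_realCoord fun k => signCoeff k * c k
  refine ⟨z, fun k t => ?_⟩
  rw [fiberCoord, hz, ← mul_assoc, signCoeff_mul_self, one_mul]

theorem eq_zero_of_coord {u : SolvModel K} (h1 : ∀ k, baseCoord k u = 0)
    (h2 : ∀ k, fiberCoord k u = 0) : u = 0 := by
  refine Prod.ext (Subtype.ext (eq_zero_of_realCoord h1)) (eq_zero_of_realCoord fun k => ?_)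
  have h3 : realCoord k u.2 = signCoeff k * fiberCoord k u := by
    rw [fiberCoord, ← mul_assoc, signCoeff_mul_self, one_mul]
  rw [h3, h2, mul_zero]

variable (w₀ : {w : InfinitePlace K // IsReal w})

/-- The form pairs the fibre directions with the span of ∂_s and the base directions. Testing
against one of these spaces shows that the component of u in the other vanishes. -/
theorem pairTwoForm_nondegenerate (s : ℝ) (u : ℝ × SolvModel K)
    (hu : ∀ v, pairTwoForm w₀ s u v = 0) : u = 0 := by
  obtain ⟨m, hm⟩ := exists_finrank_eq_add_one (K := K)
  have hk₀ : traceCoeff (K := K) (Sum.inl w₀) = 1 := rfl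
  have hk₀' : traceCoeff (K := K) (Sum.inl w₀) ≠ 0 := one_ne_zero
  obtain ⟨g, hg₀, hg, hsum⟩ := exists_enumeration (Sum.inl w₀) hm
  have hrel := relation_of_enumeration hk₀' hsum
  have hce := sum_div_traceCoeff hk₀' hm hsum
  have h1 : contactCoeff (K := K) (Sum.inl w₀) * signCoeff (Sum.inl w₀) = 1 := mul_one 1
  rw [h1, hk₀, div_one, add_comm (m : ℝ), add_right_inj] at hce
  simp only [hk₀, div_one] at hrel hce
  have hc := Real.cosh_pos s
  have hden := radialDenom_pos m s
  set C := Real.cosh s with hC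
  set D := Real.sinh s with hD
  -- the horizontal components, paired with the vertical ones
  have hη := pairTwoForm_eq w₀ hsum s u
  simp only [← hC, ← hD] at hη
  have hμ (φ : index K → ℝ) :
      (2 * C * u.1 - 2 * D * baseCoord (Sum.inl w₀) u.2) * φ (Sum.inl w₀) +
      ∑ i, (2 * D * (contactCoeff (g i) * signCoeff (g i)) * u.1 -
        2 * C * baseCoord (g i) u.2) * φ (g i) = 0 := by
    obtain ⟨z, hz⟩ := exists_forall_fiberCoord φ
    have h2 := hη (0, (0, z))
    rw [hu] at h2
    have h3 (k : index K) : baseCoord k ((0, z) : SolvModel K) = 0 := map_zero (realCoord k)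
    simp only [hz, h3, mul_zero, sub_zero] at h2
    exact h2.symm
  have hμ₀ : C * u.1 = D * baseCoord (Sum.inl w₀) u.2 := by
    have h2 := hμ fun k => if k = Sum.inl w₀ then 1 else 0
    simp only [hg₀, if_true, if_false, mul_zero, Finset.sum_const_zero] at h2
    linarith
  have hμ₁ (i) : C * baseCoord (g i) u.2 = D * (contactCoeff (g i) * signCoeff (g i)) * u.1 := by
    -- The test value at g i is the coefficient itself, so every term is a square or zero;
    -- repetitions in the enumeration would do no harm.
    have h2 := hμ fun k => if k = g i then
      (2 * D * (contactCoeff (g i) * signCoeff (g i)) * u.1 - 2 * C * baseCoord (g i) u.2) else 0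
    rw [if_neg (hg₀ i).symm, mul_zero, zero_add] at h2
    have h3 := (Finset.sum_eq_zero_iff_of_nonneg fun j _ => ?_).1 h2 i (Finset.mem_univ i)
    · simp only [if_true] at h3
      have := mul_self_eq_zero.1 h3
      linarith
    · split_ifs with h
      · rw [h]
        exact mul_self_nonneg _
      · rw [mul_zero]
  have hu1 : u.1 = 0 := by
    have h2 : C * baseCoord (Sum.inl w₀) u.2 = -(D * m * u.1) := by
      rw [hrel, mul_neg, Finset.mul_sum, ← hce, Finset.mul_sum, Finset.sum_mul]
      congr 1
      exact Finset.sum_congr rfl fun i _ => by rw [mul_left_comm, hμ₁]; ring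
    have h3 : (C ^ 2 + m * D ^ 2) * u.1 = 0 := by linear_combination C * hμ₀ + D * h2
    exact (mul_eq_zero.1 h3).resolve_left hden.ne'
  have ht (k) : baseCoord k u.2 = 0 := by
    have h2 (i) : baseCoord (g i) u.2 = 0 := by
      have := hμ₁ i
      rw [hu1, mul_zero] at this
      exact (mul_eq_zero.1 this).resolve_left hc.ne'
    by_cases hk : k = Sum.inl w₀
    · rw [hk, hrel]
      simp [h2]
    · obtain ⟨i, rfl⟩ := hg k hk
      exact h2 i
  -- the vertical components, paired with the horizontal ones
  let φ : index K → ℝ := fun k => fiberCoord k u.2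
  let B : ℝ := ∑ i, traceCoeff (g i) * φ (g i)
  -- With e_i = contactCoeff · signCoeff, the pair r, τ solves 2Cr - 2Dτ(w₀) = -φ(w₀) and 2D e_i r -
  -- 2Cτ(g i) = -φ(g i) within the trace relation. Pairing u with this vector yields ∑ φ_k².
  let r : ℝ := -((C * φ (Sum.inl w₀) + D * B) / (2 * (C ^ 2 + m * D ^ 2)))
  let τ : index K → ℝ := fun k =>
    if k = Sum.inl w₀ then -∑ i, traceCoeff (g i) *
      ((φ (g i) / 2 + D * (contactCoeff (g i) * signCoeff (g i)) * r) / C)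
    else (φ k / 2 + D * (contactCoeff k * signCoeff k) * r) / C
  have hτ₁ (i) : τ (g i) = (φ (g i) / 2 + D * (contactCoeff (g i) * signCoeff (g i)) * r) / C :=
    if_neg (hg₀ i)
  have hτ₀ : C * τ (Sum.inl w₀) = -(B / 2 + D * m * r) := by
    simp only [τ, if_true]
    rw [mul_neg, Finset.mul_sum, ← hce, Finset.sum_div, Finset.mul_sum, Finset.sum_mul,
      ← Finset.sum_add_distrib]
    congr 1
    refine Finset.sum_congr rfl fun i _ => ?_
    field_simp
  obtain ⟨t, ht'⟩ := exists_forall_realCoord_hyperplane τ (by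
    rw [hsum, hk₀, one_mul]
    simp only [hτ₁]
    simp only [τ, if_true]
    exact neg_add_cancel _)
  have h2 := hη (r, (t, 0))
  rw [hu] at h2
  have h3 (k : index K) : fiberCoord k ((t, 0) : SolvModel K) = 0 := by
    change signCoeff k * realCoord k 0 = 0
    rw [map_zero, mul_zero]
  have h4 (k : index K) : baseCoord k ((t, 0) : SolvModel K) = τ k := ht' k
  have h5 (i) : 2 * D * (contactCoeff (g i) * signCoeff (g i)) * r - 2 * C * τ (g i) =
      -φ (g i) := by
    rw [hτ₁]
    field_simp
    ring
  have h6 : 2 * C * r - 2 * D * τ (Sum.inl w₀) = -φ (Sum.inl w₀) := by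
    have h7 : C * (2 * C * r - 2 * D * τ (Sum.inl w₀)) = C * -φ (Sum.inl w₀) := by
      have h8 : 2 * (C ^ 2 + m * D ^ 2) * r = -(C * φ (Sum.inl w₀) + D * B) := by
        simp only [r]
        field_simp
      linear_combination h8 - 2 * D * hτ₀
    exact mul_left_cancel₀ hc.ne' h7
  simp only [h3, h4, h5, h6, mul_zero, zero_sub, mul_neg, neg_neg] at h2
  have h7 : ∑ k, φ k * φ k = 0 := by
    rw [hsum]
    exact h2.symm
  have h8 := (Finset.sum_eq_zero_iff_of_nonneg fun k _ => mul_self_nonneg (φ k)).1 h7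
  exact Prod.ext hu1 (eq_zero_of_coord ht fun k => mul_self_eq_zero.1 (h8 k (Finset.mem_univ k)))

/-- The direction in which the Liouville vector field moves the base point. -/
theorem exists_liouvilleDirection {m : ℕ} (hm : finrank ℚ K = m + 1) :
    ∃ E : hyperplane K, realCoord (Sum.inl w₀) E.1 = -m ∧
      ∀ k, k ≠ Sum.inl w₀ → realCoord k E.1 = contactCoeff k * signCoeff k := by
  have hk₀ : traceCoeff (K := K) (Sum.inl w₀) ≠ 0 := one_ne_zero
  obtain ⟨g, hg₀, hg, hsum⟩ := exists_enumeration (Sum.inl w₀) hm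
  have hce := sum_div_traceCoeff hk₀ hm hsum
  have h1 : contactCoeff (K := K) (Sum.inl w₀) * signCoeff (Sum.inl w₀) = 1 := mul_one 1
  have h2 : traceCoeff (K := K) (Sum.inl w₀) = 1 := rfl
  rw [h1, h2, div_one, add_comm (m : ℝ), add_right_inj] at hce
  simp only [div_one] at hce
  obtain ⟨E, hE⟩ := exists_forall_realCoord_hyperplane
    (fun k => if k = Sum.inl w₀ then -(m : ℝ) else contactCoeff k * signCoeff k) (by
      rw [hsum, h2]
      simp only [hg₀, if_true, if_false, hce, one_mul, neg_add_cancel])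
  exact ⟨E, (hE _).trans (if_pos rfl), fun k hk => (hE k).trans (if_neg hk)⟩

/-- For a field ρ∂_s + rE, the components on φ_k away from w₀ force r = ρ tanh s - 1, and the
component at w₀ then forces ρ (cosh² s + m sinh² s) = (m + 1) sinh s cosh s. -/
theorem pairTwoForm_liouvilleDirection {m : ℕ} (hm : finrank ℚ K = m + 1) {E : hyperplane K}
    (hE₀ : realCoord (Sum.inl w₀) E.1 = -m)
    (hE : ∀ k, k ≠ Sum.inl w₀ → realCoord k E.1 = contactCoeff k * signCoeff k) (s : ℝ)
    (v : ℝ × SolvModel K) :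
    pairTwoForm w₀ s
      (radialSpeed m s, ((Real.sinh s / Real.cosh s * radialSpeed m s - 1) • E, 0)) v =
      Real.exp (-s) * pairCovector w₀ (-1) v.2 + Real.exp s * pairCovector w₀ 1 v.2 := by
  obtain ⟨g, hg₀, hg, hsum⟩ := exists_enumeration (Sum.inl w₀) hm
  have hc := Real.cosh_pos s
  have hd := radialDenom_pos m s
  have h3 (t : hyperplane K) (k : index K) : fiberCoord k ((t, 0) : SolvModel K) = 0 := by
    change signCoeff k * realCoord k 0 = 0
    rw [map_zero, mul_zero]
  have h4 (r : ℝ) (k : index K) :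
      baseCoord k ((r • E, 0) : SolvModel K) = r * realCoord k E.1 := map_smul (realCoord k) r E.1
  rw [pairTwoForm_eq w₀ hsum, pairCovector_eq w₀ hsum, pairCovector_eq w₀ hsum]
  simp only [h3, h4, hE₀, hE _ (hg₀ _), zero_mul, sub_zero]
  have h5 : 2 * Real.cosh s * radialSpeed m s - 2 * Real.sinh s *
      ((Real.sinh s / Real.cosh s * radialSpeed m s - 1) * -m) = 2 * Real.sinh s := by
    unfold radialSpeed
    field_simp
    ring
  have h6 (e : ℝ) : 2 * Real.sinh s * e * radialSpeed m s - 2 * Real.cosh s *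
      ((Real.sinh s / Real.cosh s * radialSpeed m s - 1) * e) = 2 * Real.cosh s * e := by
    field_simp
    ring
  simp only [h5, h6]
  rw [Real.sinh_eq, Real.cosh_eq]
  simp only [mul_assoc]
  rw [← Finset.mul_sum, ← Finset.mul_sum]
  ring

variable (σ : EmbeddingChoice K)

theorem isLiouvilleForm_pair :
    IsLiouvilleForm (liouvillePairForm (inducedForm σ (pairCovector w₀ 1))
      (inducedForm σ (pairCovector w₀ (-1)))) := by
  refine ⟨smooth_liouvillePairForm σ _ _, ?_⟩
  have key (x : ℝ × NFManifold K σ) (u : ℝ × SolvModel K)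
      (hu : ∀ v : ℝ × SolvModel K, (liouvillePairForm (inducedForm σ (pairCovector w₀ 1))
        (inducedForm σ (pairCovector w₀ (-1)))).d x u v = 0) : u = 0 := by
    have h1 : ((u.1, scaleMap (-(chartCenter σ x.2).1.1) u.2) : ℝ × SolvModel K) = 0 := by
      refine pairTwoForm_nondegenerate w₀ x.1 _ fun v => ?_
      have h2 := hu (v.1, scaleMap (chartCenter σ x.2).1.1 v.2)
      rw [d_pairForm] at h2
      have h3 : scaleMap (-(chartCenter σ x.2).1.1) (scaleMap (chartCenter σ x.2).1.1 v.2) = v.2 :=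
        congrFun (congrArg DFunLike.coe (scaleMap_neg_comp (chartCenter σ x.2).1.1)) v.2
      rwa [h3] at h2
    refine Prod.ext (Prod.ext_iff.1 h1).1 ?_
    have h2 : scaleMap (-(chartCenter σ x.2).1.1) u.2 = 0 := (Prod.ext_iff.1 h1).2
    exact (scaleEquiv (-(chartCenter σ x.2).1.1)).map_eq_zero_iff.1 h2
  exact key

/-- The Liouville vector field. -/
def liouvilleField (m : ℕ) (E : hyperplane K) (x : ℝ × NFManifold K σ) : ℝ × SolvModel K :=
  (radialSpeed m x.1, ((Real.sinh x.1 / Real.cosh x.1 * radialSpeed m x.1 - 1) • E, 0))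

theorem scaleMap_horizontal (t : mixedSpace K) (τ : hyperplane K) :
    scaleMap t ((τ, 0) : SolvModel K) = (τ, 0) :=
  Prod.ext rfl (mul_zero _)

/-- The field does not depend on the point of the quotient, and a base direction is unchanged by
left-translation derivatives. Once S is known, the motion on the covering is along the straight line
in the direction E. -/
theorem exists_integralCurve (m : ℕ) (E : hyperplane K) (x : ℝ × NFManifold K σ) :
    ∃ γ : ℝ → ℝ × NFManifold K σ, γ 0 = x ∧
      IsMIntegralCurve (I := 𝓘(ℝ, ℝ).prod 𝓘(ℝ, SolvModel K)) γ (liouvilleField σ m E) := by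
  obtain ⟨s₀, y⟩ := x
  obtain ⟨g, rfl⟩ := proj_surjective σ y
  obtain ⟨S, hS0, hS⟩ := exists_radialFlow m s₀
  -- The primitive of tanh(S) S' - 1 that vanishes at time 0.
  let T : ℝ → ℝ := fun u => Real.log (Real.cosh (S u)) - Real.log (Real.cosh s₀) - u
  have hT (u : ℝ) : HasDerivAt T
      (Real.sinh (S u) / Real.cosh (S u) * radialSpeed m (S u) - 1) u := by
    have h := (((hS u).cosh.log (Real.cosh_pos _).ne').sub_const
      (Real.log (Real.cosh s₀))).sub (hasDerivAt_id u)
    refine h.congr_deriv ?_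
    ring
  refine ⟨fun u => (S u, proj σ (g + T u • ((E, 0) : SolvModel K))), ?_, fun u => ?_⟩
  · simp [T, hS0]
  · obtain ⟨γ, -, -, h1⟩ := exists_hasMFDerivAt_proj σ (g + T u • ((E, 0) : SolvModel K))
    have h2 : HasFDerivAt (fun u => g + T u • ((E, 0) : SolvModel K))
        ((1 : ℝ →L[ℝ] ℝ).smulRight
          ((Real.sinh (S u) / Real.cosh (S u) * radialSpeed m (S u) - 1) •
            ((E, 0) : SolvModel K))) u :=
      (((hT u).smul_const ((E, 0) : SolvModel K)).const_add g).hasFDerivAt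
    have h3 := h1.comp u h2.hasMFDerivAt
    have h4 := (hS u).hasFDerivAt.hasMFDerivAt.prodMk h3
    refine h4.congr_mfderiv ?_
    refine ContinuousLinearMap.ext fun r => ?_
    refine Prod.ext rfl ?_
    have key (r : ℝ) : scaleMap γ.1.1 (r •
        ((Real.sinh (S u) / Real.cosh (S u) * radialSpeed m (S u) - 1) •
          ((E, 0) : SolvModel K))) =
        r • ((((Real.sinh (S u) / Real.cosh (S u) * radialSpeed m (S u) - 1) • E, 0)) :
          SolvModel K) := by
      rw [map_smul, map_smul, scaleMap_horizontal]
      simp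
    exact key r

/-- The exhausting function is s², proper because the quotient is compact; its derivative along the
field is 2s times the radial speed, which has the sign of s. -/
theorem isLiouvilleManifold_pair [CompactSpace (NFManifold K σ)] :
    IsLiouvilleManifold (liouvillePairForm (inducedForm σ (pairCovector w₀ 1))
      (inducedForm σ (pairCovector w₀ (-1)))) := by
  obtain ⟨m, hm⟩ := exists_finrank_eq_add_one (K := K)
  obtain ⟨E, hE₀, hE⟩ := exists_liouvilleDirection w₀ hm
  refine ⟨isLiouvilleForm_pair w₀ σ, liouvilleField σ m E, ?_, exists_integralCurve σ m E,
    fun x => x.1 ^ 2, 1, contMDiff_fst.pow 2, ⟨0, fun x => sq_nonneg _⟩, fun a => ?_, ?_⟩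
  · have key (x : ℝ × NFManifold K σ) (v : ℝ × SolvModel K) :
        (liouvillePairForm (inducedForm σ (pairCovector w₀ 1))
          (inducedForm σ (pairCovector w₀ (-1)))).d x (liouvilleField σ m E x) v =
        liouvillePairForm (inducedForm σ (pairCovector w₀ 1))
          (inducedForm σ (pairCovector w₀ (-1))) x v := by
      refine (d_pairForm σ w₀ x _ v).trans ?_
      rw [liouvilleField, scaleMap_horizontal, pairTwoForm_liouvilleDirection w₀ hm hE₀ hE,
        liouvillePairForm_eq]
      rfl
    exact key
  · refine IsCompact.of_isClosed_subset
      (isCompact_Icc.prod (isCompact_univ (X := NFManifold K σ)))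
      (isClosed_le (continuous_fst.pow 2) continuous_const)
      (s := Icc (-Real.sqrt a) (Real.sqrt a) ×ˢ univ) fun x hx => ⟨?_, mem_univ _⟩
    exact abs_le.1 (Real.abs_le_sqrt hx)
  · intro x (hx : 1 ≤ x.1 ^ 2)
    have h1 : HasMFDerivAt (𝓘(ℝ, ℝ).prod 𝓘(ℝ, SolvModel K)) 𝓘(ℝ, ℝ)
        (fun x : ℝ × NFManifold K σ => x.1 ^ 2) x _ :=
      ((hasDerivAt_pow 2 x.1).hasFDerivAt.hasMFDerivAt).comp x (hasMFDerivAt_fst x)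
    rw [h1.mfderiv]
    have h2 : 0 < radialSpeed m x.1 * (2 * x.1) := by
      have hx0 : x.1 ≠ 0 := by
        intro h
        rw [h] at hx
        norm_num at hx
      have h3 : 0 < Real.sinh x.1 * x.1 := by
        obtain h | h := hx0.lt_or_gt
        · exact mul_pos_of_neg_of_neg (Real.sinh_neg_iff.2 h) h
        · exact mul_pos (Real.sinh_pos_iff.2 h) h
      have hd := radialDenom_pos m x.1
      have hc := Real.cosh_pos x.1
      have h4 : radialSpeed m x.1 * (2 * x.1) = 2 * ((m + 1) * ((Real.sinh x.1 * x.1) *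
          Real.cosh x.1) / (Real.cosh x.1 ^ 2 + m * Real.sinh x.1 ^ 2)) := by
        unfold radialSpeed
        ring
      rw [h4]
      positivity
    refine h2.trans_eq ?_
    change _ = radialSpeed m x.1 * _
    simp

end LiouvilleManifold

/-! ### Lattices from integers and units; compactness -/

section LatticeBases

theorem exists_basis_of_discrete_span {E : Type*} [NormedAddCommGroup E] [NormedSpace ℝ E]
    [FiniteDimensional ℝ E] {d : ℕ} (hd : finrank ℝ E = d) (A : AddSubgroup E)
    [DiscreteTopology A] (hA : Submodule.span ℝ (A : Set E) = ⊤) :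
    ∃ b : Basis (Fin d) ℝ E, ∀ x, x ∈ A ↔ ∀ i, ∃ k : ℤ, b.repr x i = k := by
  let L : Submodule ℤ E := AddSubgroup.toIntSubmodule A
  have hL : DiscreteTopology L := inferInstanceAs (DiscreteTopology A)
  have hL' : IsZLattice ℝ L := ⟨hA⟩
  have : Module.Finite ℤ L := ZLattice.module_finite ℝ L
  have : Module.Free ℤ L := ZLattice.module_free ℝ L
  let b₀ := Module.Free.chooseBasis ℤ L
  let b := b₀.ofZLatticeBasis ℝ L
  have hcard : Fintype.card (Module.Free.ChooseBasisIndex ℤ L) = d := by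
    rw [← hd, finrank_eq_card_basis b]
  let e := Fintype.equivFinOfCardEq hcard
  refine ⟨b.reindex e, fun x => ?_⟩
  have h : x ∈ A ↔ x ∈ Submodule.span ℤ (Set.range b) := by
    rw [Basis.ofZLatticeBasis_span]
    exact Iff.rfl
  rw [h, b.mem_span_iff_repr_mem ℤ, ← e.symm.forall_congr_right]
  refine forall_congr' fun i => ?_
  rw [Basis.repr_reindex_apply]
  simp only [Set.mem_range, algebraMap_int_eq, eq_intCast, eq_comm]

variable {K : Type u} [Field K]

/-- The coordinate of `ℝ^r × ℂ^s` at an infinite place, normalized to sum to the trace. -/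
def placeCoord (w : InfinitePlace K) : mixedSpace K →ₗ[ℝ] ℝ :=
  if h : IsReal w then (LinearMap.proj ⟨w, h⟩).comp (LinearMap.fst ℝ _ _)
  else (2 : ℝ) • Complex.reLm.comp
    ((LinearMap.proj ⟨w, not_isReal_iff_isComplex.1 h⟩).comp (LinearMap.snd ℝ _ _))

theorem placeCoord_of_isReal (w : {w : InfinitePlace K // IsReal w}) (x : mixedSpace K) :
    placeCoord w.1 x = x.1 w := by
  unfold placeCoord
  rw [dif_pos w.2]
  rfl

theorem placeCoord_of_isComplex (w : {w : InfinitePlace K // IsComplex w}) (x : mixedSpace K) :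
    placeCoord w.1 x = 2 * (x.2 w).re := by
  unfold placeCoord
  rw [dif_neg (not_isReal_iff_isComplex.2 w.2)]
  rfl

variable [NumberField K] (σ : EmbeddingChoice K)

/-- The lattice basis of the mixed embedding belongs to one particular choice of complex embeddings.
The isomorphism induced by the identity of K conjugates coordinates where σ differs from it, and so
transports the basis. -/
theorem exists_ringOfIntegers_basis {n : ℕ} (hn : finrank ℚ K = n) :
    ∃ B : Basis (Fin n) ℝ (mixedSpace K),
      ∀ z, (∃ x : 𝓞 K, z = jEmbedding σ (x : K)) ↔ ∀ i, ∃ k : ℤ, B.repr z i = k := by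
  let σ₀ : EmbeddingChoice K := fun w => ⟨w.1.embedding, mk_embedding w.1⟩
  let Φ := (mixedIso (RingEquiv.refl K) σ₀ σ).toEquiv
  have hΦ (x : K) : Φ (mixedEmbedding K x) = jEmbedding σ x :=
    mixedIso_jEmbedding (RingEquiv.refl K) σ₀ σ x
  have hcard : Fintype.card (Module.Free.ChooseBasisIndex ℤ (𝓞 K)) = n := by
    rw [← finrank_eq_card_chooseBasisIndex, RingOfIntegers.rank, hn]
  let e := Fintype.equivFinOfCardEq hcard
  refine ⟨((latticeBasis K).map Φ).reindex e, fun z => ?_⟩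
  have h : (∃ x : 𝓞 K, z = jEmbedding σ (x : K)) ↔
      Φ.symm z ∈ Submodule.span ℤ (Set.range (latticeBasis K)) := by
    rw [mem_span_latticeBasis]
    constructor
    · rintro ⟨x, rfl⟩
      exact ⟨x, by rw [← hΦ, LinearEquiv.symm_apply_apply]; rfl⟩
    · rintro ⟨x, hx⟩
      refine ⟨x, ?_⟩
      rw [← hΦ, ← LinearEquiv.symm_apply_eq]
      exact hx.symm
  rw [h, (latticeBasis K).mem_span_iff_repr_mem ℤ, ← e.symm.forall_congr_right]
  refine forall_congr' fun i => ?_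
  rw [Basis.repr_reindex_apply]
  simp only [Set.mem_range, algebraMap_int_eq, eq_intCast, eq_comm]
  rfl

theorem discreteTopology_unitLattice : DiscreteTopology (unitLattice σ) := by
  rw [← SetLike.isDiscrete_iff_discreteTopology]
  have h : (unitLattice σ : Set (hyperplane K)) =
      (fun t => ((t, 0) : SolvModel K)) ⁻¹' (solvLattice σ : Set (SolvGroup K)) := by
    ext t
    exact ⟨fun ht => ⟨ht, 0, by simp⟩, fun ht => ht.1⟩
  rw [h]
  refine (isDiscrete_solvLattice σ).preimage ?_ ?_
  · exact (Continuous.prodMk_left (0 : mixedSpace K)).continuousOn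
  · exact fun a b hab => (Prod.ext_iff.1 hab).1

theorem sum_placeCoord (x : mixedSpace K) : ∑ w, placeCoord w x = traceForm K x := by
  rw [sum_eq_sum_add_sum]
  simp only [placeCoord_of_isReal, placeCoord_of_isComplex]
  rw [← Finset.mul_sum]
  rfl

/-- Squaring makes a unit positive at all real places, at the cost of a factor 2. The product
formula for units puts its logarithm in the hyperplane. -/
theorem exists_mem_unitLattice_placeCoord (x : (𝓞 K)ˣ) :
    ∃ t ∈ unitLattice σ, ∀ w, placeCoord w t.1 = 2 * (mult w * Real.log (w (x : K))) := by
  have hx : (x : K) ≠ 0 := Units.coe_ne_zero x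
  let t : mixedSpace K := (fun w => Real.log (embedding_of_isReal w.2 ((x ^ 2 : (𝓞 K)ˣ) : K)),
    fun w => Complex.log ((σ w).1 ((x ^ 2 : (𝓞 K)ˣ) : K)))
  have hpos (w : {w : InfinitePlace K // IsReal w}) :
      0 < embedding_of_isReal w.2 ((x ^ 2 : (𝓞 K)ˣ) : K) := by
    have : embedding_of_isReal w.2 (x : K) ≠ 0 := (map_ne_zero _).2 hx
    simp only [Units.val_pow_eq_pow_val, map_pow]
    positivity
  have hw (w) : placeCoord w t = 2 * (mult w * Real.log (w (x : K))) := by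
    obtain hw | hw := w.isReal_or_isComplex
    · rw [placeCoord_of_isReal ⟨w, hw⟩, mult_isReal ⟨w, hw⟩, ← norm_embedding_of_isReal hw,
        Real.norm_eq_abs, Real.log_abs]
      simp [t]
    · rw [placeCoord_of_isComplex ⟨w, hw⟩, mult_isComplex ⟨w, hw⟩]
      have h1 : w (x : K) = ‖(σ ⟨w, hw⟩).1 (x : K)‖ := by
        have h := (σ ⟨w, hw⟩).2
        exact (DFunLike.congr_fun h (x : K)).symm
      rw [h1]
      simp [t, Complex.log_re]
  refine ⟨⟨t, ?_⟩, ⟨x ^ 2, hpos, ?_⟩, hw⟩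
  · rw [LinearMap.mem_ker, ← sum_placeCoord]
    simp only [hw]
    rw [← Finset.mul_sum, Units.sum_mult_mul_log, mul_zero]
  · refine Prod.ext (funext fun w => Real.exp_log (hpos w)) (funext fun w => Complex.exp_log ?_)
    exact (map_ne_zero _).2 (Units.coe_ne_zero _)

/-- The logarithmic map Λ to Dirichlet's log space is onto on the span, by the unit theorem, and its
kernel is spanned by the periods 2πi at complex places, which lie in the lattice as logarithms of 1.
-/
theorem span_unitLattice : Submodule.span ℝ (unitLattice σ : Set (hyperplane K)) = ⊤ := by
  let Λ : hyperplane K →ₗ[ℝ] Units.dirichletUnitTheorem.logSpace K :=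
    LinearMap.pi fun w => (placeCoord w.1).comp (hyperplane K).subtype
  have hker : LinearMap.ker Λ ≤ Submodule.span ℝ (unitLattice σ : Set (hyperplane K)) := by
    intro t ht
    have h1 (w : InfinitePlace K) : placeCoord w t.1 = 0 := by
      have h2 (w : {w : InfinitePlace K // w ≠ Units.dirichletUnitTheorem.w₀}) :
          placeCoord w.1 t.1 = 0 := congrFun (LinearMap.mem_ker.1 ht) w
      -- The log space omits one place; its coordinate is recovered from the trace relation.
      by_cases hw : w = Units.dirichletUnitTheorem.w₀
      · have h3 : traceForm K t.1 = 0 := t.2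
        rw [← sum_placeCoord, Fintype.sum_eq_add_sum_subtype_ne _ w] at h3
        have h4 : ∑ w' : {w' // w' ≠ w}, placeCoord w'.1 t.1 = 0 :=
          Fintype.sum_eq_zero _ fun w' => h2 ⟨w'.1, hw ▸ w'.2⟩
        rwa [h4, add_zero] at h3
      · exact h2 ⟨w, hw⟩
    have hvert (w : {w : InfinitePlace K // IsComplex w}) :
        ((0, Pi.single w (2 * Real.pi * Complex.I)) : mixedSpace K) ∈ hyperplane K := by
      rw [LinearMap.mem_ker]
      have h2 (w' : {w : InfinitePlace K // IsComplex w}) :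
          ((Pi.single w (2 * (Real.pi : ℂ) * Complex.I) :
            {w : InfinitePlace K // IsComplex w} → ℂ) w').re = 0 := by
        obtain rfl | h := eq_or_ne w' w
        · simp
        · simp [Pi.single_eq_of_ne h]
      change (∑ _, (0 : ℝ)) + 2 * ∑ w', _ = 0
      rw [Finset.sum_congr rfl fun w' _ => h2 w']
      simp
    have hmem (w) : (⟨_, hvert w⟩ : hyperplane K) ∈ unitLattice σ := by
      refine ⟨1, one_mem _, Prod.ext (funext fun w' => ?_) (funext fun w' => ?_)⟩
      · simp [mixedExp]
      · obtain rfl | h := eq_or_ne w' w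
        · simp [mixedExp]
        · simp [mixedExp, Pi.single_eq_of_ne h]
    -- All place coordinates of t vanish, so only imaginary parts at complex places are left.
    have h2 : t = ∑ w, ((t.1.2 w).im / (2 * Real.pi)) • (⟨_, hvert w⟩ : hyperplane K) := by
      refine Subtype.ext ?_
      rw [AddSubmonoidClass.coe_finsetSum]
      refine Prod.ext (funext fun w => ?_) (funext fun w => ?_)
      · rw [Prod.fst_sum, Finset.sum_apply, ← placeCoord_of_isReal, h1]
        simp
      · rw [Prod.snd_sum, Finset.sum_apply, Finset.sum_eq_single w]
        · have h3 : (t.1.2 w).re = 0 := by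
            have := h1 w.1
            rw [placeCoord_of_isComplex] at this
            linarith
          have hpi := Real.pi_ne_zero
          have h4 : t.1.2 w = (t.1.2 w).im * Complex.I := Complex.ext (by simp [h3]) (by simp)
          change t.1.2 w = ((t.1.2 w).im / (2 * Real.pi)) •
            (Pi.single w (2 * (Real.pi : ℂ) * Complex.I) :
              {w : InfinitePlace K // IsComplex w} → ℂ) w
          have hpi' : (Real.pi : ℂ) ≠ 0 := Complex.ofReal_ne_zero.2 hpi
          rw [Pi.single_eq_same, Complex.real_smul]
          push_cast
          field_simp
          exact h4
        · intro w' _ hw'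
          simp [Pi.single_eq_of_ne hw'.symm]
        · intro h
          exact absurd (Finset.mem_univ w) h
    rw [h2]
    exact Submodule.sum_mem _ fun w _ => Submodule.smul_mem _ _ (Submodule.subset_span (hmem w))
  have hmap : Submodule.map Λ (Submodule.span ℝ (unitLattice σ : Set (hyperplane K))) = ⊤ := by
    rw [eq_top_iff, ← Units.dirichletUnitTheorem.unitLattice_span_eq_top K, Submodule.span_le]
    rintro _ ⟨x, -, rfl⟩
    obtain ⟨t, ht, h⟩ := exists_mem_unitLattice_placeCoord σ x.toMul
    refine ⟨(1 / 2 : ℝ) • t, Submodule.smul_mem _ _ (Submodule.subset_span ht), ?_⟩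
    funext w
    change placeCoord w.1 ((1 / 2 : ℝ) • t.1) = _
    rw [map_smul, h, smul_eq_mul]
    change 1 / 2 * (2 * (mult w.1 * Real.log (w.1 (x.toMul : K)))) =
      mult w.1 * Real.log (w.1 (x.toMul : K))
    ring
  have h := congrArg (Submodule.comap Λ) hmap
  rwa [Submodule.comap_map_eq, Submodule.comap_top, sup_eq_left.2 hker] at h

theorem exists_unitLattice_basis {m : ℕ} (hm : finrank ℚ K = m + 1) :
    ∃ b : Basis (Fin m) ℝ (hyperplane K),
      ∀ t, t ∈ unitLattice σ ↔ ∀ i, ∃ k : ℤ, b.repr t i = k := by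
  have := discreteTopology_unitLattice σ
  refine exists_basis_of_discrete_span ?_ _ (span_unitLattice σ)
  have h := finrank_hyperplane (K := K)
  omega

theorem exists_mem_compact_sub_int {E : Type*} [NormedAddCommGroup E] [NormedSpace ℝ E] {d : ℕ}
    (b : Basis (Fin d) ℝ E) :
    ∃ C : Set E, IsCompact C ∧ ∀ x, ∃ y ∈ C, ∀ i, ∃ k : ℤ, b.repr (y - x) i = k := by
  have hc : Continuous b.equivFun.symm := LinearMap.continuous_of_finiteDimensional
    b.equivFun.symm.toLinearMap
  refine ⟨b.equivFun.symm '' Icc 0 1, isCompact_Icc.image hc, fun x => ?_⟩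
  refine ⟨b.equivFun.symm fun i => Int.fract (b.repr x i),
    ⟨_, ⟨fun i => Int.fract_nonneg _, fun i => (Int.fract_lt_one _).le⟩, rfl⟩,
    fun i => ⟨-⌊b.repr x i⌋, ?_⟩⟩
  rw [map_sub, Finsupp.sub_apply]
  have h : b.repr (b.equivFun.symm fun i => Int.fract (b.repr x i)) i = Int.fract (b.repr x i) :=
    congrFun (b.equivFun.apply_symm_apply _) i
  rw [h, Int.fract]
  push_cast
  ring

/-- A product of compact sets meeting every coset of the two lattices maps onto the quotient. -/
instance compactSpace_nfManifold : CompactSpace (NFManifold K σ) := by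
  obtain ⟨m, hm⟩ := exists_finrank_eq_add_one (K := K)
  obtain ⟨b, hb⟩ := exists_unitLattice_basis σ hm
  obtain ⟨B, hB⟩ := exists_ringOfIntegers_basis σ hm
  obtain ⟨C, hC, hC'⟩ := exists_mem_compact_sub_int b
  obtain ⟨D, hD, hD'⟩ := exists_mem_compact_sub_int B
  rw [← isCompact_univ_iff]
  convert! (hC.prod hD).image (continuous_proj σ)
  refine (eq_univ_of_forall fun x => ?_).symm
  obtain ⟨⟨t, z⟩, rfl⟩ := proj_surjective σ x
  obtain ⟨t', ht', h1⟩ := hC' t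
  -- Moving t to t' multiplies z by e^{t'-t}, so the fibre coordinate is reduced modulo integers
  -- only afterwards.
  obtain ⟨z', hz', h2⟩ := hD' (mixedExp (t' - t).1 * z)
  refine ⟨(t', z'), ⟨ht', hz'⟩, ((proj_eq_proj_iff σ).2 ?_).symm⟩
  refine ⟨(t' - t, z' - mixedExp (t' - t).1 * z), ⟨(hb _).2 h1, (hB _).2 h2⟩, ?_⟩
  exact Prod.ext (sub_add_cancel t' t) (sub_add_cancel _ _)

end LatticeBases

/-! ### Smooth local lifts from the torus to its universal covering -/

section Torus

variable {E : Type*} [NormedAddCommGroup E] [NormedSpace ℝ E]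
  {H : Type*} [TopologicalSpace H] {I : ModelWithCorners ℝ E H}
  {M : Type*} [TopologicalSpace M] [ChartedSpace H M]

theorem contMDiffAt_torus {d : ℕ} {f : M → Torus d} {x : M}
    (hf : ∀ i, ContMDiffAt I (𝓡 1) ∞ (fun y => f y i) x) :
    ContMDiffAt I (torusModel d) ∞ f x := by
  rw [contMDiffAt_iff_target]
  refine ⟨continuousAt_pi.2 fun i => (hf i).continuousAt, ?_⟩
  exact contMDiffAt_pi_space.2 fun i => (contMDiffAt_iff_target.1 (hf i)).2

theorem contMDiff_torus_apply {d : ℕ} (i : Fin d) :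
    ContMDiff (torusModel d) (𝓡 1) ∞ fun g : Torus d => g i := by
  intro c
  rw [contMDiffAt_iff]
  refine ⟨(continuous_apply i).continuousAt, ContDiffAt.contDiffWithinAt ?_⟩
  have h : ContDiffAt ℝ ∞ (fun y : Fin d → EuclideanSpace ℝ (Fin 1) => y i)
      (extChartAt (torusModel d) c c) := contDiffAt_pi.1 contDiffAt_id i
  refine h.congr_of_eventuallyEq ?_
  have h1 : ∀ᶠ y : Fin d → EuclideanSpace ℝ (Fin 1) in 𝓝 (extChartAt (torusModel d) c c),
      y i ∈ (extChartAt (𝓡 1) (c i)).target :=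
    (continuous_apply i).continuousAt.eventually (extChartAt_target_mem_nhds (I := 𝓡 1) (c i))
  filter_upwards [h1] with y hy
  exact (extChartAt (𝓡 1) (c i)).right_inv hy

/-- The universal covering of the torus. -/
def torusExp {d : ℕ} (x : Fin d → ℝ) : Torus d := fun i => Circle.exp (2 * Real.pi * x i)

theorem torusExp_eq_iff {d : ℕ} {x y : Fin d → ℝ} :
    torusExp x = torusExp y ↔ ∀ i, ∃ k : ℤ, x i - y i = k := by
  rw [funext_iff]
  refine forall_congr' fun i => ?_
  rw [torusExp, torusExp, Circle.exp_eq_exp]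
  refine exists_congr fun k => ?_
  have hpi := Real.pi_pos
  constructor
  · intro h
    have h1 : 2 * Real.pi * (x i - y i - k) = 0 := by linear_combination h
    have h2 := (mul_eq_zero.1 h1).resolve_left (by positivity)
    linarith
  · intro h
    linear_combination 2 * Real.pi * h

theorem contMDiff_torusExp (d : ℕ) :
    ContMDiff 𝓘(ℝ, Fin d → ℝ) (torusModel d) ∞ (torusExp : (Fin d → ℝ) → Torus d) := by
  intro x
  refine contMDiffAt_torus fun i => ?_
  have h : ContDiff ℝ ∞ fun x : Fin d → ℝ => 2 * Real.pi * x i := by fun_prop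
  exact (contMDiff_circleExp.comp h.contMDiff).contMDiffAt

/-- The lift of a point of the circle to the real line, by the branch of the argument that is
smooth near the image of `x₀`. -/
def circleLift (x₀ : ℝ) (y : Circle) : ℝ :=
  x₀ + Complex.arg ((y : ℂ) * ((Circle.exp (2 * Real.pi * x₀))⁻¹ : Circle)) / (2 * Real.pi)

theorem exp_circleLift (x₀ : ℝ) (y : Circle) :
    Circle.exp (2 * Real.pi * circleLift x₀ y) = y := by
  have h : 2 * Real.pi * circleLift x₀ y = 2 * Real.pi * x₀ +
      Complex.arg ((y * (Circle.exp (2 * Real.pi * x₀))⁻¹ : Circle) : ℂ) := by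
    rw [circleLift, Circle.coe_mul]
    have hpi := Real.pi_ne_zero
    field_simp
  rw [h, Circle.exp_add, Circle.exp_arg, mul_inv_cancel_comm_assoc]

/-- The domain where `circleLift` is smooth. -/
def liftDomain (x₀ : ℝ) : Set Circle :=
  {y | (y : ℂ) * ((Circle.exp (2 * Real.pi * x₀))⁻¹ : Circle) ∈ Complex.slitPlane}

theorem isOpen_liftDomain (x₀ : ℝ) : IsOpen (liftDomain x₀) :=
  Complex.isOpen_slitPlane.preimage (continuous_subtype_val.mul continuous_const)

theorem mem_liftDomain (x₀ : ℝ) : Circle.exp (2 * Real.pi * x₀) ∈ liftDomain x₀ := by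
  change _ * _ ∈ Complex.slitPlane
  rw [← Circle.coe_mul, mul_inv_cancel]
  exact Complex.one_mem_slitPlane

theorem contMDiff_circle_coe : ContMDiff (𝓡 1) 𝓘(ℝ, ℂ) ∞ fun y : Circle => (y : ℂ) := by
  have : Fact (finrank ℝ ℂ = 1 + 1) := ⟨Complex.finrank_real_complex⟩
  have h := contMDiff_coe_sphere (E := ℂ) (n := 1) (m := ∞)
  exact h

/-- The argument is the imaginary part of the complex logarithm, which is smooth on the slit plane.
-/
theorem contMDiffAt_circleLift {x₀ : ℝ} {y : Circle} (hy : y ∈ liftDomain x₀) :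
    ContMDiffAt (𝓡 1) 𝓘(ℝ, ℝ) ∞ (circleLift x₀) y := by
  have h1 : ContDiffAt ℝ ∞ (fun z : ℂ => z * ((Circle.exp (2 * Real.pi * x₀))⁻¹ : Circle)) y := by
    fun_prop
  have h2 : ContDiffAt ℝ ∞ Complex.log
      ((y : ℂ) * ((Circle.exp (2 * Real.pi * x₀))⁻¹ : Circle)) :=
    (Complex.contDiffAt_log hy).restrict_scalars ℝ
  have h3 := (Complex.imCLM.contDiff.contDiffAt (n := ∞)).comp _ (h2.comp (y : ℂ) h1)
  have h4 := (contDiffAt_const (c := x₀)).add (h3.div_const (2 * Real.pi))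
  have h5 := h4.contMDiffAt.comp y (contMDiff_circle_coe y)
  refine h5.congr_of_eventuallyEq (Filter.Eventually.of_forall fun z => ?_)
  change x₀ + _ / _ = x₀ + (Complex.log _).im / _
  rw [Complex.log_im]

/-- The lift of a point of the torus to its universal covering. -/
def torusLift {d : ℕ} (x₀ : Fin d → ℝ) (y : Torus d) : Fin d → ℝ := fun i => circleLift (x₀ i) (y i)

theorem torusExp_torusLift {d : ℕ} (x₀ : Fin d → ℝ) (y : Torus d) :
    torusExp (torusLift x₀ y) = y :=
  funext fun i => exp_circleLift (x₀ i) (y i)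

/-- The domain where `torusLift` is smooth. -/
def torusLiftDomain {d : ℕ} (x₀ : Fin d → ℝ) : Set (Torus d) := {y | ∀ i, y i ∈ liftDomain (x₀ i)}

theorem isOpen_torusLiftDomain {d : ℕ} (x₀ : Fin d → ℝ) : IsOpen (torusLiftDomain x₀) := by
  have h : torusLiftDomain x₀ = ⋂ i, (fun y : Torus d => y i) ⁻¹' liftDomain (x₀ i) := by
    ext y
    simp [torusLiftDomain]
  rw [h]
  exact isOpen_iInter_of_finite fun i => (isOpen_liftDomain _).preimage (continuous_apply i)

theorem mem_torusLiftDomain {d : ℕ} (x₀ : Fin d → ℝ) : torusExp x₀ ∈ torusLiftDomain x₀ :=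
  fun i => mem_liftDomain (x₀ i)

theorem contMDiffAt_torusLift {d : ℕ} {x₀ : Fin d → ℝ} {y : Torus d}
    (hy : y ∈ torusLiftDomain x₀) :
    ContMDiffAt (torusModel d) 𝓘(ℝ, Fin d → ℝ) ∞ (torusLift x₀) y :=
  contMDiffAt_pi_space.2 fun i =>
    (contMDiffAt_circleLift (hy i)).comp y (contMDiff_torus_apply i y)

end Torus

/-! ### The torus bundle -/

section TorusBundle

variable {K : Type u} [Field K] [NumberField K] (σ : EmbeddingChoice K) {m n : ℕ}
  (b : Basis (Fin m) ℝ (hyperplane K)) (B : Basis (Fin n) ℝ (mixedSpace K))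

theorem exists_mem_lattice_chartCenter_proj (g : SolvModel K) :
    ∃ γ ∈ solvLattice σ, chartCenter σ (proj σ g) = leftTranslate γ g := by
  obtain ⟨γ, hγ, h⟩ := (proj_eq_proj_iff σ).1 (proj_chartCenter σ (proj σ g)).symm
  exact ⟨γ, hγ, h.symm⟩

/-- The projection of the quotient to a torus. -/
def bundleProj (x : NFManifold K σ) : Torus m := torusExp (b.equivFun (chartCenter σ x).1)

theorem torusExp_equivFun_eq_iff {E : Type*} [AddCommGroup E] [Module ℝ E] {d : ℕ}
    (b : Basis (Fin d) ℝ E) (x y : E) :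
    torusExp (b.equivFun x) = torusExp (b.equivFun y) ↔ ∀ i, ∃ k : ℤ, b.repr (x - y) i = k := by
  rw [torusExp_eq_iff]
  simp only [map_sub, Finsupp.sub_apply, Basis.equivFun_apply]

theorem bundleProj_proj (hb : ∀ t, t ∈ unitLattice σ ↔ ∀ i, ∃ k : ℤ, b.repr t i = k)
    (g : SolvModel K) : bundleProj σ b (proj σ g) = torusExp (b.equivFun g.1) := by
  obtain ⟨γ, hγ, h⟩ := exists_mem_lattice_chartCenter_proj σ g
  rw [bundleProj, h, torusExp_equivFun_eq_iff, ← hb]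
  have h1 : (leftTranslate γ g).1 - g.1 = γ.1 := add_sub_cancel_right _ _
  rw [h1]
  exact hγ.1

/-- A local section of the covering of the base torus by the hyperplane. -/
def baseLift (x₀ : Fin m → ℝ) (y : Torus m) : hyperplane K := b.equivFun.symm (torusLift x₀ y)

theorem torusExp_baseLift (x₀ : Fin m → ℝ) (y : Torus m) :
    torusExp (b.equivFun (baseLift b x₀ y)) = y := by
  rw [baseLift, LinearEquiv.apply_symm_apply, torusExp_torusLift]

/-- The coordinate on the fibres of `bundleProj` over the domain of a local section. -/
def fiberMap (x₀ : Fin m → ℝ) (x : NFManifold K σ) : Torus n :=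
  torusExp (B.equivFun (mixedExp (baseLift b x₀ (bundleProj σ b x) - (chartCenter σ x).1).1 *
    (chartCenter σ x).2))

/-- Two lifts of the same point of the base torus differ by an element of the unit lattice. -/
theorem baseLift_sub_mem (hb : ∀ t, t ∈ unitLattice σ ↔ ∀ i, ∃ k : ℤ, b.repr t i = k)
    (x₀ : Fin m → ℝ) (g : SolvModel K) :
    baseLift b x₀ (bundleProj σ b (proj σ g)) - g.1 ∈ unitLattice σ := by
  rw [hb, ← torusExp_equivFun_eq_iff, torusExp_baseLift, bundleProj_proj σ b hb]

/-- The element of the unit lattice moving g over the chosen section acts on the fibre by a unit.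
Changing the representative therefore changes the fibre coordinate by a unit times an integer, which
is again an integer. -/
theorem fiberMap_proj (hb : ∀ t, t ∈ unitLattice σ ↔ ∀ i, ∃ k : ℤ, b.repr t i = k)
    (hB : ∀ z, (∃ x : 𝓞 K, z = jEmbedding σ (x : K)) ↔ ∀ i, ∃ k : ℤ, B.repr z i = k)
    (x₀ : Fin m → ℝ) (g : SolvModel K) :
    fiberMap σ b B x₀ (proj σ g) = torusExp (B.equivFun
      (mixedExp (baseLift b x₀ (bundleProj σ b (proj σ g)) - g.1).1 * g.2)) := by
  obtain ⟨γ, hγ, h⟩ := exists_mem_lattice_chartCenter_proj σ g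
  have h1 := baseLift_sub_mem σ b hb x₀ (chartCenter σ (proj σ g))
  rw [proj_chartCenter] at h1
  rw [fiberMap, torusExp_equivFun_eq_iff, ← hB]
  rw [h] at h1 ⊢
  obtain ⟨e, -, he⟩ := h1
  obtain ⟨-, x, hx⟩ := hγ
  refine ⟨e * x, ?_⟩
  have h2 : (leftTranslate γ g).2 = γ.2 + mixedExp γ.1.1 * g.2 := rfl
  have h3 : baseLift b x₀ (bundleProj σ b (proj σ g)) - g.1 =
      (baseLift b x₀ (bundleProj σ b (proj σ g)) - (leftTranslate γ g).1) + γ.1 := by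
    change _ = (_ - (γ.1 + g.1)) + γ.1
    abel
  rw [h3, Submodule.coe_add, mixedExp_add, h2, mul_add, mul_assoc, add_sub_cancel_right, he, hx]
  simp

/-- The inverse of the trivialization of `bundleProj`. -/
def bundleInv (x₀ : Fin m → ℝ) (q : Torus m × Torus n) : NFManifold K σ :=
  proj σ (baseLift b x₀ q.1, B.equivFun.symm (torusLift 0 q.2))

/-- Any lift z of the fibre point may be used, not only the branch fixed in `bundleInv`. This gives
smoothness also across the cut of that branch. -/
theorem bundleInv_eq
    (hB : ∀ z, (∃ x : 𝓞 K, z = jEmbedding σ (x : K)) ↔ ∀ i, ∃ k : ℤ, B.repr z i = k)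
    (x₀ : Fin m → ℝ) (y : Torus m) (z : mixedSpace K) :
    bundleInv σ b B x₀ (y, torusExp (B.equivFun z)) = proj σ (baseLift b x₀ y, z) := by
  let z' := B.equivFun.symm (torusLift 0 (torusExp (B.equivFun z)))
  have h1 : torusExp (B.equivFun z) = torusExp (B.equivFun z') := by
    rw [LinearEquiv.apply_symm_apply, torusExp_torusLift]
  rw [torusExp_equivFun_eq_iff, ← hB] at h1
  refine (proj_eq_proj_iff σ).2 ⟨(0, z - z'), ⟨zero_mem _, h1⟩, ?_⟩
  refine Prod.ext (zero_add _) ?_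
  change (z - z') + mixedExp (0 : mixedSpace K) * z' = z
  rw [mixedExp_zero, one_mul, sub_add_cancel]

theorem bundleInv_bundleProj
    (hb : ∀ t, t ∈ unitLattice σ ↔ ∀ i, ∃ k : ℤ, b.repr t i = k)
    (hB : ∀ z, (∃ x : 𝓞 K, z = jEmbedding σ (x : K)) ↔ ∀ i, ∃ k : ℤ, B.repr z i = k)
    (x₀ : Fin m → ℝ) (x : NFManifold K σ) :
    bundleInv σ b B x₀ (bundleProj σ b x, fiberMap σ b B x₀ x) = x := by
  obtain ⟨g, rfl⟩ := proj_surjective σ x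
  rw [fiberMap_proj σ b B hb hB, bundleInv_eq σ b B hB]
  refine ((proj_eq_proj_iff σ).2 ⟨(baseLift b x₀ (bundleProj σ b (proj σ g)) - g.1, 0),
    ⟨baseLift_sub_mem σ b hb x₀ g, 0, by simp⟩, ?_⟩).symm
  exact Prod.ext (sub_add_cancel _ _) (zero_add _)

theorem bundleProj_bundleInv (hb : ∀ t, t ∈ unitLattice σ ↔ ∀ i, ∃ k : ℤ, b.repr t i = k)
    (x₀ : Fin m → ℝ) (q : Torus m × Torus n) :
    bundleProj σ b (bundleInv σ b B x₀ q) = q.1 := by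
  rw [bundleInv, bundleProj_proj σ b hb, torusExp_baseLift]

theorem fiberMap_bundleInv (hb : ∀ t, t ∈ unitLattice σ ↔ ∀ i, ∃ k : ℤ, b.repr t i = k)
    (hB : ∀ z, (∃ x : 𝓞 K, z = jEmbedding σ (x : K)) ↔ ∀ i, ∃ k : ℤ, B.repr z i = k)
    (x₀ : Fin m → ℝ) (q : Torus m × Torus n) :
    fiberMap σ b B x₀ (bundleInv σ b B x₀ q) = q.2 := by
  have h := bundleProj_bundleInv σ b B hb x₀ q
  unfold bundleInv at h ⊢
  rw [fiberMap_proj σ b B hb hB, h, sub_self, Submodule.coe_zero, mixedExp_zero, one_mul,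
    LinearEquiv.apply_symm_apply, torusExp_torusLift]

theorem contMDiff_torusExp_equivFun {E : Type*} [NormedAddCommGroup E] [NormedSpace ℝ E] {d : ℕ}
    (b : Basis (Fin d) ℝ E) :
    ContMDiff 𝓘(ℝ, E) (torusModel d) ∞ fun x => torusExp (b.equivFun x) := by
  have := Module.Finite.of_basis b
  have h : ContDiff ℝ ∞ b.equivFun := b.equivFun.toContinuousLinearEquiv.contDiff
  exact (contMDiff_torusExp d).comp h.contMDiff

theorem contMDiffAt_equivFun_symm_torusLift {E : Type*} [NormedAddCommGroup E] [NormedSpace ℝ E]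
    {d : ℕ} (b : Basis (Fin d) ℝ E) {x₀ : Fin d → ℝ} {y : Torus d} (hy : y ∈ torusLiftDomain x₀) :
    ContMDiffAt (torusModel d) 𝓘(ℝ, E) ∞ (fun y => b.equivFun.symm (torusLift x₀ y)) y := by
  have := Module.Finite.of_basis b
  have h : ContDiff ℝ ∞ b.equivFun.symm := b.equivFun.symm.toContinuousLinearEquiv.contDiff
  exact h.contMDiff.contMDiffAt.comp y (contMDiffAt_torusLift hy)

theorem contMDiff_bundleProj (hb : ∀ t, t ∈ unitLattice σ ↔ ∀ i, ∃ k : ℤ, b.repr t i = k) :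
    ContMDiff 𝓘(ℝ, SolvModel K) (torusModel m) ∞ (bundleProj σ b) := by
  refine contMDiff_of_comp_proj σ ?_
  simp only [bundleProj_proj σ b hb]
  exact (contMDiff_torusExp_equivFun b).comp
    (ContinuousLinearMap.fst ℝ (hyperplane K) (mixedSpace K)).contDiff.contMDiff

theorem contMDiffAt_fiberMap (hb : ∀ t, t ∈ unitLattice σ ↔ ∀ i, ∃ k : ℤ, b.repr t i = k)
    (hB : ∀ z, (∃ x : 𝓞 K, z = jEmbedding σ (x : K)) ↔ ∀ i, ∃ k : ℤ, B.repr z i = k)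
    {x₀ : Fin m → ℝ} {x : NFManifold K σ} (hx : bundleProj σ b x ∈ torusLiftDomain x₀) :
    ContMDiffAt 𝓘(ℝ, SolvModel K) (torusModel n) ∞ (fiberMap σ b B x₀) x := by
  obtain ⟨g, rfl⟩ := proj_surjective σ x
  refine contMDiffAt_of_comp_proj σ g ?_
  simp only [fiberMap_proj σ b B hb hB]
  have h1 : ContMDiffAt 𝓘(ℝ, SolvModel K) 𝓘(ℝ, hyperplane K) ∞
      (fun g => baseLift b x₀ (bundleProj σ b (proj σ g))) g :=
    ContMDiffAt.comp (g := fun y => b.equivFun.symm (torusLift x₀ y)) g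
      (contMDiffAt_equivFun_symm_torusLift b hx) (((contMDiff_bundleProj σ b hb).comp (contMDiff_proj σ)) g)
  have h2 : ContDiffAt ℝ ∞
      (fun g : SolvModel K => (baseLift b x₀ (bundleProj σ b (proj σ g)) - g.1).1) g :=
    ((hyperplane K).subtypeL.contDiff.contDiffAt).comp g
      (h1.contDiffAt.sub contDiff_fst.contDiffAt)
  have h3 := (contDiff_mixedExp.contDiffAt.comp g h2).mul contDiff_snd.contDiffAt
  exact (contMDiff_torusExp_equivFun B).contMDiffAt.comp g h3.contMDiffAt

theorem contMDiffAt_bundleInv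
    (hB : ∀ z, (∃ x : 𝓞 K, z = jEmbedding σ (x : K)) ↔ ∀ i, ∃ k : ℤ, B.repr z i = k)
    {x₀ : Fin m → ℝ} {q : Torus m × Torus n} (hq : q.1 ∈ torusLiftDomain x₀) :
    ContMDiffAt ((torusModel m).prod (torusModel n)) 𝓘(ℝ, SolvModel K) ∞
      (bundleInv σ b B x₀) q := by
  -- The fibre branch is recentred at a lift of q.2, near which it is smooth.
  let x₁ := torusLift 0 q.2
  have h : bundleInv σ b B x₀ = fun q : Torus m × Torus n =>
      proj σ (b.equivFun.symm (torusLift x₀ q.1), B.equivFun.symm (torusLift x₁ q.2)) := by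
    funext q
    have h1 := bundleInv_eq σ b B hB x₀ q.1 (B.equivFun.symm (torusLift x₁ q.2))
    rw [LinearEquiv.apply_symm_apply, torusExp_torusLift] at h1
    exact h1
  rw [h]
  have hq2 : q.2 ∈ torusLiftDomain x₁ := by
    have := mem_torusLiftDomain x₁
    rwa [torusExp_torusLift] at this
  have h1 : ContMDiffAt ((torusModel m).prod (torusModel n)) 𝓘(ℝ, hyperplane K) ∞
      (fun q : Torus m × Torus n => b.equivFun.symm (torusLift x₀ q.1)) q :=
    (contMDiffAt_equivFun_symm_torusLift b hq).comp q contMDiffAt_fst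
  have h2 : ContMDiffAt ((torusModel m).prod (torusModel n)) 𝓘(ℝ, mixedSpace K) ∞
      (fun q : Torus m × Torus n => B.equivFun.symm (torusLift x₁ q.2)) q :=
    (contMDiffAt_equivFun_symm_torusLift B hq2).comp q contMDiffAt_snd
  exact (contMDiff_proj σ _).comp q (h1.prodMk_space h2)

/-- The trivialization of `bundleProj` given by a local section of the universal covering of the
base torus. -/
def bundleTrivialization (hb : ∀ t, t ∈ unitLattice σ ↔ ∀ i, ∃ k : ℤ, b.repr t i = k)
    (hB : ∀ z, (∃ x : 𝓞 K, z = jEmbedding σ (x : K)) ↔ ∀ i, ∃ k : ℤ, B.repr z i = k)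
    (x₀ : Fin m → ℝ) : Bundle.Trivialization (Torus n) (bundleProj σ b) where
  toFun x := (bundleProj σ b x, fiberMap σ b B x₀ x)
  invFun := bundleInv σ b B x₀
  source := bundleProj σ b ⁻¹' torusLiftDomain x₀
  target := torusLiftDomain x₀ ×ˢ univ
  map_source' x hx := ⟨hx, mem_univ _⟩
  map_target' q hq := by
    change bundleProj σ b (bundleInv σ b B x₀ q) ∈ torusLiftDomain x₀
    rw [bundleProj_bundleInv σ b B hb]
    exact hq.1
  left_inv' x _ := bundleInv_bundleProj σ b B hb hB x₀ x
  right_inv' q _ :=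
    Prod.ext (bundleProj_bundleInv σ b B hb x₀ q) (fiberMap_bundleInv σ b B hb hB x₀ q)
  open_source := (isOpen_torusLiftDomain x₀).preimage (contMDiff_bundleProj σ b hb).continuous
  open_target := (isOpen_torusLiftDomain x₀).prod isOpen_univ
  continuousOn_toFun x hx := ((contMDiff_bundleProj σ b hb).continuous.continuousAt.prodMk
    (contMDiffAt_fiberMap σ b B hb hB hx).continuousAt).continuousWithinAt
  continuousOn_invFun q hq := (contMDiffAt_bundleInv σ b B hB hq.1).continuousAt.continuousWithinAt
  baseSet := torusLiftDomain x₀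
  open_baseSet := isOpen_torusLiftDomain x₀
  source_eq := rfl
  target_eq := rfl
  proj_toFun _ _ := rfl

theorem exists_isSmoothFiberBundle (hm : finrank ℚ K = m + 1) :
    ∃ p : NFManifold K σ → Torus m,
      IsSmoothFiberBundle 𝓘(ℝ, SolvModel K) (torusModel m) (torusModel (m + 1))
        (Torus (m + 1)) p := by
  obtain ⟨b, hb⟩ := exists_unitLattice_basis σ hm
  obtain ⟨B, hB⟩ := exists_ringOfIntegers_basis σ hm
  refine ⟨bundleProj σ b, contMDiff_bundleProj σ b hb, fun y =>
    ⟨bundleTrivialization σ b B hb hB (torusLift 0 y), ?_, fun x hx => ?_, fun q hq => ?_⟩⟩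
  · have h := mem_torusLiftDomain (torusLift 0 y)
    rw [torusExp_torusLift] at h
    exact h
  · exact ((contMDiff_bundleProj σ b hb x).prodMk
      (contMDiffAt_fiberMap σ b B hb hB hx)).contMDiffWithinAt
  · exact (contMDiffAt_bundleInv σ b B hB hq.1).contMDiffWithinAt

end TorusBundle

end

theorem theoremC (K : Type u) [Field K] [NumberField K] (n : ℕ) (hn : Module.finrank ℚ K = n)
    (σ : EmbeddingChoice K) :
    -- a solvable Lie group of dimension `2n - 1` with a lattice
    (LieGroup 𝓘(ℝ, SolvModel K) ∞ (SolvGroup K) ∧ Group.IsSolvable (SolvGroup K) ∧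
      Module.finrank ℝ (SolvModel K) = 2 * n - 1 ∧ DiscreteTopology (solvLattice σ)) ∧
    -- the quotient is a closed smooth manifold, locally diffeomorphic to the group
    (CompactSpace (NFManifold K σ) ∧ T2Space (NFManifold K σ) ∧
      SecondCountableTopology (NFManifold K σ) ∧
      IsManifold 𝓘(ℝ, SolvModel K) ∞ (NFManifold K σ) ∧
      IsLocalDiffeomorph 𝓘(ℝ, SolvModel K) 𝓘(ℝ, SolvModel K) ∞ (nfProj σ)) ∧
    -- it is an `n`-torus bundle over an `(n-1)`-torus
    (∃ p : NFManifold K σ → Torus (n - 1),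
      IsSmoothFiberBundle 𝓘(ℝ, SolvModel K) (torusModel (n - 1)) (torusModel n) (Torus n) p) ∧
    -- it carries a contact form, induced by a left-invariant form
    (IsContactForm (n - 1) (nfContactForm σ) ∧
      OneForm.pullback 𝓘(ℝ, SolvModel K) 𝓘(ℝ, SolvModel K) (nfProj σ) (nfContactForm σ) =
        leftInvariantForm (factorCovector 0 1 0 1)) ∧
    -- the contact manifold depends only on the isomorphism class of the field
    (∀ (L : Type v) [Field L] [NumberField L] (σ' : EmbeddingChoice L), Nonempty (K ≃+* L) →
      Contactomorphic (nfContactForm σ) (nfContactForm σ')) ∧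
    -- all left-invariant Liouville forms on the factors, of the given orientation, induce isotopic
    -- contact structures
    (∀ (a c : {w : NumberField.InfinitePlace K // w.IsReal} → ℝ)
      (p q : {w : NumberField.InfinitePlace K // w.IsComplex} → ℂ),
      (∀ w, 0 < c w) → (∀ w, q w ≠ 0) →
      OneForm.pullback 𝓘(ℝ, SolvModel K) 𝓘(ℝ, SolvModel K) (nfProj σ)
          (inducedForm σ (factorCovector a c p q)) =
        leftInvariantForm (factorCovector a c p q) ∧
      IsContactForm (n - 1) (inducedForm σ (factorCovector a c p q)) ∧
      ContactIsotopic (nfContactForm σ) (inducedForm σ (factorCovector a c p q))) ∧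
    -- the Liouville pair
    (Nonempty (K →+* ℝ) →
      ∃ (o : ManifoldOrientation 𝓘(ℝ, SolvModel K) (NFManifold K σ) (2 * (n - 1) + 1))
        (αp αm : OneForm 𝓘(ℝ, SolvModel K) (NFManifold K σ)),
        IsLiouvillePair (n - 1) o αp αm ∧ IsLiouvilleManifold (liouvillePairForm αp αm)) := by
  obtain ⟨m, hm⟩ := exists_finrank_eq_add_one (K := K)
  obtain rfl : m + 1 = n := hm.symm.trans hn
  simp only [Nat.add_sub_cancel]
  refine ⟨⟨lieGroup_solvGroup, isSolvable_solvGroup, ?_, ?_⟩,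
    ⟨compactSpace_nfManifold σ, t2Space_nfManifold σ, secondCountableTopology_nfManifold σ,
      isManifold_nfManifold σ, isLocalDiffeomorph_proj σ⟩, exists_isSmoothFiberBundle σ hm,
    ⟨isContactForm_nfContactForm σ hm, pullback_nfProj_inducedForm σ _⟩,
    fun L _ _ σ' ⟨f⟩ => contactomorphic_of_ringEquiv f σ σ', fun a c p q hc hq =>
      ⟨pullback_nfProj_inducedForm σ _, isContactForm_factorCovector σ hm a c p q
        hc hq, ?_⟩, fun ⟨φ⟩ => ?_⟩
  · rw [finrank_solvModel, hm]
  · exact SetLike.isDiscrete_iff_discreteTopology.1 (isDiscrete_solvLattice σ)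
  · obtain ⟨r, h, hr, hh⟩ := exists_adjointMap_factorCovector a c p q hc hq
    exact contactIsotopic_of_adjointMap σ hr hh
  · let w : InfinitePlace K := InfinitePlace.mk (Complex.ofRealHom.comp φ)
    -- An embedding factoring through ℝ is fixed by conjugation, so its place is real.
    have hw : IsReal w := ⟨_, RingHom.ext fun x => Complex.conj_ofReal (φ x), rfl⟩
    obtain ⟨o, ho⟩ := exists_isLiouvillePair σ ⟨w, hw⟩ hm
    exact ⟨o, _, _, ho, isLiouvilleManifold_pair ⟨w, hw⟩ σ⟩
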